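/- Work with locally Noetherian schemes. Let $S$ be a locally Noetherian scheme, let $\mathscr{A}$ be a quasi-coherent sheaf of commutative $\mathscr{O}_S$-algebras that is locally free of finite rank $n$ as an $\mathscr{O}_S$-module, and let $\delta\ge 0$ be an integer. For a locally Noetherian $S$-scheme $T$ write $\mathscr{A}_T=\mathscr{A}\otimes_{\mathscr{O}_S}\mathscr{O}_T$, and let $F^{\delta}_{\mathscr{A}}(T)$ be the set of quasi-coherent $\mathscr{O}_T$-subalgebras $\mathscr{B}\subseteq\mathscr{A}_T$ such that $\Delta=\mathscr{A}_T/\mathscr{B}$ is locally free of rank $\delta$ over $\mathscr{O}_T$; this is a functor of $T$ by pullback of subalgebras. For an integer $\delta'\ge 0$ let $F^{\delta,\delta'}_{\mathscr{A}}(T)\subseteq F^{\delta}_{\mathscr{A}}(T)$ be the subset of those $\mathscr{B}$ for which the cokernel of the map $$\mathscr{B}\to\underline{\mathrm{Hom}}_{\mathscr{O}_T}(\Delta,\Delta),\qquad b\mapsto(\text{multiplication by }b),$$ is a locally free $\mathscr{O}_T$-module of rank $\delta^2-\delta'$. Then $F^{\delta}_{\mathscr{A}}$ is represented by a locally Noetherian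 $S$-scheme $\mathrm{Ter}^{\delta}_{\mathscr{A}}$, with a universal subalgebra $\mathscr{U}$. Moreover, for every $\delta'\ge 0$ the functor $F^{\delta,\delta'}_{\mathscr{A}}$ is represented by a locally closed subscheme $\mathrm{Ter}^{\delta,\delta'}_{\mathscr{A}}$ of $\mathrm{Ter}^{\delta}_{\mathscr{A}}$, with universal subalgebra the pullback of $\mathscr{U}$. These subschemes are pairwise disjoint and their union, over all $\delta'\ge 0$, is $\mathrm{Ter}^{\delta}_{\mathscr{A}}$ (as sets of points). They are the Fitting ideal strata: if $Q$ is the cokernel of $\mathscr{U}\to\underline{\mathrm{Hom}}(\Delta,\Delta)$ on $\mathrm{Ter}^{\delta}_{\mathscr{A}}$ and $r=\delta^2-\delta'$, then $$\mathrm{Ter}^{\delta,\delta'}_{\mathscr{A}}=V(\mathrm{Fit}_{r-1}(Q))\smallsetminus V(\mathrm{Fit}_{r}(Q)),$$ as an open subscheme of the closed subscheme $V(\mathrm{Fit}_{r-1}(Q))$, where $\mathrm{Fit}_k(Q)$ is the $k$-th Fitting ideal of $Q$, and $\mathrm{Fit}_k(Q)=0$ for $k<0$. -/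

import Mathlib

open CategoryTheory CategoryTheory.Limits AlgebraicGeometry AlgebraicGeometry.Scheme

universe u

/-! ### Commutative algebra -/

/-- For an `R`-subalgebra `B` of `A` and `Δ = A / B`, the `R`-linear map `B → End_R(Δ)` sending `b`
to multiplication by `b`. -/
def Subalgebra.mulQuotient {R A : Type*} [CommRing R] [CommRing A] [Algebra R A]
    (B : Subalgebra R A) : B →ₗ[R] Module.End R (A ⧸ Subalgebra.toSubmodule B) where
  toFun b := Submodule.mapQ _ _ (LinearMap.mulLeft R (b : A)) fun _ hx => B.mul_mem b.2 hx
  map_add' b c := by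
    ext x
    simp [add_mul]
    rfl
  map_smul' r b := by
    ext x
    simp
    rfl

/-- `Q = coker (B → End_R(A / B))`, as an `R`-module. -/
abbrev Subalgebra.CokerMulQuotient {R A : Type*} [CommRing R] [CommRing A] [Algebra R A]
    (B : Subalgebra R A) : Type _ :=
  Module.End R (A ⧸ Subalgebra.toSubmodule B) ⧸ LinearMap.range B.mulQuotient

/-- The `k`-th Fitting ideal of a finitely generated `R`-module `M`: the ideal generated by the
`(N - k) × (N - k)` minors of matrices of relations between `N` generators of `M`. The usual
definition fixes one generating family; the ideal does not depend on it, so that all finite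
generating families are allowed here. For `k < 0` the ideal is zero. -/
def fittingIdeal (R : Type*) (M : Type*) [CommRing R] [AddCommGroup M] [Module R M] (k : ℤ) :
    Ideal R :=
  Ideal.span {d : R | ∃ (N m : ℕ) (x : Fin N → M) (rel : Matrix (Fin m) (Fin N) R)
    (c : Fin m → Fin N), (m : ℤ) + k = N ∧ Submodule.span R (Set.range x) = ⊤ ∧
    (∀ i, ∑ j, rel i j • x j = 0) ∧ d = (rel.submatrix id c).det}

/-! ### Quasi-coherent algebras -/

/-- A quasi-coherent sheaf `𝒜` of (commutative) `𝒪_S`-algebras, given by its sections over affine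
opens and the restriction maps to basic opens; `unit` is the structure map `𝒪_S ⟶ 𝒜`, and
`coequifibered` says that `𝒜(U) ⊗ 𝒪_S(D(f)) = 𝒜(D(f))`. -/
structure QCohAlgebra (S : Scheme.{u}) where
  obj : S.AffineZariskiSiteᵒᵖ ⥤ CommRingCat.{u}
  unit : (AffineZariskiSite.toOpensFunctor S).op ⋙ S.presheaf ⟶ obj
  coequifibered : unit.Coequifibered

/-- The `𝒪_Y`-algebra `p_* 𝒪_X` of a morphism `p : X ⟶ Y`: its sections over `V`. -/
def PushforwardSec {X Y : Scheme.{u}} (p : X ⟶ Y) (V : Y.Opens) : Type u := Γ(X, p ⁻¹ᵁ V)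

noncomputable instance {X Y : Scheme.{u}} (p : X ⟶ Y) (V : Y.Opens) :
    CommRing (PushforwardSec p V) :=
  inferInstanceAs (CommRing Γ(X, p ⁻¹ᵁ V))

noncomputable instance {X Y : Scheme.{u}} (p : X ⟶ Y) (V : Y.Opens) :
    Algebra Γ(Y, V) (PushforwardSec p V) :=
  (p.app V).hom.toAlgebra

/-- For a commutative square `q ≫ p = p' ≫ g` and `V' ⊆ g⁻¹ V`, the pullback of sections
`(p_* 𝒪_X)(V) → (p'_* 𝒪_X')(V')` along `q`. -/
noncomputable def pullSec {X Y X' Y' : Scheme.{u}} {p : X ⟶ Y} {p' : X' ⟶ Y'} {q : X' ⟶ X}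
    {g : Y' ⟶ Y} (w : q ≫ p = p' ≫ g) {V : Y.Opens} {V' : Y'.Opens} (h : V' ≤ g ⁻¹ᵁ V) :
    PushforwardSec p V →+* PushforwardSec p' V' :=
  (q.appLE (p ⁻¹ᵁ V) (p' ⁻¹ᵁ V') (by
    rw [← Scheme.Hom.comp_preimage, w, Scheme.Hom.comp_preimage]
    exact p'.preimage_mono h)).hom

/-- A quasi-coherent `𝒪_Y`-subalgebra of `p_* 𝒪_X` for an affine morphism `p : X ⟶ Y`, given by its
sections over affine opens: for affine `W ⊆ V`, the `𝒪_Y(W)`-module of sections over `W` is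
generated by the restrictions of the sections over `V`. -/
structure QCohSubalgebra {X Y : Scheme.{u}} (p : X ⟶ Y) where
  sec : ∀ V : Y.affineOpens, Subalgebra Γ(Y, V) (PushforwardSec p V)
  span_restrict : ∀ (V W : Y.affineOpens) (h : W.1 ≤ V.1),
    Submodule.span Γ(Y, W)
      (pullSec (p := p) (p' := p) (q := 𝟙 X) (g := 𝟙 Y) (by simp) (V := V) (V' := W) h ''
        (sec V : Set (PushforwardSec p V))) = Subalgebra.toSubmodule (sec W)

namespace QCohAlgebra

variable {S : Scheme.{u}} (𝒜 : QCohAlgebra S)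

/-- `𝒜` is locally free of finite rank `n`. -/
def IsLocallyFreeOfRank (n : ℕ) : Prop :=
  ∀ x : S, ∃ U : S.AffineZariskiSite, x ∈ U.toOpens ∧
    letI : Algebra Γ(S, U.toOpens) (𝒜.obj.obj (.op U)) := (𝒜.unit.app (.op U)).hom.toAlgebra
    Nonempty (Module.Basis (Fin n) Γ(S, U.toOpens) (𝒜.obj.obj (.op U)))

/-- The relative spectrum of `𝒜` over `S`. -/
noncomputable def relSpec : Scheme.{u} :=
  (AffineZariskiSite.relativeGluingData 𝒜.coequifibered).glued

/-- The structure morphism of the relative spectrum. -/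
noncomputable def toBase : 𝒜.relSpec ⟶ S :=
  (AffineZariskiSite.relativeGluingData 𝒜.coequifibered).toBase

/-- `Spec_S(𝒜) ×_S T ⟶ T`, the relative spectrum of `𝒜_T = 𝒜 ⊗ 𝒪_T`. It is affine, and the
pushforward of the structure sheaf along it is the `𝒪_T`-algebra `𝒜_T`. -/
noncomputable abbrev proj (T : Over S) : pullback 𝒜.toBase T.hom ⟶ T.left :=
  pullback.snd 𝒜.toBase T.hom

/-- The morphism `Spec_S(𝒜) ×_S T' ⟶ Spec_S(𝒜) ×_S T` induced by `g : T' ⟶ T`. -/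
noncomputable def projMap {T T' : Over S} (g : T' ⟶ T) :
    pullback 𝒜.toBase T'.hom ⟶ pullback 𝒜.toBase T.hom :=
  pullback.lift (pullback.fst _ _) (pullback.snd _ _ ≫ g.left) (by
    rw [Category.assoc, Over.w, pullback.condition])

lemma projMap_comp_proj {T T' : Over S} (g : T' ⟶ T) :
    𝒜.projMap g ≫ 𝒜.proj T = 𝒜.proj T' ≫ g.left :=
  pullback.lift_snd _ _ _

/-- An element of `F^δ_𝒜(T)`: a quasi-coherent `𝒪_T`-subalgebra `ℬ` of `𝒜_T` such that
`Δ = 𝒜_T / ℬ` is locally free of rank `δ`. -/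
structure Family (T : Over S) (δ : ℕ) extends QCohSubalgebra (𝒜.proj T) where
  corank : ∀ x : T.left, ∃ V : T.left.affineOpens, x ∈ V.1 ∧
    Nonempty (Module.Basis (Fin δ) Γ(T.left, V)
      (PushforwardSec (𝒜.proj T) V ⧸ Subalgebra.toSubmodule (sec V)))

namespace Family

variable {𝒜} {δ : ℕ}

/-- `ℬ'` is the pullback of the family `ℬ` along `g : T' ⟶ T`: over an affine open of `T'` that maps
into an affine open `V` of `T`, it is generated by the pullbacks of the sections of `ℬ` over `V`. -/
def IsPullback {T T' : Over S} (g : T' ⟶ T) (ℬ : 𝒜.Family T δ) (ℬ' : 𝒜.Family T' δ) : Prop :=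
  ∀ (V : T.left.affineOpens) (V' : T'.left.affineOpens) (h : V'.1 ≤ g.left ⁻¹ᵁ V.1),
    Subalgebra.toSubmodule (ℬ'.sec V') =
      Submodule.span Γ(T'.left, V')
        (pullSec (𝒜.projMap_comp_proj g) h '' (ℬ.sec V : Set (PushforwardSec (𝒜.proj T) V)))

/-- Membership in the subset `F^{δ,δ'}_𝒜(T)` of `F^δ_𝒜(T)`: the cokernel of `ℬ → Hom(Δ, Δ)` is
locally free of rank `δ² - δ'`. -/
def HasDeltaPrime {T : Over S} (ℬ : 𝒜.Family T δ) (δ' : ℕ) : Prop :=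
  ∀ x : T.left, ∃ V : T.left.affineOpens, x ∈ V.1 ∧
    ∃ r : ℕ, r + δ' = δ ^ 2 ∧
      Nonempty (Module.Basis (Fin r) Γ(T.left, V) (ℬ.sec V).CokerMulQuotient)

/-- The ideal sheaf of `𝒪_T` whose sections over an affine open `V` are the `k`-th Fitting ideal of
the sections over `V` of the cokernel of `ℬ → Hom(Δ, Δ)`. (These ideals are compatible with
localization, so that the largest ideal sheaf contained in them is given by them.) -/
noncomputable def fittingIdealSheaf {T : Over S} (ℬ : 𝒜.Family T δ) (k : ℤ) :
    T.left.IdealSheafData :=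
  .ofIdeals fun V => fittingIdeal Γ(T.left, V) (ℬ.sec V).CokerMulQuotient k

/-- The closed subscheme `V(Fit_{r-1})` of `T`, where `r = δ² - δ'`. -/
noncomputable abbrev stratumClosure {T : Over S} (ℬ : 𝒜.Family T δ) (δ' : ℕ) :
    T.left.IdealSheafData :=
  ℬ.fittingIdealSheaf ((δ : ℤ) ^ 2 - δ' - 1)

/-- The open complement of `V(Fit_r)` in `T`, where `r = δ² - δ'`. -/
noncomputable def stratumOpen {T : Over S} (ℬ : 𝒜.Family T δ) (δ' : ℕ) : T.left.Opens :=
  (ℬ.fittingIdealSheaf ((δ : ℤ) ^ 2 - δ')).support.compl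

/-- The Fitting stratum `V(Fit_{r-1}) ∖ V(Fit_r)`, `r = δ² - δ'`, an open subscheme of the closed
subscheme `V(Fit_{r-1})`, as an `S`-scheme. -/
noncomputable def stratum {T : Over S} (ℬ : 𝒜.Family T δ) (δ' : ℕ) : Over S :=
  Over.mk (((ℬ.stratumClosure δ').subschemeι ⁻¹ᵁ ℬ.stratumOpen δ').ι ≫
    (ℬ.stratumClosure δ').subschemeι ≫ T.hom)

/-- The inclusion of the Fitting stratum. -/
noncomputable def stratumι {T : Over S} (ℬ : 𝒜.Family T δ) (δ' : ℕ) : ℬ.stratum δ' ⟶ T :=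
  Over.homMk (((ℬ.stratumClosure δ').subschemeι ⁻¹ᵁ ℬ.stratumOpen δ').ι ≫
    (ℬ.stratumClosure δ').subschemeι) (by simp [stratum])

end Family

/-- On locally Noetherian `S`-schemes, the subfunctor of `F^δ_𝒜` given by the condition `P` is
represented by the locally Noetherian `S`-scheme `Z` with universal family `𝒰`: pulling back `𝒰` is
a bijection from the `S`-morphisms `T ⟶ Z` to the families on `T` that satisfy `P`, naturally
in `T`. -/
structure Represents {δ : ℕ} (P : ∀ T : Over S, 𝒜.Family T δ → Prop) (Z : Over S)
    (𝒰 : 𝒜.Family Z δ) : Prop where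
  isLocallyNoetherian : IsLocallyNoetherian Z.left
  prop : P Z 𝒰
  existsUnique_pullback : ∀ T : Over S, IsLocallyNoetherian T.left → ∀ h : T ⟶ Z,
    ∃! ℬ : 𝒜.Family T δ, P T ℬ ∧ Family.IsPullback h 𝒰 ℬ
  existsUnique_hom : ∀ T : Over S, IsLocallyNoetherian T.left → ∀ ℬ : 𝒜.Family T δ, P T ℬ →
    ∃! h : T ⟶ Z, Family.IsPullback h 𝒰 ℬ
  natural : ∀ T T' : Over S, IsLocallyNoetherian T.left → IsLocallyNoetherian T'.left →
    ∀ (g : T' ⟶ T) (h : T ⟶ Z) (ℬ : 𝒜.Family T δ) (ℬ' : 𝒜.Family T' δ),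
      Family.IsPullback h 𝒰 ℬ → Family.IsPullback (g ≫ h) 𝒰 ℬ' → Family.IsPullback g ℬ ℬ'

/-- `Z`, with the universal family `𝒰`, is the territory `Ter^δ_𝒜`: it represents `F^δ_𝒜`. -/
def IsTerritory {δ : ℕ} (Z : Over S) (𝒰 : 𝒜.Family Z δ) : Prop :=
  𝒜.Represents (fun _ _ => True) Z 𝒰

end QCohAlgebra

/-!
The functor of families is representable because it is a Zariski sheaf that is covered by affine
schemes. Over an affine open `U` of `S` on which `𝒜` has a basis `e₁, …, eₙ`, and for a choice `ι`
of `δ` basis vectors, consider the subalgebras `B` of `𝒜_T` such that the classes of the chosen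
vectors are a basis of `𝒜_T / B`. Such a `B` is the kernel of the projection `𝒜_T → 𝒪_T^δ`, that is,
it is given by a `δ × n` matrix. A matrix comes from a subalgebra if and only if its columns at `ι`
form the identity matrix, the kernel contains `1`, and the products of the obvious generators of the
kernel lie in the kernel. These are polynomial equations in the entries, so that the subalgebras are
represented by an affine scheme of finite type over `U`, the chart of `(e, ι)`
(`QCohAlgebra.existsUnique_isPullback_chartFamily`). The condition on the classes is open, as it
says that a determinant is invertible, and its formation commutes with pullback
(`QCohAlgebra.isOpenImmersion_chartMap`); near every point it holds for some `ι`, as one of the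
maximal minors of a surjection onto a free module is invertible
(`QCohAlgebra.isLocallySurjective_chartMap`). Quasi-coherent subalgebras are glued from their
sections over sufficiently small affine opens (`QCohSubalgebra.exists_extension`), so that families
form a Zariski sheaf (`QCohAlgebra.isSheaf_familyFunctor`). Hence the charts glue to the territory
(`QCohAlgebra.exists_isTerritory`).

For the strata, let `Q` be the cokernel of `ℬ → Hom(Δ, Δ)`. The ideals of minors of a module do not
depend on the generators (`relMinors_eq_of_span_eq_top`) and commute with base change
(`IsBaseChange.fittingIdeal_eq_map`). The formation of `Q` commutes with base change too, as `Δ` is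
locally free, and so does the formation of the Fitting ideal sheaves
(`QCohAlgebra.Family.IsPullback.fittingIdealSheaf_eq_comap`). A finitely generated module is locally
free of rank `r` if and only if `Fit_{r-1} = 0` and `Fit_r = 1`: an invertible minor expresses all
generators through `r` of them, and the vanishing of the next larger minors makes these independent
(`nonempty_basis_of_isUnit_det`). It follows that the pullback of a family along `g` has a cokernel
that is locally free of rank `r = δ² - δ'` if and only if the ideal `Fit_{r-1}(Q)` becomes zero and
the ideal `Fit_r(Q)` becomes the unit ideal after pullback along `g`, that is, if and only if `g`
factors through `V(Fit_{r-1}(Q)) ∖ V(Fit_r(Q))` (`QCohAlgebra.Family.IsPullback.hasDeltaPrime_iff`).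
The strata are disjoint because the Fitting ideals increase, and they cover because `Fit_{-1} = 0`
and `Fit_{δ²} = 1`.
-/

/-! ### Fitting ideals -/

section FittingIdeal

/-- A rank-one perturbation of a square matrix has its determinant in every ideal that contains the
minors of the matrix of the next smaller size. -/
lemma Matrix.det_add_mul_mem {R : Type*} [CommRing R] (I : Ideal R) {m : ℕ}
    (W : Matrix (Fin (m + 1)) (Fin (m + 1)) R) (v b : Fin (m + 1) → R)
    (h : ∀ i j : Fin (m + 1), (W.submatrix i.succAbove j.succAbove).det ∈ I) :
    (Matrix.of fun i j => W i j + v i * b j).det ∈ I := by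
  let A : Matrix (Fin (m + 2)) (Fin (m + 2)) R :=
    Matrix.of (Fin.cons (Fin.cons 1 b) fun i => Fin.cons 0 fun j => W i j + v i * b j)
  let B : Matrix (Fin (m + 2)) (Fin (m + 2)) R :=
    Matrix.of (Fin.cons (Fin.cons 1 b) fun i => Fin.cons (-v i) (W i))
  have hA : A.det = (Matrix.of fun i j => W i j + v i * b j).det := by
    rw [Matrix.det_succ_column_zero, Fin.sum_univ_succ]
    have : A.submatrix Fin.succ Fin.succ = Matrix.of fun i j => W i j + v i * b j := by
      ext i j
      simp [A]
    simp [A, ← this]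
  have hAB : A.det = B.det := by
    refine Matrix.det_eq_of_forall_row_eq_smul_add_const (Fin.cons 0 v) 0 (by simp) ?_
    intro i j
    refine Fin.cases ?_ (fun i => ?_) i <;> refine Fin.cases ?_ (fun j => ?_) j <;> simp [A, B]
  have hW : W.det ∈ I := by
    rw [Matrix.det_succ_row_zero]
    exact Ideal.sum_mem _ fun j _ => Ideal.mul_mem_left _ _ (h 0 j)
  rw [← hA, hAB, Matrix.det_succ_row_zero]
  refine Ideal.sum_mem _ fun j _ => Ideal.mul_mem_left _ _ ?_
  refine Fin.cases ?_ (fun j => ?_) j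
  · convert hW
    ext i j
    simp [B]
  · rw [Matrix.det_succ_column_zero]
    refine Ideal.sum_mem _ fun i _ => Ideal.mul_mem_left _ _ ?_
    have : (B.submatrix Fin.succ j.succ.succAbove).submatrix i.succAbove Fin.succ =
        W.submatrix i.succAbove j.succAbove := by
      ext k l
      simp [B]
    rw [this]
    exact h i j

variable {R : Type*} [CommRing R] {M : Type*} [AddCommGroup M] [Module R M]
  {ι κ : Type*} [Fintype ι] [Fintype κ]

/-- The ideal generated by the `m × m` minors of the matrices of relations between the members of a
finite family `x` of elements of a module. -/
def relMinors (x : ι → M) (m : ℕ) : Ideal R :=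
  Ideal.span {d | ∃ (rel : Fin m → ι → R) (c : Fin m → ι),
    (∀ i, ∑ j, rel i j • x j = 0) ∧ d = (Matrix.of fun i j => rel i (c j)).det}

lemma det_mem_relMinors {x : ι → M} {m : ℕ} (rel : Fin m → ι → R) (c : Fin m → ι)
    (h : ∀ i, ∑ j, rel i j • x j = 0) :
    (Matrix.of fun i j => rel i (c j)).det ∈ relMinors (R := R) x m :=
  Ideal.subset_span ⟨rel, c, h, rfl⟩

@[simp] lemma relMinors_zero (x : ι → M) : relMinors (R := R) x 0 = ⊤ := by
  rw [Ideal.eq_top_iff_one]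
  convert! det_mem_relMinors (R := R) (x := x) (m := 0) Fin.elim0 Fin.elim0 (fun i => i.elim0)
  simp

lemma relMinors_succ_le (x : ι → M) (m : ℕ) :
    relMinors (R := R) x (m + 1) ≤ relMinors x m := by
  refine Ideal.span_le.2 ?_
  rintro _ ⟨rel, c, h, rfl⟩
  rw [SetLike.mem_coe, Matrix.det_succ_row_zero]
  refine Ideal.sum_mem _ fun j _ => Ideal.mul_mem_left _ _ ?_
  exact det_mem_relMinors (fun i => rel i.succ) (fun k => c (j.succAbove k)) fun i => h _

lemma relMinors_antitone (x : ι → M) : Antitone (relMinors (R := R) x) :=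
  antitone_nat_of_succ_le (relMinors_succ_le x)

lemma relMinors_eq_bot (x : ι → M) {m : ℕ} (hm : Fintype.card ι < m) :
    relMinors (R := R) x m = ⊥ := by
  refine Ideal.span_eq_bot.2 ?_
  rintro _ ⟨rel, c, -, rfl⟩
  obtain ⟨i, j, hij, h⟩ := Fintype.exists_ne_map_eq_of_card_lt c (by simpa using hm)
  exact Matrix.det_zero_of_column_eq hij fun k => by simp [h]

lemma relMinors_comp_equiv_le (x : ι → M) (e : κ ≃ ι) (m : ℕ) :
    relMinors (R := R) x m ≤ relMinors (x ∘ e) m := by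
  refine Ideal.span_le.2 ?_
  rintro _ ⟨rel, c, h, rfl⟩
  convert! det_mem_relMinors (R := R) (x := x ∘ e) (fun i => rel i ∘ e) (e.symm ∘ c) fun i => ?_
    using 3
  · simp
  · rw [← h i]
    exact Equiv.sum_comp e fun j => rel i j • x j

lemma relMinors_comp_equiv (x : ι → M) (e : κ ≃ ι) (m : ℕ) :
    relMinors (R := R) (x ∘ e) m = relMinors x m := by
  refine le_antisymm ?_ (relMinors_comp_equiv_le x e m)
  convert relMinors_comp_equiv_le (R := R) (x ∘ e) e.symm m
  ext; simp

/-- Adding one redundant member `z = ∑ aⱼ xⱼ` to a family `x` shifts the size of the minors by one.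
In one inclusion the relation `z = ∑ aⱼ xⱼ` is added as a row. In the other one, subtracting
multiples of this row turns a matrix of relations into a rank-one perturbation of relations between
the members of `x`. -/
lemma relMinors_option (x : ι → M) (z : M) (hz : z ∈ Submodule.span R (Set.range x)) (m : ℕ) :
    relMinors (R := R) (fun o : Option ι => o.elim z x) (m + 1) = relMinors x m := by
  obtain ⟨a, rfl⟩ := (Submodule.mem_span_range_iff_exists_fun R).1 hz
  apply le_antisymm
  · refine Ideal.span_le.2 ?_
    rintro _ ⟨rel, c, h, rfl⟩
    let w : Fin (m + 1) → ι → R := fun i l => rel i (some l) + rel i none * a l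
    have hw : ∀ i, ∑ l, w i l • x l = 0 := fun i => by
      have := h i
      rw [Fintype.sum_option] at this
      simp only [Option.elim, Finset.smul_sum] at this
      rw [← this, ← Finset.sum_add_distrib]
      refine Finset.sum_congr rfl fun l _ => ?_
      simp only [w, add_smul, mul_smul]
      abel
    let W : Matrix (Fin (m + 1)) (Fin (m + 1)) R := Matrix.of fun i j => (c j).elim 0 (w i)
    have key := Matrix.det_add_mul_mem (relMinors (R := R) x m) W (fun i => rel i none)
      (fun j => (c j).elim 1 fun l => -a l) fun i j => ?_
    · convert! key using 3
      ext i j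
      rcases hc : c j with - | l <;> simp [W, hc, w]
    · by_cases hn : ∃ k, c (j.succAbove k) = none
      · obtain ⟨k, hk⟩ := hn
        rw [Matrix.det_eq_zero_of_column_eq_zero k fun i => by simp [W, hk]]
        exact zero_mem _
      · push Not at hn
        choose c' hc' using fun k => Option.ne_none_iff_exists'.1 (hn k)
        convert! det_mem_relMinors (R := R) (x := x) (fun k => w (i.succAbove k)) c' fun k => hw _
          using 2
        ext k l
        simp [W, hc']
  · refine Ideal.span_le.2 ?_
    rintro _ ⟨rel, c, h, rfl⟩
    convert! det_mem_relMinors (R := R) (m := m + 1)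
      (x := fun o : Option ι => o.elim (∑ i, a i • x i) x)
      (Fin.cons (fun o => o.elim 1 fun l => -a l) fun i o => o.elim 0 (rel i))
      (Fin.cons none fun j => some (c j)) fun i => ?_ using 1
    · rw [Matrix.det_succ_column_zero, Fin.sum_univ_succ]
      simp
      rfl
    · rw [Fintype.sum_option]
      refine Fin.cases ?_ (fun i => ?_) i
      · simp
      · simpa using h i

lemma relMinors_sumElim_fin (x : ι → M) (m n : ℕ) (y : Fin n → M)
    (hy : ∀ j, y j ∈ Submodule.span R (Set.range x)) :
    relMinors (R := R) (Sum.elim x y) (m + n) = relMinors x m := by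
  induction n with
  | zero =>
    rw [← relMinors_comp_equiv _ (Equiv.sumEmpty ι (Fin 0)).symm]
    rfl
  | succ n ih =>
    rw [← ih (fun j => y j.succ) fun j => hy _,
      ← relMinors_option (Sum.elim x fun j : Fin n => y j.succ) (y 0), ← add_assoc]
    · let e : Option (ι ⊕ Fin n) ≃ ι ⊕ Fin (n + 1) :=
        { toFun := fun o => o.elim (.inr 0) (Sum.map id Fin.succ)
          invFun := Sum.elim (fun i => some (.inl i)) (Fin.cases none fun j => some (.inr j))
          left_inv := by rintro (- | (i | j)) <;> rfl
          right_inv := by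
            rintro (i | j)
            · rfl
            · refine Fin.cases rfl (fun j => rfl) j }
      rw [← relMinors_comp_equiv (Sum.elim x y) e]
      congr 1
      ext (- | (i | j)) <;> rfl
    · refine Submodule.span_mono ?_ (hy 0)
      rintro _ ⟨i, rfl⟩
      exact ⟨.inl i, rfl⟩

/-- Fitting's lemma: the ideals of minors do not depend on the generating family. -/
lemma relMinors_eq_of_span_eq_top {N N' m m' : ℕ} (x : Fin N → M) (y : Fin N' → M)
    (hx : Submodule.span R (Set.range x) = ⊤) (hy : Submodule.span R (Set.range y) = ⊤)
    (h : m + N' = m' + N) : relMinors (R := R) x m = relMinors y m' := by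
  rw [← relMinors_sumElim_fin x m N' y fun j => hx ▸ trivial,
    ← relMinors_sumElim_fin y m' N x fun j => hy ▸ trivial, ← h,
    ← relMinors_comp_equiv (Sum.elim y x) (Equiv.sumComm _ _)]
  congr 1
  ext (i | j) <;> rfl

lemma fittingIdeal_eq_relMinors {N m : ℕ} {k : ℤ} (x : Fin N → M)
    (hx : Submodule.span R (Set.range x) = ⊤) (h : (m : ℤ) + k = N) :
    fittingIdeal R M k = relMinors x m := by
  apply le_antisymm
  · refine Ideal.span_le.2 ?_
    rintro _ ⟨N', m', y, rel, c, h', hy, hrel, rfl⟩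
    rw [relMinors_eq_of_span_eq_top (m' := m') x y hx hy (by omega)]
    exact det_mem_relMinors rel c hrel
  · refine Ideal.span_le.2 ?_
    rintro _ ⟨rel, c, hrel, rfl⟩
    exact Ideal.subset_span ⟨N, m, x, Matrix.of rel, c, h, hx, hrel, rfl⟩

lemma exists_fin_span_eq_top [Module.Finite R M] (r : ℕ) :
    ∃ (m : ℕ) (x : Fin (m + r) → M), Submodule.span R (Set.range x) = ⊤ := by
  obtain ⟨m, x, hx⟩ := Module.Finite.exists_fin (R := R) (M := M)
  refine ⟨m, Fin.append x 0, top_le_iff.1 (hx.ge.trans (Submodule.span_mono ?_))⟩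
  rintro _ ⟨i, rfl⟩
  exact ⟨Fin.castAdd r i, by simp⟩

lemma fittingIdeal_mono [Module.Finite R M] : Monotone (fittingIdeal R M) := by
  intro k l hkl
  obtain ⟨m, x, hx⟩ := exists_fin_span_eq_top (R := R) (M := M) (k.natAbs + l.natAbs)
  obtain ⟨a, ha⟩ := Int.le.dest (show k ≤ ((m + (k.natAbs + l.natAbs) : ℕ) : ℤ) by omega)
  obtain ⟨b, hb⟩ := Int.le.dest (show l ≤ ((m + (k.natAbs + l.natAbs) : ℕ) : ℤ) by omega)
  rw [fittingIdeal_eq_relMinors x hx (m := a) (by omega),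
    fittingIdeal_eq_relMinors x hx (m := b) (by omega)]
  exact relMinors_antitone x (by omega)

lemma fittingIdeal_eq_bot_of_neg {k : ℤ} (hk : k < 0) [Module.Finite R M] :
    fittingIdeal R M k = ⊥ := by
  obtain ⟨m, x, hx⟩ := exists_fin_span_eq_top (R := R) (M := M) 0
  obtain ⟨a, ha⟩ := Int.le.dest (show k ≤ ((m + 0 : ℕ) : ℤ) by omega)
  rw [fittingIdeal_eq_relMinors x hx (m := a) (by omega), relMinors_eq_bot]
  simp; omega

lemma fittingIdeal_basis_eq_top {r : ℕ} (b : Module.Basis (Fin r) R M) :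
    fittingIdeal R M r = ⊤ := by
  rw [fittingIdeal_eq_relMinors (m := 0) b b.span_eq (by simp), relMinors_zero]

lemma fittingIdeal_basis_eq_bot {r : ℕ} (b : Module.Basis (Fin r) R M) :
    fittingIdeal R M (r - 1) = ⊥ := by
  rw [fittingIdeal_eq_relMinors (m := 1) b b.span_eq (by simp)]
  refine Ideal.span_eq_bot.2 ?_
  rintro _ ⟨rel, c, h, rfl⟩
  have := Fintype.linearIndependent_iff.1 b.linearIndependent (rel 0) (h 0) (c 0)
  simpa using this

/-- If an `m × m` minor of a matrix of relations between `m + r` generators is a unit and all the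
minors of size `m + 1` vanish, then the `r` generators that are left out form a basis: they generate
by Cramer's rule, and a relation between them, added as a row, has its coefficients among the minors
of size `m + 1`. -/
lemma nonempty_basis_of_isUnit_det {m r : ℕ} (x : Fin (m + r) → M)
    (hx : Submodule.span R (Set.range x) = ⊤) (rel : Fin m → Fin (m + r) → R)
    (c : Fin m → Fin (m + r)) (hrel : ∀ i, ∑ j, rel i j • x j = 0)
    (hdet : IsUnit (Matrix.of fun i j => rel i (c j)).det)
    (hbot : relMinors (R := R) x (m + 1) = ⊥) : Nonempty (Module.Basis (Fin r) R M) := by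
  cases subsingleton_or_nontrivial R
  · have := Module.subsingleton R M
    exact ⟨Module.Basis.ofEquivFun
      { toFun := 0, invFun := 0, map_add' := by simp, map_smul' := by simp,
        left_inv := fun _ => Subsingleton.elim _ _, right_inv := fun _ => Subsingleton.elim _ _ }⟩
  have hc : Function.Injective c := by
    intro i j hij
    by_contra hne
    exact hdet.ne_zero (Matrix.det_zero_of_column_eq hne fun k => by simp [hij])
  have hcard : Fintype.card ((Set.range c)ᶜ : Set (Fin (m + r))) = r := by
    rw [Fintype.card_compl_set, Set.card_range_of_injective hc]
    simp
  let e : Fin m ⊕ Fin r ≃ Fin (m + r) :=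
    (Equiv.sumCongr (Equiv.ofInjective c hc) (Fintype.equivFinOfCardEq hcard).symm).trans
      (Equiv.Set.sumCompl (Set.range c))
  have he : ∀ i, e (.inl i) = c i := fun i => rfl
  set A := Matrix.of fun i j => rel i (c j) with hA
  let y : Fin r → M := fun j => x (e (.inr j))
  have hli : LinearIndependent R y := by
    rw [Fintype.linearIndependent_iff]
    intro s hs j
    let row : Fin (m + r) → R := fun l => Sum.elim 0 s (e.symm l)
    have hrow : ∑ l, row l • x l = 0 := by
      rw [← Equiv.sum_comp e, Fintype.sum_sum_type]
      simpa [row] using hs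
    have h := det_mem_relMinors (R := R) (x := x) (m := m + 1) (Fin.cons row rel)
      (Fin.cons (e (.inr j)) c) (Fin.cases hrow hrel)
    rw [hbot, Ideal.mem_bot, Matrix.det_succ_row_zero, Fin.sum_univ_succ] at h
    have h0 : ∀ i, row (c i) = 0 := fun i => by simp [row, ← he]
    have hj : row (e (.inr j)) = s j := by simp [row]
    simp only [Fin.val_zero, pow_zero, one_mul, Matrix.of_apply, Fin.cons_zero, hj, Fin.cons_succ,
      h0, mul_zero, zero_mul, Finset.sum_const_zero, add_zero] at h
    exact (hdet.mul_left_eq_zero).1 h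
  have hspan : ⊤ ≤ Submodule.span R (Set.range y) := by
    rw [← hx, Submodule.span_le]
    rintro _ ⟨l, rfl⟩
    obtain ⟨k | j, rfl⟩ := e.surjective l
    · have hmem : ∀ i, ∑ k, A i k • x (c k) ∈ Submodule.span R (Set.range y) := fun i => by
        have h := hrel i
        rw [← Equiv.sum_comp e, Fintype.sum_sum_type] at h
        change ∑ k, A i k • x (c k) + ∑ j, rel i (e (.inr j)) • y j = 0 at h
        rw [eq_neg_of_add_eq_zero_left h]
        exact neg_mem (sum_mem fun j _ => Submodule.smul_mem _ _ (Submodule.subset_span ⟨j, rfl⟩))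
      have hk : A.det • x (c k) = ∑ i, A.adjugate k i • ∑ k', A i k' • x (c k') := by
        simp only [Finset.smul_sum, smul_smul]
        rw [Finset.sum_comm]
        simp only [← Finset.sum_smul, ← Matrix.mul_apply, Matrix.adjugate_mul, Matrix.smul_apply,
          Matrix.one_apply, smul_eq_mul, mul_ite, mul_one, mul_zero, ite_smul, zero_smul,
          Finset.sum_ite_eq, Finset.mem_univ, if_true]
      have h := sum_mem fun i (_ : i ∈ Finset.univ) =>
        Submodule.smul_mem _ (A.adjugate k i) (hmem i)
      rw [← hk] at h
      exact (Submodule.smul_mem_iff_of_isUnit _ hdet).1 h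
    · exact Submodule.subset_span ⟨j, rfl⟩
  exact ⟨Module.Basis.mk hli hspan⟩

section BaseChange

variable {R' : Type*} [CommRing R'] [Algebra R R'] {M' : Type*} [AddCommGroup M'] [Module R M']
  [Module R' M'] [IsScalarTower R R' M'] {j : M →ₗ[R] M'}

/-- A minor of a matrix whose rows lie in the span of a set of vectors is a linear combination of
minors of matrices with rows in the set. -/
lemma det_mem_of_mem_span {ι : Type*} (s : Set (ι → R)) (I : Ideal R) {m : ℕ} (c : Fin m → ι)
    (hI : ∀ rel : Fin m → ι → R, (∀ i, rel i ∈ s) → (Matrix.of fun i j => rel i (c j)).det ∈ I)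
    (rel : Fin m → ι → R) (hrel : ∀ i, rel i ∈ Submodule.span R s) :
    (Matrix.of fun i j => rel i (c j)).det ∈ I := by
  classical
  suffices ∀ (t : Finset (Fin m)) (rel : Fin m → ι → R), (∀ i ∈ t, rel i ∈ Submodule.span R s) →
      (∀ i ∉ t, rel i ∈ s) → (Matrix.of fun i j => rel i (c j)).det ∈ I from
    this Finset.univ rel (fun i _ => hrel i) (by simp)
  intro t
  induction t using Finset.induction_on with
  | empty => exact fun rel _ h => hI rel fun i => h i (by simp)
  | insert a t hat ih =>
    intro rel h₁ h₂
    -- linearity of the determinant in the row `a`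
    let φ : (ι → R) →ₗ[R] R :=
      (Matrix.detRowAlternating (R := R) (n := Fin m)).toMultilinearMap.toLinearMap
        (fun i j => rel i (c j)) a ∘ₗ LinearMap.funLeft R R c
    have hφ : ∀ v, φ v = (Matrix.of fun i j => (Function.update rel a v) i (c j)).det := by
      intro v
      simp only [φ, LinearMap.comp_apply, MultilinearMap.toLinearMap_apply]
      change Matrix.det _ = _
      congr 1
      ext i j
      rcases eq_or_ne i a with rfl | hi <;> simp [LinearMap.funLeft, *]
    have : Submodule.span R s ≤ Submodule.comap φ I := by
      refine Submodule.span_le.2 fun v hv => ?_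
      change φ v ∈ I
      rw [hφ]
      refine ih _ (fun i hi => ?_) fun i hi => ?_
      · rw [Function.update_of_ne (by rintro rfl; exact hat hi)]
        exact h₁ i (by simp [hi])
      · rcases eq_or_ne i a with rfl | hia
        · simpa using hv
        · rw [Function.update_of_ne hia]
          exact h₂ i (by simp [hi, hia])
    have h := this (h₁ a (by simp))
    change φ _ ∈ I at h
    rwa [hφ, Function.update_eq_self] at h

/-- The relations between the images of a generating family under a base change are generated by the
relations between its members. -/
lemma IsBaseChange.mem_span_relations (hj : IsBaseChange R' j) {x : ι → M}
    (hx : Submodule.span R (Set.range x) = ⊤) (a : ι → R') (ha : ∑ i, a i • j (x i) = 0) :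
    a ∈ Submodule.span R' ((fun (r : ι → R) i => algebraMap R R' (r i)) ''
      {r | ∑ i, r i • x i = 0}) := by
  classical
  let g : (ι → R) →ₗ[R] M := Fintype.linearCombination R x
  have hg : Function.Surjective g := by
    rw [← LinearMap.range_eq_top, Fintype.range_linearCombination, hx]
  have hex : Function.Exact (LinearMap.ker g).subtype g := by
    rw [LinearMap.exact_iff, Submodule.range_subtype]
  have hex' := lTensor_exact R' hex hg
  let t : TensorProduct R R' (ι → R) := ∑ i, a i ⊗ₜ Pi.single i 1
  have ht : LinearMap.lTensor R' g t = 0 := by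
    apply hj.equiv.injective
    simp only [t, map_sum, LinearMap.lTensor_tmul, hj.equiv_tmul, map_zero]
    rw [← ha]
    simp [g, Fintype.linearCombination_apply]
  obtain ⟨s, hs⟩ := (hex' t).1 ht
  let θ : TensorProduct R R' (ι → R) →ₗ[R] (ι → R') :=
    TensorProduct.lift (LinearMap.mk₂ R (fun (b : R') (v : ι → R) i => v i • b)
      (fun _ _ _ => funext fun _ => smul_add _ _ _)
      (fun _ _ _ => funext fun _ => smul_comm _ _ _)
      (fun _ _ _ => funext fun _ => add_smul _ _ _)
      (fun _ _ _ => funext fun _ => mul_smul _ _ _))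
  have hθ : ∀ b v, θ (b ⊗ₜ v) = fun i => v i • b := fun b v => rfl
  have hθt : θ t = a := by
    ext i
    simp [t, hθ, Finset.sum_apply, Pi.single_apply]
  rw [← hθt, ← hs]
  clear hs hθt
  induction s with
  | zero => simp
  | add s₁ s₂ h₁ h₂ => simpa using add_mem h₁ h₂
  | tmul b r =>
    rw [LinearMap.lTensor_tmul, hθ]
    have h := Submodule.smul_mem _ b (Submodule.subset_span (R := R')
      (Set.mem_image_of_mem (fun (r : ι → R) i => algebraMap R R' (r i)) r.2))
    convert! h using 1
    exact funext fun i => by simp [Algebra.smul_def, mul_comm]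

lemma IsBaseChange.span_range_eq_top (hj : IsBaseChange R' j) {ι : Type*} {x : ι → M}
    (hx : Submodule.span R (Set.range x) = ⊤) :
    Submodule.span R' (Set.range (j ∘ x)) = ⊤ := by
  rw [eq_top_iff]
  rintro y -
  induction y using hj.inductionOn with
  | zero => simp
  | add a b ha hb => exact add_mem ha hb
  | smul r a ha => exact Submodule.smul_mem _ _ ha
  | tmul m =>
    have : m ∈ Submodule.span R (Set.range x) := hx ▸ trivial
    have h := Submodule.mem_map_of_mem (f := j) this
    rw [Submodule.map_span, ← Set.range_comp] at h
    exact Submodule.span_subset_span R R' _ h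

lemma IsBaseChange.relMinors_comp (hj : IsBaseChange R' j) {x : ι → M}
    (hx : Submodule.span R (Set.range x) = ⊤) (m : ℕ) :
    relMinors (R := R') (j ∘ x) m = (relMinors (R := R) x m).map (algebraMap R R') := by
  have hdet : ∀ (rel : Fin m → ι → R) (c : Fin m → ι),
      (Matrix.of fun i j => algebraMap R R' (rel i (c j))).det =
        algebraMap R R' (Matrix.of fun i j => rel i (c j)).det := by
    intro rel c
    rw [RingHom.map_det]
    rfl
  apply le_antisymm
  · refine Ideal.span_le.2 ?_
    rintro _ ⟨rel, c, h, rfl⟩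
    refine det_mem_of_mem_span _ _ c (fun rel' h' => ?_) rel
      fun i => hj.mem_span_relations hx (rel i) (h i)
    choose r hr hr' using h'
    obtain rfl : rel' = fun i l => algebraMap R R' (r i l) := by
      ext i l
      rw [← hr' i]
    rw [hdet]
    exact Ideal.mem_map_of_mem _ (det_mem_relMinors r c hr)
  · rw [relMinors, Ideal.map_span]
    refine Ideal.span_le.2 ?_
    rintro _ ⟨_, ⟨rel, c, h, rfl⟩, rfl⟩
    rw [← hdet]
    refine det_mem_relMinors (fun i l => algebraMap R R' (rel i l)) c fun i => ?_
    simp only [Function.comp_apply, algebraMap_smul, ← map_smul, ← map_sum, h i, map_zero]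

/-- The Fitting ideals commute with base change. -/
lemma IsBaseChange.fittingIdeal_eq_map [Module.Finite R M] (hj : IsBaseChange R' j) (k : ℤ) :
    fittingIdeal R' M' k = (fittingIdeal R M k).map (algebraMap R R') := by
  obtain ⟨m, x, hx⟩ := exists_fin_span_eq_top (R := R) (M := M) k.natAbs
  obtain ⟨a, ha⟩ := Int.le.dest (show k ≤ ((m + k.natAbs : ℕ) : ℤ) by omega)
  rw [fittingIdeal_eq_relMinors x hx (m := a) (by omega),
    fittingIdeal_eq_relMinors (j ∘ x) (hj.span_range_eq_top hx) (m := a) (by omega),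
    hj.relMinors_comp hx]

/-- If `Fit_{r-1}(M) = 0` and `Fit_r(M) = R`, then `M` is locally free of rank `r`. -/
lemma exists_notMem_nonempty_basis_of_fittingIdeal [Module.Finite R M] (r : ℕ)
    (h₁ : fittingIdeal R M (r - 1) = ⊥) (h₂ : fittingIdeal R M r = ⊤) (p : Ideal R) [p.IsPrime] :
    ∃ f ∉ p, ∀ (R' : Type u) [CommRing R'] [Algebra R R'] (M' : Type u) [AddCommGroup M']
      [Module R M'] [Module R' M'] [IsScalarTower R R' M'] (j : M →ₗ[R] M'), IsBaseChange R' j →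
      IsUnit (algebraMap R R' f) → Nonempty (Module.Basis (Fin r) R' M') := by
  obtain ⟨m, x, hx⟩ := exists_fin_span_eq_top (R := R) (M := M) r
  rw [fittingIdeal_eq_relMinors (m := m) x hx (by simp)] at h₂
  rw [fittingIdeal_eq_relMinors (m := m + 1) x hx (by push_cast; ring)] at h₁
  have : ¬ relMinors (R := R) x m ≤ p := fun h => Ideal.IsPrime.ne_top' (top_le_iff.1 (h₂ ▸ h))
  rw [relMinors, Ideal.span_le, Set.not_subset] at this
  obtain ⟨_, ⟨rel, c, hrel, rfl⟩, hp⟩ := this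
  refine ⟨_, hp, ?_⟩
  intro R' _ _ M' _ _ _ _ j hj hu
  refine nonempty_basis_of_isUnit_det (j ∘ x) (hj.span_range_eq_top hx)
    (fun i l => algebraMap R R' (rel i l)) c (fun i => ?_) ?_ ?_
  · simp only [Function.comp_apply, algebraMap_smul, ← map_smul, ← map_sum, hrel i, map_zero]
  · rw [RingHom.map_det] at hu
    exact hu
  · rw [hj.relMinors_comp hx, h₁, Ideal.map_bot]

end BaseChange

end FittingIdeal

/-! ### Base change of quotients by subalgebras -/

section Quotient

variable {R R' : Type*} [CommRing R] [CommRing R'] [Algebra R R']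

section

variable {A A' : Type*} [AddCommGroup A] [AddCommGroup A'] [Module R A] [Module R A'] [Module R' A']
  [IsScalarTower R R' A'] {j : A →ₗ[R] A'} {B : Submodule R A} {B' : Submodule R' A'}

/-- The map `A / B → A' / B'` induced by `j : A → A'` when `B'` is generated by the image of `B`. -/
def quotientMapOfSpan (j : A →ₗ[R] A') (hB : B' = Submodule.span R' (j '' B)) :
    A ⧸ B →ₗ[R] A' ⧸ B' :=
  B.liftQ (B'.mkQ.restrictScalars R ∘ₗ j) fun b hb => by
    rw [LinearMap.mem_ker, LinearMap.comp_apply, LinearMap.restrictScalars_apply,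
      Submodule.mkQ_apply, Submodule.Quotient.mk_eq_zero, hB]
    exact Submodule.subset_span ⟨b, hb, rfl⟩

@[simp] lemma quotientMapOfSpan_mk (hB : B' = Submodule.span R' (j '' B)) (a : A) :
    quotientMapOfSpan j hB (Submodule.Quotient.mk a) = Submodule.Quotient.mk (j a) := rfl

lemma IsBaseChange.quotientMapOfSpan (hj : IsBaseChange R' j)
    (hB : B' = Submodule.span R' (j '' B)) : IsBaseChange R' (quotientMapOfSpan j hB) := by
  let f' : TensorProduct R R' B →ₗ[R'] A' := hj.equiv.toLinearMap ∘ₗ B.subtype.baseChange R'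
  have hf' : ∀ r b, f' (r ⊗ₜ b) = r • j b := fun r b => by simp [f', hj.equiv_tmul]
  refine IsBaseChange.of_right_exact R' (TensorProduct.mk R R' B 1) j _ (f := B.subtype)
    (g := B.mkQ) (f' := f') (g' := B'.mkQ) ?_ ?_ (TensorProduct.isBaseChange R B R') hj ?_
    B.mkQ_surjective ?_ B'.mkQ_surjective
  · ext b
    simp [hf']
  · ext a
    rfl
  · rw [LinearMap.exact_iff, Submodule.ker_mkQ, Submodule.range_subtype]
  · rw [LinearMap.exact_iff, Submodule.ker_mkQ, hB]
    apply le_antisymm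
    · refine Submodule.span_le.2 ?_
      rintro _ ⟨b, hb, rfl⟩
      exact ⟨1 ⊗ₜ ⟨b, hb⟩, by simp [hf']⟩
    · rintro _ ⟨t, rfl⟩
      induction t with
      | zero => simp
      | add s t hs ht => simpa using add_mem hs ht
      | tmul r b =>
        rw [hf']
        exact Submodule.smul_mem _ _ (Submodule.subset_span ⟨b, b.2, rfl⟩)

end

/-- The formation of the endomorphisms of a finitely presented module commutes with flat base
change. -/
lemma IsBaseChange.exists_end_of_flat {M M' : Type*} [AddCommGroup M] [AddCommGroup M'] [Module R M]
    [Module R M'] [Module R' M'] [IsScalarTower R R' M'] [Module.Flat R R']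
    [Module.FinitePresentation R M] {q : M →ₗ[R] M'} (hq : IsBaseChange R' q) :
    ∃ k : Module.End R M →ₗ[R] Module.End R' M',
      IsBaseChange R' k ∧ ∀ φ x, k φ (q x) = q (φ x) := by
  have h := Module.FinitePresentation.isBaseChange_map R M M R'
  refine ⟨(hq.equiv.conj.toLinearMap.restrictScalars R) ∘ₗ LinearMap.baseChangeHom R R' M M,
    IsBaseChange.of_equiv (h.equiv.trans hq.equiv.conj) fun φ => ?_, fun φ x => ?_⟩
  · simp [h.equiv_tmul]
  · have : hq.equiv.symm (q x) = 1 ⊗ₜ x := by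
      rw [LinearEquiv.symm_apply_eq]; simp [hq.equiv_tmul]
    simp [LinearEquiv.conj_apply, this, hq.equiv_tmul]

variable {A A' : Type*} [CommRing A] [CommRing A'] [Algebra R A] [Algebra R A'] [Algebra R' A']
  [IsScalarTower R R' A'] {j : A →ₐ[R] A'} {B : Subalgebra R A} {B' : Subalgebra R' A'}

lemma Subalgebra.mulQuotient_mk (b : B) (a : A) :
    B.mulQuotient b (Submodule.Quotient.mk a) = Submodule.Quotient.mk (b * a) := rfl

/-- The formation of `coker (B → End(A / B))` commutes with a base change for which the formation of
`End(A / B)` does. -/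
lemma IsBaseChange.exists_cokerMulQuotient
    (hB : Subalgebra.toSubmodule B' = Submodule.span R' (j.toLinearMap '' Subalgebra.toSubmodule B))
    (hq : IsBaseChange R' (_root_.quotientMapOfSpan j.toLinearMap hB))
    (k : Module.End R (A ⧸ Subalgebra.toSubmodule B) →ₗ[R]
      Module.End R' (A' ⧸ Subalgebra.toSubmodule B')) (hk : IsBaseChange R' k)
    (hkq : ∀ φ x, k φ (_root_.quotientMapOfSpan j.toLinearMap hB x) =
      _root_.quotientMapOfSpan j.toLinearMap hB (φ x)) :
    ∃ l : B.CokerMulQuotient →ₗ[R] B'.CokerMulQuotient, IsBaseChange R' l := by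
  have hjB : ∀ b : B, j b ∈ B' := fun b => by
    rw [← Subalgebra.mem_toSubmodule, hB]
    exact Submodule.subset_span ⟨b, b.2, rfl⟩
  have hkb : ∀ b : B, k (B.mulQuotient b) = B'.mulQuotient ⟨j b, hjB b⟩ := by
    intro b
    refine hq.algHom_ext _ _ fun x => ?_
    obtain ⟨a, rfl⟩ := Submodule.Quotient.mk_surjective _ x
    rw [hkq, Subalgebra.mulQuotient_mk, quotientMapOfSpan_mk, quotientMapOfSpan_mk,
      Subalgebra.mulQuotient_mk]
    simp
  refine ⟨_, hk.quotientMapOfSpan (B := LinearMap.range B.mulQuotient)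
    (B' := LinearMap.range B'.mulQuotient) ?_⟩
  apply le_antisymm
  · rintro _ ⟨⟨b', hb'⟩, rfl⟩
    have hb : b' ∈ Submodule.span R' (j.toLinearMap '' Subalgebra.toSubmodule B) := hB ▸ hb'
    have : ∀ b'' (h : b'' ∈ B'),
        b'' ∈ Submodule.span R' (j.toLinearMap '' Subalgebra.toSubmodule B) →
        B'.mulQuotient ⟨b'', h⟩ ∈ Submodule.span R' (k '' LinearMap.range B.mulQuotient) := by
      intro b'' h hs
      induction hs using Submodule.span_induction with
      | mem x hx =>
        obtain ⟨b, hb, rfl⟩ := hx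
        exact Submodule.subset_span ⟨_, ⟨⟨b, hb⟩, rfl⟩, hkb ⟨b, hb⟩⟩
      | zero =>
        change B'.mulQuotient 0 ∈ _
        rw [map_zero]
        exact zero_mem _
      | add x y hx hy hx' hy' =>
        have h₁ : x ∈ B' := by rw [← Subalgebra.mem_toSubmodule, hB]; exact hx
        have h₂ : y ∈ B' := by rw [← Subalgebra.mem_toSubmodule, hB]; exact hy
        have := add_mem (hx' h₁) (hy' h₂)
        rwa [← map_add] at this
      | smul r x hx hx' =>
        have h₁ : x ∈ B' := by rw [← Subalgebra.mem_toSubmodule, hB]; exact hx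
        have := Submodule.smul_mem _ r (hx' h₁)
        rwa [← map_smul] at this
    exact this b' hb' hb
  · refine Submodule.span_le.2 ?_
    rintro _ ⟨_, ⟨b, rfl⟩, rfl⟩
    exact ⟨_, (hkb b).symm⟩

lemma IsBaseChange.exists_cokerMulQuotient_of_basis {δ : ℕ}
    (c : Module.Basis (Fin δ) R (A ⧸ Subalgebra.toSubmodule B)) (hj : IsBaseChange R' j.toLinearMap)
    (hB : Subalgebra.toSubmodule B' =
      Submodule.span R' (j.toLinearMap '' Subalgebra.toSubmodule B)) :
    ∃ l : B.CokerMulQuotient →ₗ[R] B'.CokerMulQuotient, IsBaseChange R' l := by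
  have := Module.Free.of_basis c
  have := Module.Finite.of_basis c
  have hq := hj.quotientMapOfSpan hB
  exact IsBaseChange.exists_cokerMulQuotient hB hq _ hq.end fun φ x => hq.endHom_comp_apply φ x

lemma IsBaseChange.exists_cokerMulQuotient_of_flat [Module.Flat R R']
    [Module.FinitePresentation R (A ⧸ Subalgebra.toSubmodule B)]
    (hj : IsBaseChange R' j.toLinearMap)
    (hB : Subalgebra.toSubmodule B' =
      Submodule.span R' (j.toLinearMap '' Subalgebra.toSubmodule B)) :
    ∃ l : B.CokerMulQuotient →ₗ[R] B'.CokerMulQuotient, IsBaseChange R' l := by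
  have hq := hj.quotientMapOfSpan hB
  obtain ⟨k, hk, hkq⟩ := hq.exists_end_of_flat
  exact IsBaseChange.exists_cokerMulQuotient hB hq k hk hkq

end Quotient

/-! ### Base change of algebras along ring homomorphisms -/

section IsAlgBaseChange

variable {R R' A A' : Type*} [CommRing R] [CommRing R'] [CommRing A] [CommRing A'] [Algebra R A]
  [Algebra R' A']

lemma RingHom.map_smul_of_comp_eq {f : R →+* R'} {ψ : A →+* A'}
    (w : ψ.comp (algebraMap R A) = (algebraMap R' A').comp f) (r : R) (a : A) :
    ψ (r • a) = f r • ψ a := by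
  have := RingHom.congr_fun w r
  simp only [RingHom.comp_apply] at this
  rw [Algebra.smul_def, map_mul, this, Algebra.smul_def]

lemma RingHom.map_mem_span_of_comp_eq {f : R →+* R'} {ψ : A →+* A'}
    (w : ψ.comp (algebraMap R A) = (algebraMap R' A').comp f) {s : Set A} {a : A}
    (ha : a ∈ Submodule.span R s) : ψ a ∈ Submodule.span R' (ψ '' s) := by
  induction ha using Submodule.span_induction with
  | mem x hx => exact Submodule.subset_span ⟨x, hx, rfl⟩
  | zero => simp
  | add x y _ _ hx hy => simpa using add_mem hx hy
  | smul r x _ hx =>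
    rw [RingHom.map_smul_of_comp_eq w]
    exact Submodule.smul_mem _ _ hx

lemma RingHom.span_image_span_of_comp_eq {f : R →+* R'} {ψ : A →+* A'}
    (w : ψ.comp (algebraMap R A) = (algebraMap R' A').comp f) (s : Set A) :
    Submodule.span R' (ψ '' (Submodule.span R s : Set A)) = Submodule.span R' (ψ '' s) := by
  apply le_antisymm
  · refine Submodule.span_le.2 ?_
    rintro _ ⟨a, ha, rfl⟩
    exact RingHom.map_mem_span_of_comp_eq w ha
  · exact Submodule.span_mono (Set.image_mono Submodule.subset_span)

/-- The `R'`-subalgebra of `A'` generated by the image of a subalgebra `B` of `A` under a ring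
homomorphism `ψ : A → A'`. -/
def Subalgebra.mapSpan (ψ : A →+* A') (R' : Type*) [CommRing R'] [Algebra R' A']
    (B : Subalgebra R A) : Subalgebra R' A' :=
  Algebra.adjoin R' (ψ '' B)

lemma Subalgebra.toSubmodule_mapSpan (ψ : A →+* A') (B : Subalgebra R A) :
    Subalgebra.toSubmodule (B.mapSpan ψ R') = Submodule.span R' (ψ '' B) := by
  have : (ψ '' B : Set A') = (B.toSubmonoid.map (ψ : A →* A') : Set A') := rfl
  rw [mapSpan, Algebra.adjoin_eq_span, this, Submonoid.closure_eq]

/-- A ring homomorphism `ψ : A → A'` from an `R`-algebra to an `R'`-algebra that lies over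
`f : R → R'` and identifies `A'` with `R' ⊗ A`. -/
def IsAlgBaseChange (f : R →+* R') (ψ : A →+* A') : Prop :=
  ∃ w : ψ.comp (algebraMap R A) = (algebraMap R' A').comp f,
    letI := f.toAlgebra
    letI := ((algebraMap R' A').comp f).toAlgebra
    haveI : IsScalarTower R R' A' := .of_algebraMap_eq' rfl
    IsBaseChange R' (AlgHom.mk ψ (RingHom.congr_fun w) : A →ₐ[R] A').toLinearMap

namespace IsAlgBaseChange

variable {f : R →+* R'} {ψ : A →+* A'} (h : IsAlgBaseChange f ψ)
include h

lemma exists_basis {ι : Type*} (e : Module.Basis ι R A) :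
    ∃ e' : Module.Basis ι R' A', ∀ i, e' i = ψ (e i) := by
  let := f.toAlgebra
  let := ((algebraMap R' A').comp f).toAlgebra
  have : IsScalarTower R R' A' := .of_algebraMap_eq' rfl
  obtain ⟨w, h⟩ := h
  exact ⟨h.basis e, h.basis_apply e⟩

lemma exists_quotient_basis {B : Submodule R A} {B' : Submodule R' A'}
    (hB : B' = Submodule.span R' (ψ '' B)) {ι : Type*} (c : Module.Basis ι R (A ⧸ B)) :
    ∃ c' : Module.Basis ι R' (A' ⧸ B'), ∀ a i,
      c'.repr (Submodule.Quotient.mk (ψ a)) i = f (c.repr (Submodule.Quotient.mk a) i) := by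
  let := f.toAlgebra
  let := ((algebraMap R' A').comp f).toAlgebra
  have : IsScalarTower R R' A' := .of_algebraMap_eq' rfl
  obtain ⟨w, h⟩ := h
  have hq := h.quotientMapOfSpan (B := B) (B' := B') hB
  refine ⟨hq.basis c, fun a i => ?_⟩
  have := hq.basis_repr_comp_apply c (Submodule.Quotient.mk a) i
  exact this

variable {B : Subalgebra R A} {B' : Subalgebra R' A'}

lemma fittingIdeal_of_basis (hB : Subalgebra.toSubmodule B' = Submodule.span R' (ψ '' B)) {δ : ℕ}
    (c : Module.Basis (Fin δ) R (A ⧸ Subalgebra.toSubmodule B)) (k : ℤ) :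
    fittingIdeal R' B'.CokerMulQuotient k = (fittingIdeal R B.CokerMulQuotient k).map f := by
  let := f.toAlgebra
  let := ((algebraMap R' A').comp f).toAlgebra
  have : IsScalarTower R R' A' := .of_algebraMap_eq' rfl
  obtain ⟨w, h⟩ := h
  obtain ⟨l, hl⟩ := h.exists_cokerMulQuotient_of_basis c hB
  have := Module.Free.of_basis c
  have := Module.Finite.of_basis c
  exact hl.fittingIdeal_eq_map k

lemma fittingIdeal_of_flat (hB : Subalgebra.toSubmodule B' = Submodule.span R' (ψ '' B))
    (hf : f.Flat) [IsNoetherianRing R] [Module.Finite R (A ⧸ Subalgebra.toSubmodule B)] (k : ℤ) :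
    fittingIdeal R' B'.CokerMulQuotient k = (fittingIdeal R B.CokerMulQuotient k).map f := by
  let := f.toAlgebra
  let := ((algebraMap R' A').comp f).toAlgebra
  have : IsScalarTower R R' A' := .of_algebraMap_eq' rfl
  obtain ⟨w, h⟩ := h
  have : Module.Flat R R' := hf
  have : Module.FinitePresentation R (A ⧸ Subalgebra.toSubmodule B) :=
    Module.finitePresentation_of_finite R _
  obtain ⟨l, hl⟩ := h.exists_cokerMulQuotient_of_flat hB
  have : Module.Finite R (Module.End R (A ⧸ Subalgebra.toSubmodule B)) := inferInstance
  exact hl.fittingIdeal_eq_map k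

/-- If `s` lies in the localization of `N` at `g`, then a power of `g` multiplies `s` into `N`. -/
lemma exists_pow_smul_mem {g : R} (hf : letI := f.toAlgebra; IsLocalization.Away g R')
    (N : Submodule R A) (s : A) (hs : ψ s ∈ Submodule.span R' (ψ '' N)) :
    ∃ k : ℕ, g ^ k • s ∈ N := by
  let := f.toAlgebra
  let := ((algebraMap R' A').comp f).toAlgebra
  have : IsScalarTower R R' A' := .of_algebraMap_eq' rfl
  obtain ⟨w, h⟩ := h
  have : IsLocalization (Submonoid.powers g) R' := hf
  have hq := h.quotientMapOfSpan (B := N) rfl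
  rw [← isLocalizedModule_iff_isBaseChange (Submonoid.powers g)] at hq
  have h0 : quotientMapOfSpan (B := N) (R' := R')
      (AlgHom.mk ψ (RingHom.congr_fun w) : A →ₐ[R] A').toLinearMap rfl
      (Submodule.Quotient.mk s) = 0 := by
    rw [quotientMapOfSpan_mk, Submodule.Quotient.mk_eq_zero]
    exact hs
  obtain ⟨⟨_, k, rfl⟩, hk⟩ := (IsLocalizedModule.eq_zero_iff (Submonoid.powers g) _).1 h0
  refine ⟨k, ?_⟩
  rwa [← Submodule.Quotient.mk_eq_zero, Submodule.Quotient.mk_smul]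

lemma exists_pow_smul_eq {g : R} (hf : letI := f.toAlgebra; IsLocalization.Away g R') (s : A') :
    ∃ (k : ℕ) (a : A), ψ a = f g ^ k • s := by
  let := f.toAlgebra
  let := ((algebraMap R' A').comp f).toAlgebra
  have : IsScalarTower R R' A' := .of_algebraMap_eq' rfl
  obtain ⟨w, h⟩ := h
  have : IsLocalization (Submonoid.powers g) R' := hf
  rw [← isLocalizedModule_iff_isBaseChange (Submonoid.powers g)] at h
  obtain ⟨⟨a, ⟨_, k, rfl⟩⟩, hk⟩ := IsLocalizedModule.surj (Submonoid.powers g)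
    (AlgHom.mk ψ (RingHom.congr_fun w) : A →ₐ[R] A').toLinearMap s
  refine ⟨k, a, hk.symm.trans ?_⟩
  rw [← map_pow]
  exact (algebraMap_smul R' (g ^ k) s).symm

end IsAlgBaseChange

end IsAlgBaseChange

/-! ### Sections of the algebra of an affine morphism -/

section Sections

variable {X Y X' Y' X'' Y'' : Scheme.{u}} {p : X ⟶ Y} {p' : X' ⟶ Y'} {p'' : X'' ⟶ Y''}
  {q : X' ⟶ X} {g : Y' ⟶ Y} {q' : X'' ⟶ X'} {g' : Y'' ⟶ Y'}

lemma pullSec_comp_algebraMap (w : q ≫ p = p' ≫ g) {V : Y.Opens} {V' : Y'.Opens}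
    (h : V' ≤ g ⁻¹ᵁ V) :
    (pullSec w h).comp (algebraMap Γ(Y, V) (PushforwardSec p V)) =
      (algebraMap Γ(Y', V') (PushforwardSec p' V')).comp (g.appLE V V' h).hom := by
  have : p.app V ≫ q.appLE (p ⁻¹ᵁ V) (p' ⁻¹ᵁ V') (by
      rw [← Scheme.Hom.comp_preimage, w, Scheme.Hom.comp_preimage]
      exact p'.preimage_mono h) = g.appLE V V' h ≫ p'.app V' := by
    rw [Scheme.Hom.app_eq_appLE, Scheme.Hom.app_eq_appLE, Scheme.Hom.appLE_comp_appLE,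
      Scheme.Hom.appLE_comp_appLE]
    simp only [w]
  exact congr($(this).hom)

/-- For a cartesian square with `p` affine, the sections of `p'_* 𝒪` over an affine open are the
base change of the sections of `p_* 𝒪`. -/
lemma isAlgBaseChange_pullSec (H : IsPullback q p' p g) [IsAffineHom p] (V : Y.affineOpens)
    (V' : Y'.affineOpens) (h : V'.1 ≤ g ⁻¹ᵁ V.1) :
    IsAlgBaseChange (g.appLE V V' h).hom (pullSec H.w h) := by
  have hle : p' ⁻¹ᵁ V'.1 ≤ q ⁻¹ᵁ p ⁻¹ᵁ V.1 := by
    rw [← Scheme.Hom.comp_preimage, H.w, Scheme.Hom.comp_preimage]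
    exact p'.preimage_mono h
  have hUY : p' ⁻¹ᵁ V'.1 = q ⁻¹ᵁ p ⁻¹ᵁ V.1 ⊓ p' ⁻¹ᵁ V'.1 := (inf_eq_right.2 hle).symm
  have h1 := isIso_pushoutSection_of_isAffineOpen H.flip.flip (US := V.1) (UT := V'.1)
    (UX := p ⁻¹ᵁ V.1) h le_rfl hUY V.2 V'.2 (V.2.preimage p)
  rw [isIso_pushoutSection_iff] at h1
  refine ⟨pullSec_comp_algebraMap H.w h, ?_⟩
  let := (g.appLE V V' h).hom.toAlgebra
  let := ((algebraMap Γ(Y', V'.1) (PushforwardSec p' V'.1)).comp (g.appLE V V' h).hom).toAlgebra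
  have ist : IsScalarTower Γ(Y, V.1) Γ(Y', V'.1) (PushforwardSec p' V'.1) :=
    .of_algebraMap_eq' rfl
  let := (pullSec H.w h).toAlgebra
  have ist' : IsScalarTower Γ(Y, V.1) (PushforwardSec p V.1) (PushforwardSec p' V'.1) :=
    .of_algebraMap_eq' (pullSec_comp_algebraMap H.w h).symm
  have h2 : IsPushout (CommRingCat.ofHom (algebraMap Γ(Y, V.1) Γ(Y', V'.1)))
      (CommRingCat.ofHom (algebraMap Γ(Y, V.1) (PushforwardSec p V.1)))
      (CommRingCat.ofHom (algebraMap Γ(Y', V'.1) (PushforwardSec p' V'.1)))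
      (CommRingCat.ofHom (algebraMap (PushforwardSec p V.1) (PushforwardSec p' V'.1))) := by
    convert! h1.flip using 1
    · exact Scheme.Hom.app_eq_appLE (f := p)
    · exact Scheme.Hom.app_eq_appLE (f := p')
  rw [CommRingCat.isPushout_iff_isPushout] at h2
  exact h2.out

lemma pullSec_comp (w : q ≫ p = p' ≫ g) (w' : q' ≫ p' = p'' ≫ g') {q₂ : X'' ⟶ X} {g₂ : Y'' ⟶ Y}
    (hq : q' ≫ q = q₂) (hg : g' ≫ g = g₂) (w₂ : q₂ ≫ p = p'' ≫ g₂) {V : Y.Opens} {V' : Y'.Opens}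
    {V'' : Y''.Opens} (h : V' ≤ g ⁻¹ᵁ V) (h' : V'' ≤ g' ⁻¹ᵁ V') (h₂ : V'' ≤ g₂ ⁻¹ᵁ V)
    (s : PushforwardSec p V) :
    pullSec w' h' (pullSec w h s) = pullSec w₂ h₂ s := by
  subst hq hg
  exact ConcreteCategory.congr_hom (Scheme.Hom.appLE_comp_appLE q' q _ _ _ _ _) s

/-- The restriction of sections of `p_* 𝒪`. -/
noncomputable abbrev resSec (p : X ⟶ Y) {V W : Y.Opens} (h : W ≤ V) :
    PushforwardSec p V →+* PushforwardSec p W :=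
  pullSec (p := p) (p' := p) (q := 𝟙 X) (g := 𝟙 Y) (by simp) (V := V) (V' := W) h

lemma resSec_pullSec (w : q ≫ p = p' ≫ g) {V : Y.Opens} {V' W' : Y'.Opens} (h : V' ≤ g ⁻¹ᵁ V)
    (h' : W' ≤ V') (s : PushforwardSec p V) :
    resSec p' h' (pullSec w h s) = pullSec w (h'.trans h) s :=
  pullSec_comp _ _ (Category.id_comp _) (Category.id_comp _) _ _ _ _ _

lemma pullSec_resSec (w : q ≫ p = p' ≫ g) {V W : Y.Opens} {V' : Y'.Opens} (hW : W ≤ V)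
    (h : V' ≤ g ⁻¹ᵁ W) (s : PushforwardSec p V) :
    pullSec w h (resSec p hW s) = pullSec w (h.trans (g.preimage_mono hW)) s :=
  pullSec_comp _ _ (Category.comp_id _) (Category.comp_id _) _ _ _ _ _

lemma resSec_resSec {U V W : Y.Opens} (h : V ≤ U) (h' : W ≤ V) (s : PushforwardSec p U) :
    resSec p h' (resSec p h s) = resSec p (h'.trans h) s :=
  resSec_pullSec _ _ _ _

lemma appLE_id_hom_eq {V W : Y.Opens} (h : W ≤ V) :
    (𝟙 Y : Y ⟶ Y).appLE V W h = Y.presheaf.map (homOfLE h).op := by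
  simp only [Scheme.Hom.appLE, Scheme.Hom.id_app]
  exact Category.id_comp _

@[simp] lemma resSec_self {V : Y.Opens} (h : V ≤ V) (s : PushforwardSec p V) :
    resSec p h s = s := by
  have := appLE_id_hom_eq (Y := X) (le_refl (p ⁻¹ᵁ V))
  rw [show (homOfLE (le_refl (p ⁻¹ᵁ V))).op = 𝟙 _ from rfl, X.presheaf.map_id] at this
  exact ConcreteCategory.congr_hom this s

lemma resSec_comp_algebraMap {V W : Y.Opens} (h : W ≤ V) :
    (resSec p h).comp (algebraMap Γ(Y, V) (PushforwardSec p V)) =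
      (algebraMap Γ(Y, W) (PushforwardSec p W)).comp (Y.presheaf.map (homOfLE h).op).hom := by
  rw [← appLE_id_hom_eq]
  exact pullSec_comp_algebraMap _ h

lemma resSec_smul {V W : Y.Opens} (h : W ≤ V) (r : Γ(Y, V)) (s : PushforwardSec p V) :
    resSec p h (r • s) = Y.presheaf.map (homOfLE h).op r • resSec p h s :=
  RingHom.map_smul_of_comp_eq (resSec_comp_algebraMap h) _ _

lemma isAlgBaseChange_resSec [IsAffineHom p] (V W : Y.affineOpens) (h : W.1 ≤ V.1) :
    IsAlgBaseChange (Y.presheaf.map (homOfLE h).op).hom (resSec p h) := by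
  rw [← appLE_id_hom_eq]
  exact isAlgBaseChange_pullSec (p := p) (p' := p) (q := 𝟙 X) (g := 𝟙 Y)
    (IsPullback.of_horiz_isIso (by simp)) V W h

end Sections

/-! ### Gluing quasi-coherent subalgebras -/

section Gluing

variable {X Y X' Y' X'' Y'' : Scheme.{u}} {p : X ⟶ Y} {p' : X' ⟶ Y'} {p'' : X'' ⟶ Y''}
  {q : X' ⟶ X} {g : Y' ⟶ Y} {q' : X'' ⟶ X'} {g' : Y'' ⟶ Y'}

lemma AlgebraicGeometry.Scheme.exists_affineOpens_mem_le {U : Y.Opens} {y : Y} (hy : y ∈ U) :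
    ∃ W : Y.affineOpens, y ∈ W.1 ∧ W.1 ≤ U := by
  obtain ⟨_, ⟨W, hW, rfl⟩, hyW, hWU⟩ :=
    Y.isBasis_affineOpens.exists_subset_of_mem_open hy U.isOpen
  exact ⟨⟨W, hW⟩, hyW, hWU⟩

lemma AlgebraicGeometry.Scheme.exists_affineBasicOpen_le (V : Y.affineOpens) {U : Y.Opens} {y : Y}
    (hyV : y ∈ V.1) (hyU : y ∈ U) :
    ∃ f : Γ(Y, V), y ∈ (Y.affineBasicOpen f).1 ∧ (Y.affineBasicOpen f).1 ≤ U := by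
  obtain ⟨f, hf, hyf⟩ := V.2.exists_basicOpen_le ⟨y, hyU⟩ hyV
  exact ⟨f, hyf, hf⟩

lemma AlgebraicGeometry.Scheme.affineBasicOpen_coe_le {V : Y.affineOpens} (f : Γ(Y, V)) :
    (Y.affineBasicOpen f).1 ≤ V.1 :=
  Y.basicOpen_le f

lemma isLocalizationAway_restrict (V : Y.affineOpens) (f : Γ(Y, V)) :
    letI := (Y.presheaf.map (homOfLE (Y.affineBasicOpen_coe_le f)).op).hom.toAlgebra
    IsLocalization.Away f Γ(Y, Y.affineBasicOpen f) :=
  V.2.isLocalization_basicOpen f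

namespace QCohSubalgebra

lemma toSubmodule_sec_eq_span (B : QCohSubalgebra p) {V W : Y.affineOpens} (h : W.1 ≤ V.1) :
    Subalgebra.toSubmodule (B.sec W) =
      Submodule.span Γ(Y, W) (resSec p h '' (B.sec V : Set (PushforwardSec p V))) :=
  (B.span_restrict V W h).symm

lemma resSec_mem (B : QCohSubalgebra p) {V W : Y.affineOpens} (h : W.1 ≤ V.1)
    {s : PushforwardSec p V} (hs : s ∈ B.sec V) : resSec p h s ∈ B.sec W := by
  rw [← Subalgebra.mem_toSubmodule, ← B.span_restrict V W h]
  exact Submodule.subset_span ⟨s, hs, rfl⟩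

end QCohSubalgebra

variable [IsAffineHom p]

/-- Membership in a submodule of the sections over an affine open is a local condition: the ideal of
the functions that multiply `s` into the submodule is not contained in any prime ideal. -/
lemma mem_of_forall_exists_resSec_mem (V : Y.affineOpens)
    (N : Submodule Γ(Y, V) (PushforwardSec p V)) (s : PushforwardSec p V)
    (h : ∀ y ∈ V.1, ∃ (W : Y.affineOpens) (hW : W.1 ≤ V.1), y ∈ W.1 ∧
      resSec p hW s ∈ Submodule.span Γ(Y, W) (resSec p hW '' N)) : s ∈ N := by
  let I : Ideal Γ(Y, V) :=
    { carrier := {f | f • s ∈ N}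
      add_mem' := fun {a b} ha hb => by simpa [add_smul] using add_mem ha hb
      zero_mem' := by simp
      smul_mem' := fun c f hf => by simpa [mul_smul] using N.smul_mem c hf }
  suffices I = ⊤ by
    have h1 : (1 : Γ(Y, V)) ∈ I := this ▸ trivial
    have h2 : (1 : Γ(Y, V)) • s ∈ N := h1
    rwa [one_smul] at h2
  rw [← Ideal.span_eq I, ← V.2.self_le_iSup_basicOpen_iff]
  intro y hy
  obtain ⟨W, hW, hyW, hs⟩ := h y hy
  obtain ⟨f, hyf, hf⟩ := Y.exists_affineBasicOpen_le V hy hyW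
  have h1 : resSec p (Y.affineBasicOpen_coe_le f) s ∈
      Submodule.span Γ(Y, Y.affineBasicOpen f) (resSec p (Y.affineBasicOpen_coe_le f) '' N) := by
    have := RingHom.map_mem_span_of_comp_eq (resSec_comp_algebraMap hf) hs
    rw [resSec_resSec, Set.image_image] at this
    simpa only [resSec_resSec] using this
  obtain ⟨k, hk⟩ := (isAlgBaseChange_resSec V (Y.affineBasicOpen f)
    (Y.affineBasicOpen_coe_le f)).exists_pow_smul_mem (isLocalizationAway_restrict V f) N s h1
  -- the exponent is positive, so that `D(f ^ (k + 1)) = D(f)`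
  refine TopologicalSpace.Opens.mem_iSup.2 ⟨⟨f ^ (k + 1), ?_⟩, ?_⟩
  · change f ^ (k + 1) • s ∈ N
    rw [pow_succ', mul_smul]
    exact N.smul_mem f hk
  · rw [Y.basicOpen_pow _ (Nat.succ_pos k)]
    exact hyf

namespace QCohSubalgebra

lemma mem_of_local (B : QCohSubalgebra p) (V : Y.affineOpens) (s : PushforwardSec p V)
    (h : ∀ y ∈ V.1, ∃ (W : Y.affineOpens) (hW : W.1 ≤ V.1), y ∈ W.1 ∧ resSec p hW s ∈ B.sec W) :
    s ∈ B.sec V := by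
  refine mem_of_forall_exists_resSec_mem V (Subalgebra.toSubmodule (B.sec V)) s fun y hy => ?_
  obtain ⟨W, hW, hyW, hs⟩ := h y hy
  refine ⟨W, hW, hyW, ?_⟩
  rw [← Subalgebra.mem_toSubmodule, B.toSubmodule_sec_eq_span hW] at hs
  exact hs

lemma le_of_local {B₁ B₂ : QCohSubalgebra p}
    (h : ∀ y : Y, ∃ V : Y.affineOpens, y ∈ V.1 ∧ B₁.sec V ≤ B₂.sec V) (V : Y.affineOpens) :
    B₁.sec V ≤ B₂.sec V := by
  intro s hs
  refine B₂.mem_of_local V s fun y hy => ?_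
  obtain ⟨U, hyU, hU⟩ := h y
  obtain ⟨W, hyW, hW⟩ := Y.exists_affineOpens_mem_le (U := V.1 ⊓ U.1) ⟨hy, hyU⟩
  refine ⟨W, hW.trans inf_le_left, hyW, ?_⟩
  have h1 := B₁.resSec_mem (hW.trans inf_le_left) hs
  rw [← Subalgebra.mem_toSubmodule, B₁.toSubmodule_sec_eq_span (hW.trans inf_le_right)] at h1
  rw [← Subalgebra.mem_toSubmodule, B₂.toSubmodule_sec_eq_span (hW.trans inf_le_right)]
  exact Submodule.span_mono (Set.image_mono hU) h1

lemma ext_of_local {B₁ B₂ : QCohSubalgebra p}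
    (h : ∀ y : Y, ∃ V : Y.affineOpens, y ∈ V.1 ∧ B₁.sec V = B₂.sec V) : B₁ = B₂ := by
  have h1 := le_of_local (B₁ := B₁) (B₂ := B₂) fun y => (h y).imp fun V hV => ⟨hV.1, hV.2.le⟩
  have h2 := le_of_local (B₁ := B₂) (B₂ := B₁) fun y => (h y).imp fun V hV => ⟨hV.1, hV.2.ge⟩
  cases B₁
  cases B₂
  congr
  exact funext fun V => le_antisymm (h1 V) (h2 V)

end QCohSubalgebra

/-- Over the distinguished open `D(f)` of an affine open `V`, the sections that satisfy a local
condition are generated by those over `V`: after multiplication with a high power of `f`, a section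
over `D(f)` extends to `V`, and the extension satisfies the condition on each member of a finite
cover. -/
lemma exists_pow_smul_resSec_mem (P : Y.affineOpens → Prop)
    (hP : ∀ V W : Y.affineOpens, W.1 ≤ V.1 → P V → P W) (hcov : ∀ y : Y, ∃ V, y ∈ V.1 ∧ P V)
    (sec₀ : ∀ V : Y.affineOpens, Subalgebra Γ(Y, V) (PushforwardSec p V))
    (hsec : ∀ (V W : Y.affineOpens) (h : W.1 ≤ V.1), P V → Subalgebra.toSubmodule (sec₀ W) =
      Submodule.span Γ(Y, W) (resSec p h '' (sec₀ V : Set (PushforwardSec p V))))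
    (V : Y.affineOpens) (f : Γ(Y, V)) (s : PushforwardSec p (Y.affineBasicOpen f).1)
    (hs : ∀ (W : Y.affineOpens) (h : W.1 ≤ (Y.affineBasicOpen f).1), P W →
      resSec p h s ∈ sec₀ W) :
    ∃ (k : ℕ) (a : PushforwardSec p V),
      resSec p (Y.affineBasicOpen_coe_le f) a =
        Y.presheaf.map (homOfLE (Y.affineBasicOpen_coe_le f)).op f ^ k • s ∧
      ∀ (W : Y.affineOpens) (h : W.1 ≤ V.1), P W → resSec p h a ∈ sec₀ W := by
  obtain ⟨k, a, ha⟩ := (isAlgBaseChange_resSec V (Y.affineBasicOpen f)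
    (Y.affineBasicOpen_coe_le f)).exists_pow_smul_eq (isLocalizationAway_restrict V f) s
  -- on each `W` of the class, a power of `f` multiplies `a` into `sec₀ W`
  have key : ∀ (W : Y.affineOpens) (h : W.1 ≤ V.1), P W → ∃ m : ℕ,
      resSec p h (f ^ m • a) ∈ sec₀ W := by
    intro W h hPW
    let fW : Γ(Y, W) := Y.presheaf.map (homOfLE h).op f
    have hle : (Y.affineBasicOpen fW).1 ≤ (Y.affineBasicOpen f).1 := by
      change Y.basicOpen _ ≤ Y.basicOpen _
      rw [Y.basicOpen_res]
      exact inf_le_right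
    have hDW : (Y.affineBasicOpen fW).1 ≤ W.1 := Y.affineBasicOpen_coe_le fW
    have h1 : resSec p hDW (resSec p h a) ∈ Submodule.span Γ(Y, Y.affineBasicOpen fW)
        (resSec p hDW '' (Subalgebra.toSubmodule (sec₀ W))) := by
      have h2 : resSec p hDW (resSec p h a) ∈ sec₀ (Y.affineBasicOpen fW) := by
        have : resSec p hDW (resSec p h a) =
            resSec p hle (resSec p (Y.affineBasicOpen_coe_le f) a) := by
          rw [resSec_resSec, resSec_resSec]
        rw [this, ha, resSec_smul]
        exact Subalgebra.smul_mem _ (hs _ hle (hP _ _ hDW hPW)) _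
      rw [← Subalgebra.mem_toSubmodule, hsec W _ hDW hPW] at h2
      exact h2
    obtain ⟨m, hm⟩ := (isAlgBaseChange_resSec W (Y.affineBasicOpen fW) hDW).exists_pow_smul_mem
      (isLocalizationAway_restrict W fW) _ _ h1
    refine ⟨m, ?_⟩
    rw [resSec_smul, map_pow]
    exact hm
  -- a finite cover of `V` by members of the class gives a common power
  have hcov' : ∀ y : V.1, ∃ d : Γ(Y, V),
      y.1 ∈ (Y.affineBasicOpen d).1 ∧ P (Y.affineBasicOpen d) := by
    intro y
    obtain ⟨U, hyU, hU⟩ := hcov y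
    obtain ⟨d, hyd, hd⟩ := Y.exists_affineBasicOpen_le V y.2 hyU
    exact ⟨d, hyd, hP _ _ hd hU⟩
  choose d hyd hd using hcov'
  obtain ⟨t, ht⟩ := V.2.isCompact.elim_finite_subcover
    (fun y : V.1 => ((Y.affineBasicOpen (d y)).1 : Set Y)) (fun y => (Y.affineBasicOpen (d y)).1.2)
    fun y hy => Set.mem_iUnion.2 ⟨⟨y, hy⟩, hyd ⟨y, hy⟩⟩
  choose m hm using fun y : V.1 => key (Y.affineBasicOpen (d y)) (Y.affineBasicOpen_coe_le _) (hd y)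
  refine ⟨k + t.sup m, f ^ (t.sup m) • a, ?_, ?_⟩
  · rw [resSec_smul, ha, smul_smul, map_pow, ← pow_add, add_comm]
  · intro W h hPW
    refine mem_of_forall_exists_resSec_mem W (Subalgebra.toSubmodule (sec₀ W)) _ fun y hy => ?_
    obtain ⟨z, hz, hyz⟩ := Set.mem_iUnion₂.1 (ht (h hy))
    obtain ⟨W', hyW', hW'⟩ :=
      Y.exists_affineOpens_mem_le (U := W.1 ⊓ (Y.affineBasicOpen (d z)).1) ⟨hy, hyz⟩
    refine ⟨W', hW'.trans inf_le_left, hyW', ?_⟩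
    have h1 : f ^ (t.sup m) • a = f ^ (t.sup m - m z) • f ^ m z • a := by
      rw [smul_smul, ← pow_add, Nat.sub_add_cancel (Finset.le_sup hz)]
    have h2 : resSec p (Y.affineBasicOpen_coe_le (d z)) (f ^ (t.sup m) • a) ∈
        sec₀ (Y.affineBasicOpen (d z)) := by
      rw [h1, resSec_smul]
      exact Subalgebra.smul_mem _ (hm z) _
    have h3 : resSec p (hW'.trans inf_le_right) (resSec p (Y.affineBasicOpen_coe_le (d z))
        (f ^ (t.sup m) • a)) ∈ Subalgebra.toSubmodule (sec₀ W') := by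
      rw [hsec _ W' (hW'.trans inf_le_right) (hd z)]
      exact Submodule.subset_span ⟨_, h2, rfl⟩
    rw [hsec W W' (hW'.trans inf_le_left) hPW] at h3
    rw [resSec_resSec] at h3 ⊢
    exact h3

/-- A quasi-coherent subalgebra may be given on a class of affine opens that is closed under passage
to smaller affine opens and covers the base. -/
lemma QCohSubalgebra.exists_extension (P : Y.affineOpens → Prop)
    (hP : ∀ V W : Y.affineOpens, W.1 ≤ V.1 → P V → P W) (hcov : ∀ y : Y, ∃ V, y ∈ V.1 ∧ P V)
    (sec₀ : ∀ V : Y.affineOpens, Subalgebra Γ(Y, V) (PushforwardSec p V))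
    (hsec : ∀ (V W : Y.affineOpens) (h : W.1 ≤ V.1), P V → Subalgebra.toSubmodule (sec₀ W) =
      Submodule.span Γ(Y, W) (resSec p h '' (sec₀ V : Set (PushforwardSec p V)))) :
    ∃ B : QCohSubalgebra p, ∀ V, P V → B.sec V = sec₀ V := by
  let sec : ∀ V : Y.affineOpens, Subalgebra Γ(Y, V) (PushforwardSec p V) := fun V =>
    { carrier := {s | ∀ (W : Y.affineOpens) (h : W.1 ≤ V.1), P W → resSec p h s ∈ sec₀ W}
      mul_mem' := fun ha hb W h hW => by
        rw [map_mul]; exact mul_mem (ha W h hW) (hb W h hW)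
      add_mem' := fun ha hb W h hW => by
        rw [map_add]; exact add_mem (ha W h hW) (hb W h hW)
      algebraMap_mem' := fun r W h hW => by
        rw [Algebra.algebraMap_eq_smul_one, resSec_smul, map_one]
        exact Subalgebra.smul_mem _ (one_mem _) _ }
  have hres : ∀ (V W : Y.affineOpens) (h : W.1 ≤ V.1) (s : PushforwardSec p V), s ∈ sec V →
      resSec p h s ∈ sec W := fun V W h s hs W' h' hW' => by
    rw [resSec_resSec]
    exact hs W' _ hW'
  refine ⟨⟨sec, fun V W h => le_antisymm ?_ ?_⟩, fun V hV => le_antisymm ?_ ?_⟩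
  · refine Submodule.span_le.2 ?_
    rintro _ ⟨s, hs, rfl⟩
    exact hres V W h s hs
  · intro s hs
    refine mem_of_forall_exists_resSec_mem W _ s fun y hy => ?_
    obtain ⟨f, hyf, hf⟩ := Y.exists_affineBasicOpen_le V (h hy) hy
    refine ⟨Y.affineBasicOpen f, hf, hyf, ?_⟩
    obtain ⟨k, a, ha, ha'⟩ := exists_pow_smul_resSec_mem P hP hcov sec₀ hsec V f (resSec p hf s)
      fun W' h' hW' => by rw [resSec_resSec]; exact hs W' _ hW'
    have h1 : Y.presheaf.map (homOfLE (Y.affineBasicOpen_coe_le f)).op f ^ k • resSec p hf s ∈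
        Submodule.span Γ(Y, Y.affineBasicOpen f) (resSec p hf '' (Submodule.span Γ(Y, W)
          (resSec p h '' (sec V : Set (PushforwardSec p V))))) := by
      rw [← ha]
      refine Submodule.subset_span ⟨_, Submodule.subset_span ⟨a, ha', rfl⟩, ?_⟩
      rw [resSec_resSec]
    have hu : IsUnit (Y.presheaf.map (homOfLE (Y.affineBasicOpen_coe_le f)).op f ^ k) :=
      (RingedSpace.isUnit_res_basicOpen _ f).pow k
    exact (Submodule.smul_mem_iff_of_isUnit _ hu).1 h1
  · intro s hs
    have := hs V le_rfl hV
    rwa [resSec_self] at this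
  · intro s hs W h hW
    rw [← Subalgebra.mem_toSubmodule, hsec V W h hV]
    exact Submodule.subset_span ⟨s, hs, rfl⟩

end Gluing

/-! ### Pullback of quasi-coherent subalgebras -/

section Pullback

variable {X Y X' Y' X'' Y'' : Scheme.{u}} {p : X ⟶ Y} {p' : X' ⟶ Y'} {p'' : X'' ⟶ Y''}
  {q : X' ⟶ X} {g : Y' ⟶ Y} {q' : X'' ⟶ X'} {g' : Y'' ⟶ Y'}

namespace QCohSubalgebra

/-- `B'` is the pullback of `B` along the commutative square `w`. -/
def IsPullback (w : q ≫ p = p' ≫ g) (B : QCohSubalgebra p) (B' : QCohSubalgebra p') : Prop :=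
  ∀ (V : Y.affineOpens) (V' : Y'.affineOpens) (h : V'.1 ≤ g ⁻¹ᵁ V.1),
    Subalgebra.toSubmodule (B'.sec V') =
      Submodule.span Γ(Y', V') (pullSec w h '' (B.sec V : Set (PushforwardSec p V)))

lemma span_image_resSec_image_pullSec (w : q ≫ p = p' ≫ g) {V : Y.affineOpens}
    {V' W' : Y'.affineOpens} (h : V'.1 ≤ g ⁻¹ᵁ V.1) (h' : W'.1 ≤ V'.1)
    (s : Set (PushforwardSec p V)) :
    Submodule.span Γ(Y', W') (resSec p' h' '' (Submodule.span Γ(Y', V') (pullSec w h '' s))) =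
      Submodule.span Γ(Y', W') (pullSec w (h'.trans h) '' s) := by
  rw [RingHom.span_image_span_of_comp_eq (resSec_comp_algebraMap h'), Set.image_image]
  simp only [resSec_pullSec]

lemma span_image_pullSec_eq (w : q ≫ p = p' ≫ g) (B : QCohSubalgebra p) {V W : Y.affineOpens}
    {V' : Y'.affineOpens} (hW : W.1 ≤ V.1) (h : V'.1 ≤ g ⁻¹ᵁ W.1) :
    Submodule.span Γ(Y', V') (pullSec w h '' (B.sec W : Set (PushforwardSec p W))) =
      Submodule.span Γ(Y', V') (pullSec w (h.trans (g.preimage_mono hW)) ''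
        (B.sec V : Set (PushforwardSec p V))) := by
  have : (B.sec W : Set (PushforwardSec p W)) =
      Submodule.span Γ(Y, W) (resSec p hW '' (B.sec V : Set (PushforwardSec p V))) := by
    rw [← B.toSubmodule_sec_eq_span hW]
    rfl
  rw [this, RingHom.span_image_span_of_comp_eq (pullSec_comp_algebraMap w h), Set.image_image]
  simp only [pullSec_resSec]

lemma span_image_pullSec_image_pullSec (w : q ≫ p = p' ≫ g) (w' : q' ≫ p' = p'' ≫ g')
    {q₂ : X'' ⟶ X} {g₂ : Y'' ⟶ Y} (hq : q' ≫ q = q₂) (hg : g' ≫ g = g₂) (w₂ : q₂ ≫ p = p'' ≫ g₂)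
    {V : Y.affineOpens} {V' : Y'.affineOpens} {V'' : Y''.affineOpens} (h : V'.1 ≤ g ⁻¹ᵁ V.1)
    (h' : V''.1 ≤ g' ⁻¹ᵁ V'.1) (h₂ : V''.1 ≤ g₂ ⁻¹ᵁ V.1) (s : Set (PushforwardSec p V)) :
    Submodule.span Γ(Y'', V'') (pullSec w' h' '' (Submodule.span Γ(Y', V') (pullSec w h '' s))) =
      Submodule.span Γ(Y'', V'') (pullSec w₂ h₂ '' s) := by
  rw [RingHom.span_image_span_of_comp_eq (pullSec_comp_algebraMap w' h'), Set.image_image]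
  simp only [pullSec_comp w w' hq hg w₂ h h' h₂]

lemma span_image_pullSec_le [IsAffineHom p'] (w : q ≫ p = p' ≫ g) (B : QCohSubalgebra p)
    {V₁ V₂ : Y.affineOpens} {V' : Y'.affineOpens} (h₁ : V'.1 ≤ g ⁻¹ᵁ V₁.1)
    (h₂ : V'.1 ≤ g ⁻¹ᵁ V₂.1) :
    Submodule.span Γ(Y', V') (pullSec w h₁ '' (B.sec V₁ : Set (PushforwardSec p V₁))) ≤
      Submodule.span Γ(Y', V') (pullSec w h₂ '' (B.sec V₂ : Set (PushforwardSec p V₂))) := by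
  intro s hs
  refine mem_of_forall_exists_resSec_mem V' _ s fun y hy => ?_
  obtain ⟨W, hyW, hW⟩ := Y.exists_affineOpens_mem_le (U := V₁.1 ⊓ V₂.1) ⟨h₁ hy, h₂ hy⟩
  obtain ⟨W', hyW', hW'⟩ := Y'.exists_affineOpens_mem_le (U := V'.1 ⊓ g ⁻¹ᵁ W.1) ⟨hy, hyW⟩
  refine ⟨W', hW'.trans inf_le_left, hyW', ?_⟩
  have h := Submodule.subset_span (R := Γ(Y', W'))
    (Set.mem_image_of_mem (resSec p' (hW'.trans inf_le_left)) hs)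
  rw [span_image_resSec_image_pullSec,
    ← span_image_pullSec_eq w B (hW.trans inf_le_left) (hW'.trans inf_le_right),
    span_image_pullSec_eq w B (hW.trans inf_le_right) (hW'.trans inf_le_right)] at h
  rw [span_image_resSec_image_pullSec]
  exact h

lemma span_image_pullSec_eq_of_le [IsAffineHom p'] (w : q ≫ p = p' ≫ g) (B : QCohSubalgebra p)
    {V₁ V₂ : Y.affineOpens} {V' : Y'.affineOpens} (h₁ : V'.1 ≤ g ⁻¹ᵁ V₁.1)
    (h₂ : V'.1 ≤ g ⁻¹ᵁ V₂.1) :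
    Submodule.span Γ(Y', V') (pullSec w h₁ '' (B.sec V₁ : Set (PushforwardSec p V₁))) =
      Submodule.span Γ(Y', V') (pullSec w h₂ '' (B.sec V₂ : Set (PushforwardSec p V₂))) :=
  le_antisymm (span_image_pullSec_le w B h₁ h₂) (span_image_pullSec_le w B h₂ h₁)

lemma exists_affineOpens_le_preimage (g : Y' ⟶ Y) (y : Y') :
    ∃ (V : Y.affineOpens) (V' : Y'.affineOpens), y ∈ V'.1 ∧ V'.1 ≤ g ⁻¹ᵁ V.1 := by
  obtain ⟨V, hV, -⟩ := Y.exists_affineOpens_mem_le (U := ⊤) (y := g y) trivial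
  obtain ⟨V', hV', h⟩ := Y'.exists_affineOpens_mem_le (U := g ⁻¹ᵁ V.1) (y := y) hV
  exact ⟨V, V', hV', h⟩

lemma IsPullback.of_local [IsAffineHom p'] {w : q ≫ p = p' ≫ g} {B : QCohSubalgebra p}
    {B' : QCohSubalgebra p'} (H : ∀ y : Y', ∃ (V : Y.affineOpens) (V' : Y'.affineOpens)
      (h : V'.1 ≤ g ⁻¹ᵁ V.1), y ∈ V'.1 ∧ Subalgebra.toSubmodule (B'.sec V') =
      Submodule.span Γ(Y', V') (pullSec w h '' (B.sec V : Set (PushforwardSec p V)))) :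
    IsPullback w B B' := by
  intro V V' h
  have key : ∀ y ∈ V'.1, ∃ (W' : Y'.affineOpens) (hW' : W'.1 ≤ V'.1), y ∈ W'.1 ∧
      Subalgebra.toSubmodule (B'.sec W') = Submodule.span Γ(Y', W')
        (pullSec w (hW'.trans h) '' (B.sec V : Set (PushforwardSec p V))) := by
    intro y hy
    obtain ⟨V₁, V₁', h₁, hy₁, e⟩ := H y
    obtain ⟨W', hyW', hW'⟩ := Y'.exists_affineOpens_mem_le (U := V'.1 ⊓ V₁'.1) ⟨hy, hy₁⟩
    refine ⟨W', hW'.trans inf_le_left, hyW', ?_⟩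
    have e' : (B'.sec V₁' : Set (PushforwardSec p' V₁')) = Submodule.span Γ(Y', V₁')
        (pullSec w h₁ '' (B.sec V₁ : Set (PushforwardSec p V₁))) := by
      rw [← e]
      rfl
    rw [B'.toSubmodule_sec_eq_span (hW'.trans inf_le_right), e', span_image_resSec_image_pullSec]
    exact span_image_pullSec_eq_of_le w B _ _
  apply le_antisymm
  · intro s hs
    refine mem_of_forall_exists_resSec_mem V' _ s fun y hy => ?_
    obtain ⟨W', hW', hyW', e⟩ := key y hy
    refine ⟨W', hW', hyW', ?_⟩
    rw [span_image_resSec_image_pullSec, ← e]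
    exact B'.resSec_mem hW' hs
  · refine Submodule.span_le.2 ?_
    rintro _ ⟨s, hs, rfl⟩
    refine B'.mem_of_local V' _ fun y hy => ?_
    obtain ⟨W', hW', hyW', e⟩ := key y hy
    refine ⟨W', hW', hyW', ?_⟩
    rw [← Subalgebra.mem_toSubmodule, e, resSec_pullSec]
    exact Submodule.subset_span ⟨s, hs, rfl⟩

lemma IsPullback.coe_sec_eq {w : q ≫ p = p' ≫ g} {B : QCohSubalgebra p} {B' : QCohSubalgebra p'}
    (H : IsPullback w B B') {V : Y.affineOpens} {V' : Y'.affineOpens} (h : V'.1 ≤ g ⁻¹ᵁ V.1) :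
    (B'.sec V' : Set (PushforwardSec p' V')) = Submodule.span Γ(Y', V')
      (pullSec w h '' (B.sec V : Set (PushforwardSec p V))) := by
  rw [← H V V' h]
  rfl

lemma IsPullback.unique [IsAffineHom p'] {w : q ≫ p = p' ≫ g} {B : QCohSubalgebra p}
    {B₁ B₂ : QCohSubalgebra p'} (h₁ : IsPullback w B B₁) (h₂ : IsPullback w B B₂) : B₁ = B₂ :=
  ext_of_local fun y => by
    obtain ⟨V, V', hy, h⟩ := exists_affineOpens_le_preimage g y
    exact ⟨V', hy, Subalgebra.toSubmodule_injective ((h₁ V V' h).trans (h₂ V V' h).symm)⟩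

lemma exists_affineOpens_le_preimage_comp (g : Y' ⟶ Y) (g' : Y'' ⟶ Y') (y : Y'') :
    ∃ (V : Y.affineOpens) (V' : Y'.affineOpens) (V'' : Y''.affineOpens), y ∈ V''.1 ∧
      V'.1 ≤ g ⁻¹ᵁ V.1 ∧ V''.1 ≤ g' ⁻¹ᵁ V'.1 := by
  obtain ⟨V, V', hV', h⟩ := exists_affineOpens_le_preimage g (g' y)
  obtain ⟨V'', hV'', h'⟩ := Y''.exists_affineOpens_mem_le (U := g' ⁻¹ᵁ V'.1) (y := y) hV'
  exact ⟨V, V', V'', hV'', h, h'⟩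

lemma IsPullback.comp [IsAffineHom p''] {w : q ≫ p = p' ≫ g} {w' : q' ≫ p' = p'' ≫ g'}
    {q₂ : X'' ⟶ X} {g₂ : Y'' ⟶ Y} (hq : q' ≫ q = q₂) (hg : g' ≫ g = g₂) (w₂ : q₂ ≫ p = p'' ≫ g₂)
    {B : QCohSubalgebra p} {B' : QCohSubalgebra p'} {B'' : QCohSubalgebra p''}
    (H : IsPullback w B B') (H' : IsPullback w' B' B'') : IsPullback w₂ B B'' :=
  .of_local fun y => by
    obtain ⟨V, V', V'', hy, h, h'⟩ := exists_affineOpens_le_preimage_comp g g' y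
    have h₂ : V''.1 ≤ g₂ ⁻¹ᵁ V.1 := by
      rw [← hg, Scheme.Hom.comp_preimage]
      exact h'.trans (g'.preimage_mono h)
    refine ⟨V, V'', h₂, hy, ?_⟩
    rw [H' V' V'' h', H.coe_sec_eq h, span_image_pullSec_image_pullSec w w' hq hg w₂ h h' h₂]

lemma IsPullback.of_comp [IsAffineHom p''] {w : q ≫ p = p' ≫ g} {w' : q' ≫ p' = p'' ≫ g'}
    {q₂ : X'' ⟶ X} {g₂ : Y'' ⟶ Y} (hq : q' ≫ q = q₂) (hg : g' ≫ g = g₂) {w₂ : q₂ ≫ p = p'' ≫ g₂}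
    {B : QCohSubalgebra p} {B' : QCohSubalgebra p'} {B'' : QCohSubalgebra p''}
    (H : IsPullback w B B') (H₂ : IsPullback w₂ B B'') : IsPullback w' B' B'' :=
  .of_local fun y => by
    obtain ⟨V, V', V'', hy, h, h'⟩ := exists_affineOpens_le_preimage_comp g g' y
    have h₂ : V''.1 ≤ g₂ ⁻¹ᵁ V.1 := by
      rw [← hg, Scheme.Hom.comp_preimage]
      exact h'.trans (g'.preimage_mono h)
    refine ⟨V', V'', h', hy, ?_⟩
    rw [H₂ V V'' h₂, H.coe_sec_eq h, span_image_pullSec_image_pullSec w w' hq hg w₂ h h' h₂]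

lemma isPullback_refl (B : QCohSubalgebra p) (w : 𝟙 X ≫ p = p ≫ 𝟙 Y) : IsPullback w B B :=
  fun _ _ h => B.toSubmodule_sec_eq_span h

lemma exists_isPullback [IsAffineHom p'] (w : q ≫ p = p' ≫ g) (B : QCohSubalgebra p) :
    ∃ B' : QCohSubalgebra p', IsPullback w B B' := by
  classical
  let P : Y'.affineOpens → Prop := fun V' => ∃ V : Y.affineOpens, V'.1 ≤ g ⁻¹ᵁ V.1
  let sec₀ : ∀ V' : Y'.affineOpens, Subalgebra Γ(Y', V') (PushforwardSec p' V') := fun V' =>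
    if h : P V' then (B.sec h.choose).mapSpan (pullSec w h.choose_spec) Γ(Y', V') else ⊥
  have hsec₀ : ∀ (V : Y.affineOpens) (V' : Y'.affineOpens) (h : V'.1 ≤ g ⁻¹ᵁ V.1),
      Subalgebra.toSubmodule (sec₀ V') =
        Submodule.span Γ(Y', V') (pullSec w h '' (B.sec V : Set (PushforwardSec p V))) := by
    intro V V' h
    have hP : P V' := ⟨V, h⟩
    simp only [sec₀, dif_pos hP]
    rw [Subalgebra.toSubmodule_mapSpan]
    exact span_image_pullSec_eq_of_le w B _ _
  obtain ⟨B', hB'⟩ := exists_extension P (fun V W hWV ⟨V₁, h₁⟩ => ⟨V₁, hWV.trans h₁⟩)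
    (fun y => by
      obtain ⟨V, V', hy, h⟩ := exists_affineOpens_le_preimage g y
      exact ⟨V', hy, V, h⟩) sec₀ fun V' W' h' ⟨V, h⟩ => by
        have e : (sec₀ V' : Set (PushforwardSec p' V')) = Submodule.span Γ(Y', V')
            (pullSec w h '' (B.sec V : Set (PushforwardSec p V))) := by
          rw [← hsec₀ V V' h]
          rfl
        rw [hsec₀ V W' (h'.trans h), e, span_image_resSec_image_pullSec]
  exact ⟨B', fun V V' h => by rw [hB' V' ⟨V, h⟩, hsec₀ V V' h]⟩

lemma IsPullback.exists_quotient_basis [IsAffineHom p] (H : CategoryTheory.IsPullback q p' p g)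
    {w : q ≫ p = p' ≫ g} {B : QCohSubalgebra p} {B' : QCohSubalgebra p'} (hB : IsPullback w B B')
    {V : Y.affineOpens} {V' : Y'.affineOpens} (h : V'.1 ≤ g ⁻¹ᵁ V.1) {ι : Type*}
    (c : Module.Basis ι Γ(Y, V) (PushforwardSec p V ⧸ Subalgebra.toSubmodule (B.sec V))) :
    ∃ c' : Module.Basis ι Γ(Y', V') (PushforwardSec p' V' ⧸ Subalgebra.toSubmodule (B'.sec V')),
      ∀ a i, c'.repr (Submodule.Quotient.mk (pullSec w h a)) i =
        (g.appLE V V' h).hom (c.repr (Submodule.Quotient.mk a) i) := by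
  have h1 := isAlgBaseChange_pullSec H V V' h
  exact h1.exists_quotient_basis (B := Subalgebra.toSubmodule (B.sec V))
    (B' := Subalgebra.toSubmodule (B'.sec V')) (hB V V' h) (ι := ι) c

end QCohSubalgebra

end Pullback

/-! ### Pullback of families -/

namespace QCohAlgebra

variable {S : Scheme.{u}} (𝒜 : QCohAlgebra S)

/-- The open immersion of the spectrum of `𝒜(U)` into the relative spectrum. -/
noncomputable def relSpecι (U : S.AffineZariskiSite) : Spec (𝒜.obj.obj (.op U)) ⟶ 𝒜.relSpec :=
  (AffineZariskiSite.relativeGluingData 𝒜.coequifibered).cover.f U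

instance (U : S.AffineZariskiSite) : IsOpenImmersion (𝒜.relSpecι U) :=
  (AffineZariskiSite.relativeGluingData 𝒜.coequifibered).cover.map_prop U

instance : ((AffineZariskiSite.relativeGluingData 𝒜.coequifibered).functor ⋙
    Scheme.forget).IsLocallyDirected :=
  Cover.RelativeGluingData.instIsLocallyDirectedI₀CompFunctorForgetOfIsThin ..

lemma relSpecι_toBase (U : S.AffineZariskiSite) :
    𝒜.relSpecι U ≫ 𝒜.toBase = Spec.map (𝒜.unit.app (.op U)) ≫ U.2.fromSpec :=
  colimit.ι_desc _ _

lemma preimage_toBase (U : S.AffineZariskiSite) :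
    𝒜.toBase ⁻¹ᵁ U.toOpens = (𝒜.relSpecι U).opensRange := by
  simpa using!
    (AffineZariskiSite.relativeGluingData 𝒜.coequifibered).toBase_preimage_eq_opensRange_ι U

instance : IsAffineHom 𝒜.toBase where
  isAffine_preimage U hU := by
    let U' : S.AffineZariskiSite := ⟨U, hU⟩
    change IsAffineOpen (𝒜.toBase ⁻¹ᵁ U'.toOpens)
    rw [𝒜.preimage_toBase U']
    exact isAffineOpen_opensRange _

instance (T : Over S) : IsAffineHom (𝒜.proj T) := by
  have : ∀ {Y : Scheme.{u}} (f : Y ⟶ S), IsAffineHom (pullback.snd 𝒜.toBase f) := fun f =>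
    MorphismProperty.IsStableUnderBaseChange.of_isPullback (P := @IsAffineHom)
      (CategoryTheory.IsPullback.of_hasPullback 𝒜.toBase f) inferInstance
  exact this T.hom

lemma isPullback_projMap {T T' : Over S} (g : T' ⟶ T) :
    CategoryTheory.IsPullback (𝒜.projMap g) (𝒜.proj T') (𝒜.proj T) g.left := by
  have h := CategoryTheory.IsPullback.of_hasPullback 𝒜.toBase T.hom
  refine CategoryTheory.IsPullback.of_right (h₁₂ := pullback.fst 𝒜.toBase T.hom)
    (v₁₃ := 𝒜.toBase) (h₂₂ := T.hom) ?_ (𝒜.projMap_comp_proj g) h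
  have h' := CategoryTheory.IsPullback.of_hasPullback 𝒜.toBase T'.hom
  rw [Over.w]
  rwa [projMap, pullback.lift_fst]

lemma projMap_comp {T T' T'' : Over S} (g' : T'' ⟶ T') (g : T' ⟶ T) :
    𝒜.projMap g' ≫ 𝒜.projMap g = 𝒜.projMap (g' ≫ g) := by
  apply pullback.hom_ext
  · rw [Category.assoc, projMap, projMap, projMap, pullback.lift_fst, pullback.lift_fst,
      pullback.lift_fst]
  · rw [Category.assoc, projMap, projMap, projMap, pullback.lift_snd, pullback.lift_snd,
      pullback.lift_snd_assoc, Over.comp_left, Category.assoc]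

lemma projMap_id (T : Over S) : 𝒜.projMap (𝟙 T) = 𝟙 _ := by
  apply pullback.hom_ext
  · rw [projMap, pullback.lift_fst, Category.id_comp]
  · rw [projMap, pullback.lift_snd, Category.id_comp, Over.id_left, Category.comp_id]

namespace Family

variable {𝒜} {δ : ℕ} {T T' T'' : Over S}

lemma toQCohSubalgebra_injective :
    Function.Injective (toQCohSubalgebra : 𝒜.Family T δ → QCohSubalgebra (𝒜.proj T)) := by
  rintro ⟨B, _⟩ ⟨B', _⟩ rfl
  rfl

lemma isPullback_iff {g : T' ⟶ T} {ℬ : 𝒜.Family T δ} {ℬ' : 𝒜.Family T' δ} :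
    IsPullback g ℬ ℬ' ↔ QCohSubalgebra.IsPullback (𝒜.projMap_comp_proj g) ℬ.toQCohSubalgebra
      ℬ'.toQCohSubalgebra := Iff.rfl

lemma IsPullback.unique {g : T' ⟶ T} {ℬ : 𝒜.Family T δ} {ℬ₁ ℬ₂ : 𝒜.Family T' δ}
    (h₁ : IsPullback g ℬ ℬ₁) (h₂ : IsPullback g ℬ ℬ₂) : ℬ₁ = ℬ₂ :=
  toQCohSubalgebra_injective
    (QCohSubalgebra.IsPullback.unique (isPullback_iff.1 h₁) (isPullback_iff.1 h₂))

lemma exists_isPullback (g : T' ⟶ T) (ℬ : 𝒜.Family T δ) :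
    ∃ ℬ' : 𝒜.Family T' δ, IsPullback g ℬ ℬ' := by
  obtain ⟨B', hB'⟩ := QCohSubalgebra.exists_isPullback (𝒜.projMap_comp_proj g) ℬ.toQCohSubalgebra
  refine ⟨⟨B', fun x => ?_⟩, hB'⟩
  obtain ⟨V, hV, ⟨c⟩⟩ := ℬ.corank (g.left x)
  obtain ⟨V', hV', h⟩ := T'.left.exists_affineOpens_mem_le (U := g.left ⁻¹ᵁ V.1) (y := x) hV
  obtain ⟨c', -⟩ := hB'.exists_quotient_basis (𝒜.isPullback_projMap g) h c
  exact ⟨V', hV', ⟨c'⟩⟩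

lemma IsPullback.comp {g : T' ⟶ T} {g' : T'' ⟶ T'} {ℬ : 𝒜.Family T δ} {ℬ' : 𝒜.Family T' δ}
    {ℬ'' : 𝒜.Family T'' δ} (h : IsPullback g ℬ ℬ') (h' : IsPullback g' ℬ' ℬ'') :
    IsPullback (g' ≫ g) ℬ ℬ'' :=
  QCohSubalgebra.IsPullback.comp (𝒜.projMap_comp g' g) (Over.comp_left _ _ _ g' g).symm _ h h'

lemma IsPullback.of_comp {g : T' ⟶ T} {g' : T'' ⟶ T'} {ℬ : 𝒜.Family T δ} {ℬ' : 𝒜.Family T' δ}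
    {ℬ'' : 𝒜.Family T'' δ} (h : IsPullback g ℬ ℬ') (h' : IsPullback (g' ≫ g) ℬ ℬ'') :
    IsPullback g' ℬ' ℬ'' :=
  QCohSubalgebra.IsPullback.of_comp (𝒜.projMap_comp g' g) (Over.comp_left _ _ _ g' g).symm h h'

lemma isPullback_id (ℬ : 𝒜.Family T δ) : IsPullback (𝟙 T) ℬ ℬ := by
  have : ∀ (q : pullback 𝒜.toBase T.hom ⟶ pullback 𝒜.toBase T.hom) (g : T.left ⟶ T.left)
      (_ : q = 𝟙 _) (_ : g = 𝟙 _) (w : q ≫ 𝒜.proj T = 𝒜.proj T ≫ g),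
      QCohSubalgebra.IsPullback w ℬ.toQCohSubalgebra ℬ.toQCohSubalgebra := by
    rintro _ _ rfl rfl w
    exact QCohSubalgebra.isPullback_refl _ w
  exact this _ _ (𝒜.projMap_id T) (Over.id_left T) _

end Family

end QCohAlgebra

/-! ### Descent of quasi-coherent subalgebras along open covers -/

lemma RingHom.image_span_of_surjective {R R' A A' : Type*} [CommRing R] [CommRing R'] [CommRing A]
    [CommRing A'] [Algebra R A] [Algebra R' A'] {f : R →+* R'} {ψ : A →+* A'}
    (w : ψ.comp (algebraMap R A) = (algebraMap R' A').comp f) (hf : Function.Surjective f)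
    (s : Set A) : ψ '' (Submodule.span R s : Set A) = Submodule.span R' (ψ '' s) := by
  apply subset_antisymm
  · rintro _ ⟨a, ha, rfl⟩
    exact RingHom.map_mem_span_of_comp_eq w ha
  · intro a ha
    induction ha using Submodule.span_induction with
    | mem x hx =>
      obtain ⟨a, ha, rfl⟩ := hx
      exact ⟨a, Submodule.subset_span ha, rfl⟩
    | zero => exact ⟨0, zero_mem _, map_zero _⟩
    | add x y _ _ hx hy =>
      obtain ⟨a, ha, rfl⟩ := hx
      obtain ⟨b, hb, rfl⟩ := hy
      exact ⟨a + b, add_mem ha hb, map_add _ _ _⟩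
    | smul r x _ hx =>
      obtain ⟨a, ha, rfl⟩ := hx
      obtain ⟨r, rfl⟩ := hf r
      exact ⟨r • a, Submodule.smul_mem _ _ ha, RingHom.map_smul_of_comp_eq w r a⟩

lemma exists_basis_of_bijective {R R' M M' ι : Type*} [CommRing R] [CommRing R'] [AddCommGroup M]
    [AddCommGroup M'] [Module R M] [Module R' M'] {f : R →+* R'} (hf : Function.Bijective f)
    (ψ : M →ₛₗ[f] M') (hψ : Function.Bijective ψ) (c' : Module.Basis ι R' M') :
    ∃ c : Module.Basis ι R M, ∀ i, ψ (c i) = c' i := by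
  let := Module.compHom M' f
  let e : R' ≃+* R := (RingEquiv.ofBijective f hf).symm
  let l : M' ≃ₗ[R] M :=
    (LinearEquiv.ofBijective (⟨ψ.toAddHom, ψ.map_smul'⟩ : M →ₗ[R] M') hψ).symm
  have he : ∀ r (x : M'), e r • x = r • x := fun r x => by
    obtain ⟨r, rfl⟩ := hf.2 r
    have : e (f r) = r := (RingEquiv.ofBijective f hf).symm_apply_apply r
    rw [this]
    rfl
  refine ⟨(c'.mapCoeffs e he).map l, fun i => ?_⟩
  rw [Module.Basis.map_apply, Module.Basis.mapCoeffs_apply]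
  exact l.symm_apply_apply (c' i)

lemma nonempty_quotient_basis_of_bijective {R R' A A' ι : Type*} [CommRing R]
    [CommRing R'] [CommRing A] [CommRing A'] [Algebra R A] [Algebra R' A'] {f : R →+* R'}
    {ψ : A →+* A'} (w : ψ.comp (algebraMap R A) = (algebraMap R' A').comp f)
    (hf : Function.Bijective f) (hψ : Function.Bijective ψ) {B : Submodule R A}
    {B' : Submodule R' A'} (hB : B' = Submodule.span R' (ψ '' B))
    (c' : Module.Basis ι R' (A' ⧸ B')) : Nonempty (Module.Basis ι R (A ⧸ B)) := by
  let ψ' : A →ₛₗ[f] A' := { ψ.toAddMonoidHom with map_smul' := RingHom.map_smul_of_comp_eq w }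
  have hmem : ∀ a, ψ' a ∈ B' ↔ a ∈ B := fun a => by
    have := RingHom.image_span_of_surjective w hf.2 (B : Set A)
    rw [Submodule.span_eq] at this
    rw [← SetLike.mem_coe, hB, ← this]
    exact hψ.1.mem_set_image
  have hq : Function.Bijective (B.mapQ B' ψ' fun a ha => (hmem a).2 ha) := by
    constructor
    · rw [injective_iff_map_eq_zero]
      intro a
      obtain ⟨a, rfl⟩ := Submodule.Quotient.mk_surjective _ a
      rw [Submodule.mapQ_apply, Submodule.Quotient.mk_eq_zero, Submodule.Quotient.mk_eq_zero]
      exact (hmem a).1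
    · intro a
      obtain ⟨a, rfl⟩ := Submodule.Quotient.mk_surjective _ a
      obtain ⟨a, rfl⟩ := hψ.2 a
      exact ⟨Submodule.Quotient.mk a, rfl⟩
  exact ⟨(exists_basis_of_bijective hf _ hq c').choose⟩

section OpenDescent

variable {X Y X' Y' X'' Y'' : Scheme.{u}} {p : X ⟶ Y} {p' : X' ⟶ Y'} {q : X' ⟶ X} {g : Y' ⟶ Y}

lemma bijective_appLE_of_isOpenImmersion [IsOpenImmersion g] {V : Y.Opens} {V' : Y'.Opens}
    (hV : V ≤ g.opensRange) (e : V' = g ⁻¹ᵁ V) :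
    Function.Bijective (g.appLE V V' e.le).hom := by
  subst e
  have := Scheme.Hom.isIso_app g V hV
  rw [← Scheme.Hom.app_eq_appLE]
  exact ConcreteCategory.bijective_of_isIso (g.app V)

lemma bijective_pullSec_of_isOpenImmersion [IsOpenImmersion g]
    (H : CategoryTheory.IsPullback q p' p g) {V : Y.Opens} {V' : Y'.Opens}
    (hV : V ≤ g.opensRange) (e : V' = g ⁻¹ᵁ V) :
    Function.Bijective (pullSec H.w e.le) := by
  have : IsOpenImmersion q :=
    MorphismProperty.IsStableUnderBaseChange.of_isPullback (P := @IsOpenImmersion) H.flip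
      inferInstance
  have hle : p ⁻¹ᵁ V ≤ q.opensRange := by
    refine (p.preimage_mono hV).trans ?_
    rw [← Scheme.Hom.opensRange_pullbackFst]
    rintro _ ⟨x, rfl⟩
    rw [← H.isoPullback_inv_fst, Scheme.Hom.comp_apply]
    exact ⟨_, rfl⟩
  refine bijective_appLE_of_isOpenImmersion hle ?_
  rw [e, ← Scheme.Hom.comp_preimage, ← H.w, Scheme.Hom.comp_preimage]

namespace QCohSubalgebra

/-- Pullback along an open immersion identifies the subalgebras. -/
lemma IsPullback.image_pullSec_eq [IsOpenImmersion g] (H : CategoryTheory.IsPullback q p' p g)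
    {B : QCohSubalgebra p} {B' : QCohSubalgebra p'} (hB : IsPullback H.w B B') {V : Y.affineOpens}
    {V' : Y'.affineOpens} (hV : V.1 ≤ g.opensRange) (e : V'.1 = g ⁻¹ᵁ V.1) :
    pullSec H.w e.le '' (B.sec V : Set (PushforwardSec p V)) = B'.sec V' := by
  rw [hB.coe_sec_eq e.le, ← RingHom.image_span_of_surjective (pullSec_comp_algebraMap H.w e.le)
    (bijective_appLE_of_isOpenImmersion hV e).2]
  congr 1
  exact (SetLike.ext'_iff.1 (Submodule.span_eq (Subalgebra.toSubmodule (B.sec V)))).symm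

lemma IsPullback.pullSec_mem_iff [IsOpenImmersion g] (H : CategoryTheory.IsPullback q p' p g)
    {B : QCohSubalgebra p} {B' : QCohSubalgebra p'} (hB : IsPullback H.w B B') {V : Y.affineOpens}
    {V' : Y'.affineOpens} (hV : V.1 ≤ g.opensRange) (e : V'.1 = g ⁻¹ᵁ V.1)
    (s : PushforwardSec p V) : pullSec H.w e.le s ∈ B'.sec V' ↔ s ∈ B.sec V := by
  rw [← SetLike.mem_coe, ← hB.image_pullSec_eq H hV e]
  exact (bijective_pullSec_of_isOpenImmersion H hV e).1.mem_set_image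

/-- Quasi-coherent subalgebras on the members of an open cover that agree over the affine opens of
the intersections are the restrictions of one quasi-coherent subalgebra. -/
lemma exists_of_openCover [IsAffineHom p] {J : Type*} {X' Y' : J → Scheme.{u}}
    {p' : ∀ j, X' j ⟶ Y' j} {q : ∀ j, X' j ⟶ X} {g : ∀ j, Y' j ⟶ Y} [∀ j, IsOpenImmersion (g j)]
    [∀ j, IsAffineHom (p' j)]
    (H : ∀ j, CategoryTheory.IsPullback (q j) (p' j) p (g j))
    (hcov : ∀ y : Y, ∃ j, y ∈ (g j).opensRange) (B' : ∀ j, QCohSubalgebra (p' j))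
    (hB' : ∀ (V : Y.affineOpens) (i j : J) (Vi : (Y' i).affineOpens) (Vj : (Y' j).affineOpens)
      (ei : Vi.1 = g i ⁻¹ᵁ V.1) (ej : Vj.1 = g j ⁻¹ᵁ V.1), V.1 ≤ (g i).opensRange →
      V.1 ≤ (g j).opensRange → ∀ s, pullSec (H i).w ei.le s ∈ (B' i).sec Vi →
        pullSec (H j).w ej.le s ∈ (B' j).sec Vj) :
    ∃ B : QCohSubalgebra p, ∀ j, IsPullback (H j).w B (B' j) := by
  classical
  let pre : ∀ (V : Y.affineOpens) (j : J), V.1 ≤ (g j).opensRange → (Y' j).affineOpens :=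
    fun V j h => ⟨g j ⁻¹ᵁ V.1, V.2.preimage_of_isOpenImmersion (g j) h⟩
  let sec₁ : ∀ (V : Y.affineOpens) (j : J), V.1 ≤ (g j).opensRange →
      Subalgebra Γ(Y, V) (PushforwardSec p V) := fun V j h =>
    { carrier := {s | pullSec (H j).w le_rfl s ∈ (B' j).sec (pre V j h)}
      mul_mem' := fun ha hb => by
        rw [Set.mem_ofPred_eq, map_mul]; exact mul_mem ha hb
      add_mem' := fun ha hb => by
        rw [Set.mem_ofPred_eq, map_add]; exact add_mem ha hb
      algebraMap_mem' := fun r => by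
        have := RingHom.congr_fun (pullSec_comp_algebraMap (H j).w (le_refl (g j ⁻¹ᵁ V.1))) r
        simp only [RingHom.comp_apply] at this
        rw [Set.mem_ofPred_eq, this]
        exact Subalgebra.algebraMap_mem ((B' j).sec (pre V j h)) _ }
  let sec₀ : ∀ V : Y.affineOpens, Subalgebra Γ(Y, V) (PushforwardSec p V) := fun V =>
    if h : ∃ j, V.1 ≤ (g j).opensRange then sec₁ V h.choose h.choose_spec else ⊥
  have hsec₀ : ∀ (V : Y.affineOpens) (j : J) (Vj : (Y' j).affineOpens) (ej : Vj.1 = g j ⁻¹ᵁ V.1)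
      (_ : V.1 ≤ (g j).opensRange) (s : PushforwardSec p V),
      s ∈ sec₀ V ↔ pullSec (H j).w ej.le s ∈ (B' j).sec Vj := by
    intro V j Vj ej hj s
    have h : ∃ j, V.1 ≤ (g j).opensRange := ⟨j, hj⟩
    simp only [sec₀, dif_pos h]
    exact ⟨hB' V _ j (pre V _ h.choose_spec) Vj rfl ej h.choose_spec hj s,
      hB' V j _ Vj (pre V _ h.choose_spec) ej rfl hj h.choose_spec s⟩
  have himage : ∀ (V : Y.affineOpens) (j : J) (Vj : (Y' j).affineOpens) (ej : Vj.1 = g j ⁻¹ᵁ V.1)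
      (_ : V.1 ≤ (g j).opensRange),
      pullSec (H j).w ej.le '' (sec₀ V : Set (PushforwardSec p V)) = (B' j).sec Vj := by
    intro V j Vj ej hj
    ext s
    constructor
    · rintro ⟨s, hs, rfl⟩
      exact (hsec₀ V j Vj ej hj s).1 hs
    · intro hs
      obtain ⟨s, rfl⟩ := (bijective_pullSec_of_isOpenImmersion (H j) hj ej).2 s
      exact ⟨s, (hsec₀ V j Vj ej hj s).2 hs, rfl⟩
  obtain ⟨B, hB⟩ := exists_extension (fun V => ∃ j, V.1 ≤ (g j).opensRange)
    (fun V W hWV ⟨j, hj⟩ => ⟨j, hWV.trans hj⟩) (fun y => by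
      obtain ⟨j, hj⟩ := hcov y
      obtain ⟨V, hyV, hV⟩ := Y.exists_affineOpens_mem_le hj
      exact ⟨V, hyV, j, hV⟩) sec₀ fun V W h ⟨j, hj⟩ => by
        apply SetLike.coe_injective
        have inj := (bijective_pullSec_of_isOpenImmersion (H j) (h.trans hj)
          (rfl : (pre W j (h.trans hj)).1 = _)).1
        refine inj.image_injective ?_
        have h1 : (pre W j (h.trans hj)).1 ≤ (pre V j hj).1 := (g j).preimage_mono h
        rw [RingHom.image_span_of_surjective (pullSec_comp_algebraMap (H j).w _)
          (bijective_appLE_of_isOpenImmersion (h.trans hj) rfl).2, Set.image_image]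
        simp only [pullSec_resSec]
        refine (himage W j (pre W j (h.trans hj)) rfl (h.trans hj)).trans ?_
        have h2 := (B' j).toSubmodule_sec_eq_span h1
        rw [← himage V j (pre V j hj) rfl hj, Set.image_image] at h2
        simp only [resSec_pullSec] at h2
        exact SetLike.ext'_iff.1 h2
  refine ⟨B, fun j => .of_local fun y => ?_⟩
  obtain ⟨V, hyV, hV⟩ := Y.exists_affineOpens_mem_le (U := (g j).opensRange) (y := g j y) ⟨y, rfl⟩
  refine ⟨V, pre V j hV, le_rfl, hyV, ?_⟩
  rw [hB V ⟨j, hV⟩]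
  have h3 := himage V j (pre V j hV) rfl hV
  rw [h3]
  exact (Submodule.span_eq _).symm

end QCohSubalgebra

end OpenDescent

/-! ### The sheaf of families -/

namespace QCohAlgebra

variable {S : Scheme.{u}} (𝒜 : QCohAlgebra S) (δ : ℕ)

/-- An `S`-scheme structure on `T`, together with an element of `F^δ_𝒜(T)`. -/
structure FamilyOver (T : Scheme.{u}) where
  hom : T ⟶ S
  family : 𝒜.Family (Over.mk hom) δ

namespace FamilyOver

variable {𝒜 δ} {T T' T'' : Scheme.{u}}

/-- `ξ'` is the pullback of `ξ` along `g`, as an `S`-scheme structure and as a family. -/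
def IsPullback (g : T' ⟶ T) (ξ : 𝒜.FamilyOver δ T) (ξ' : 𝒜.FamilyOver δ T') : Prop :=
  ∃ e : g ≫ ξ.hom = ξ'.hom,
    Family.IsPullback (Over.homMk g e : Over.mk ξ'.hom ⟶ Over.mk ξ.hom) ξ.family ξ'.family

lemma exists_isPullback (g : T' ⟶ T) (ξ : 𝒜.FamilyOver δ T) :
    ∃ ξ' : 𝒜.FamilyOver δ T', IsPullback g ξ ξ' := by
  obtain ⟨ℬ', h⟩ := Family.exists_isPullback
    (Over.homMk g rfl : Over.mk (g ≫ ξ.hom) ⟶ Over.mk ξ.hom) ξ.family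
  exact ⟨⟨g ≫ ξ.hom, ℬ'⟩, rfl, h⟩

lemma IsPullback.unique {g : T' ⟶ T} {ξ : 𝒜.FamilyOver δ T} {ξ₁ ξ₂ : 𝒜.FamilyOver δ T'}
    (h₁ : IsPullback g ξ ξ₁) (h₂ : IsPullback g ξ ξ₂) : ξ₁ = ξ₂ := by
  obtain ⟨f₁, ℬ₁⟩ := ξ₁
  obtain ⟨f₂, ℬ₂⟩ := ξ₂
  obtain ⟨e₁, h₁⟩ := h₁
  obtain ⟨e₂, h₂⟩ := h₂
  simp only at e₁ e₂
  subst e₁ e₂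
  obtain rfl := Family.IsPullback.unique h₁ h₂
  rfl

lemma IsPullback.comp {g : T' ⟶ T} {g' : T'' ⟶ T'} {ξ : 𝒜.FamilyOver δ T}
    {ξ' : 𝒜.FamilyOver δ T'} {ξ'' : 𝒜.FamilyOver δ T''} (h : IsPullback g ξ ξ')
    (h' : IsPullback g' ξ' ξ'') : IsPullback (g' ≫ g) ξ ξ'' :=
  have w : (g' ≫ g) ≫ ξ.hom = ξ''.hom := by rw [Category.assoc, h.1, h'.1]
  ⟨w, by
    have e : (Over.homMk (g' ≫ g) w : Over.mk ξ''.hom ⟶ Over.mk ξ.hom) =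
        (Over.homMk g' h'.1 : Over.mk ξ''.hom ⟶ Over.mk ξ'.hom) ≫
          (Over.homMk g h.1 : Over.mk ξ'.hom ⟶ Over.mk ξ.hom) := by
      ext : 1
      rfl
    rw [e]
    exact Family.IsPullback.comp h.2 h'.2⟩

lemma isPullback_id (ξ : 𝒜.FamilyOver δ T) : IsPullback (𝟙 T) ξ ξ :=
  ⟨Category.id_comp _, by
    have e : (Over.homMk (𝟙 T) (Category.id_comp _) : Over.mk ξ.hom ⟶ Over.mk ξ.hom) = 𝟙 _ := by
      ext : 1
      rfl
    rw [e]
    exact Family.isPullback_id ξ.family⟩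

/-- The pullback of a family along `g`. -/
noncomputable def pull (g : T' ⟶ T) (ξ : 𝒜.FamilyOver δ T) : 𝒜.FamilyOver δ T' :=
  (exists_isPullback g ξ).choose

lemma isPullback_pull (g : T' ⟶ T) (ξ : 𝒜.FamilyOver δ T) : IsPullback g ξ (pull g ξ) :=
  (exists_isPullback g ξ).choose_spec

lemma pull_eq_iff {g : T' ⟶ T} {ξ : 𝒜.FamilyOver δ T} {ξ' : 𝒜.FamilyOver δ T'} :
    pull g ξ = ξ' ↔ IsPullback g ξ ξ' :=
  ⟨fun h => h ▸ isPullback_pull g ξ, fun h => (isPullback_pull g ξ).unique h⟩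

lemma pull_id (ξ : 𝒜.FamilyOver δ T) : pull (𝟙 T) ξ = ξ :=
  pull_eq_iff.2 (isPullback_id ξ)

lemma pull_comp (g : T' ⟶ T) (g' : T'' ⟶ T') (ξ : 𝒜.FamilyOver δ T) :
    pull (g' ≫ g) ξ = pull g' (pull g ξ) :=
  pull_eq_iff.2 ((isPullback_pull g ξ).comp (isPullback_pull g' _))

/-- A family is determined by its restrictions to the members of an open cover. -/
lemma eq_of_openCover {ξ₁ ξ₂ : 𝒜.FamilyOver δ T} (𝒲 : T.OpenCover)
    (h : ∀ j, pull (𝒲.f j) ξ₁ = pull (𝒲.f j) ξ₂) : ξ₁ = ξ₂ := by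
  obtain ⟨f₁, ℬ₁⟩ := ξ₁
  obtain ⟨f₂, ℬ₂⟩ := ξ₂
  have h' : ∀ j, IsPullback (𝒲.f j) ⟨f₁, ℬ₁⟩ (pull (𝒲.f j) ⟨f₂, ℬ₂⟩) := fun j =>
    pull_eq_iff.1 (h j)
  obtain rfl : f₁ = f₂ := 𝒲.hom_ext _ _ fun j => by
    rw [(h' j).1]
    exact (isPullback_pull (𝒲.f j) (⟨f₂, ℬ₂⟩ : 𝒜.FamilyOver δ T)).1.symm
  suffices ℬ₁ = ℬ₂ by rw [this]
  apply Family.toQCohSubalgebra_injective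
  refine QCohSubalgebra.ext_of_local fun y => ?_
  obtain ⟨j, hj⟩ : ∃ j, y ∈ (𝒲.f j).opensRange := ⟨_, 𝒲.covers y⟩
  obtain ⟨V, hyV, hV⟩ := T.exists_affineOpens_mem_le hj
  refine ⟨V, hyV, ?_⟩
  let V' : (𝒲.X j).affineOpens := ⟨𝒲.f j ⁻¹ᵁ V.1, V.2.preimage_of_isOpenImmersion (𝒲.f j) hV⟩
  have h1 := h' j
  have h2 := isPullback_pull (𝒲.f j) (⟨f₁, ℬ₂⟩ : 𝒜.FamilyOver δ T)
  set η := pull (𝒲.f j) (⟨f₁, ℬ₂⟩ : 𝒜.FamilyOver δ T)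
  let g : Over.mk η.hom ⟶ Over.mk f₁ := Over.homMk (𝒲.f j) h1.1
  have : IsOpenImmersion g.left := inferInstanceAs (IsOpenImmersion (𝒲.f j))
  have k1 := QCohSubalgebra.IsPullback.pullSec_mem_iff (𝒜.isPullback_projMap g) (V' := V')
    (Family.isPullback_iff.1 h1.2) hV rfl
  have k2 := QCohSubalgebra.IsPullback.pullSec_mem_iff (𝒜.isPullback_projMap g) (V' := V')
    (Family.isPullback_iff.1 h2.2) hV rfl
  ext s
  rw [← k1, ← k2]

/-- Compatible families on the members of an open cover glue. -/
lemma exists_of_openCover (𝒲 : T.OpenCover) (ξ : ∀ j, 𝒜.FamilyOver δ (𝒲.X j))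
    (hξ : ∀ (Z : Scheme.{u}) (i j : 𝒲.I₀) (a : Z ⟶ 𝒲.X i) (b : Z ⟶ 𝒲.X j),
      a ≫ 𝒲.f i = b ≫ 𝒲.f j → pull a (ξ i) = pull b (ξ j)) :
    ∃ η : 𝒜.FamilyOver δ T, ∀ j, IsPullback (𝒲.f j) η (ξ j) := by
  let f : T ⟶ S := 𝒲.glueMorphisms (fun j => (ξ j).hom) fun i j => by
    have := hξ _ i j _ _ (pullback.condition (f := 𝒲.f i) (g := 𝒲.f j))
    rw [(isPullback_pull (pullback.fst (𝒲.f i) (𝒲.f j)) (ξ i)).1, this,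
      (isPullback_pull (pullback.snd (𝒲.f i) (𝒲.f j)) (ξ j)).1]
  have hf : ∀ j, 𝒲.f j ≫ f = (ξ j).hom := fun j => 𝒲.ι_glueMorphisms _ _ j
  let g : ∀ j, Over.mk (ξ j).hom ⟶ Over.mk f := fun j => Over.homMk (𝒲.f j) (hf j)
  have hg : ∀ j, IsOpenImmersion (g j).left := fun j => inferInstanceAs (IsOpenImmersion (𝒲.f j))
  obtain ⟨B, hB⟩ := QCohSubalgebra.exists_of_openCover (p := 𝒜.proj (Over.mk f))
    (g := fun j => (g j).left)
    (fun j => 𝒜.isPullback_projMap (g j)) (fun y => ⟨_, 𝒲.covers y⟩)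
    (fun j => (ξ j).family.toQCohSubalgebra) (fun V i j Vi Vj ei ej hi hj s hs => by
      have hri : Set.range V.1.ι ⊆ Set.range (𝒲.f i) := by
        rw [Scheme.Opens.range_ι]; exact hi
      have hrj : Set.range V.1.ι ⊆ Set.range (𝒲.f j) := by
        rw [Scheme.Opens.range_ι]; exact hj
      let a : V.1.toScheme ⟶ 𝒲.X i := IsOpenImmersion.lift (𝒲.f i) V.1.ι hri
      let b : V.1.toScheme ⟶ 𝒲.X j := IsOpenImmersion.lift (𝒲.f j) V.1.ι hrj
      have ha : a ≫ 𝒲.f i = V.1.ι := IsOpenImmersion.lift_fac _ _ _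
      have hb : b ≫ 𝒲.f j = V.1.ι := IsOpenImmersion.lift_fac _ _ _
      have : IsOpenImmersion a := by
        have : IsOpenImmersion (a ≫ 𝒲.f i) := by rw [ha]; infer_instance
        exact IsOpenImmersion.of_comp a (𝒲.f i)
      have : IsOpenImmersion b := by
        have : IsOpenImmersion (b ≫ 𝒲.f j) := by rw [hb]; infer_instance
        exact IsOpenImmersion.of_comp b (𝒲.f j)
      have hpa := isPullback_pull a (ξ i)
      have hpb := isPullback_pull b (ξ j)
      rw [← hξ _ i j a b (ha.trans hb.symm)] at hpb
      set η := pull a (ξ i)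
      have hη : V.1.ι ≫ f = η.hom := by rw [← ha, Category.assoc, hf, hpa.1]
      let ga : Over.mk η.hom ⟶ Over.mk (ξ i).hom := Over.homMk a hpa.1
      let gb : Over.mk η.hom ⟶ Over.mk (ξ j).hom := Over.homMk b hpb.1
      have : IsOpenImmersion ga.left := inferInstanceAs (IsOpenImmersion a)
      have : IsOpenImmersion gb.left := inferInstanceAs (IsOpenImmersion b)
      let t : V.1.toScheme.affineOpens := ⟨⊤, isAffineOpen_top _⟩
      have hta : t.1 = a ⁻¹ᵁ Vi.1 := by
        have : Vi.1 = 𝒲.f i ⁻¹ᵁ V.1 := ei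
        rw [this, ← Scheme.Hom.comp_preimage, ha, Scheme.Opens.ι_preimage_self]
      have htb : t.1 = b ⁻¹ᵁ Vj.1 := by
        have : Vj.1 = 𝒲.f j ⁻¹ᵁ V.1 := ej
        rw [this, ← Scheme.Hom.comp_preimage, hb, Scheme.Opens.ι_preimage_self]
      have hVi : Vi.1 ≤ a.opensRange := by
        intro x hx
        have hx' : 𝒲.f i x ∈ V.1 := ei.le hx
        refine ⟨(⟨_, hx'⟩ : V.1.toScheme), (𝒲.f i).isOpenEmbedding.injective ?_⟩
        exact (Scheme.Hom.comp_apply a _ _).symm.trans (by rw [ha]; rfl)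
      have hVj : Vj.1 ≤ b.opensRange := by
        intro x hx
        have hx' : 𝒲.f j x ∈ V.1 := ej.le hx
        refine ⟨(⟨_, hx'⟩ : V.1.toScheme), (𝒲.f j).isOpenEmbedding.injective ?_⟩
        exact (Scheme.Hom.comp_apply b _ _).symm.trans (by rw [hb]; rfl)
      have ki := QCohSubalgebra.IsPullback.pullSec_mem_iff (𝒜.isPullback_projMap ga) (V' := t)
        (Family.isPullback_iff.1 hpa.2) hVi hta
      have kj := QCohSubalgebra.IsPullback.pullSec_mem_iff (𝒜.isPullback_projMap gb) (V' := t)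
        (Family.isPullback_iff.1 hpb.2) hVj htb
      rw [← kj]
      rw [← ki] at hs
      have hgg : ga ≫ g i = gb ≫ g j := by
        ext : 1
        exact ha.trans hb.symm
      have hle : t.1 ≤ (ga ≫ g i).left ⁻¹ᵁ V.1 := by
        rw [Over.comp_left, Scheme.Hom.comp_preimage]
        exact hta.le.trans (a.preimage_mono ei.le)
      rw [pullSec_comp _ _ (𝒜.projMap_comp ga (g i)) (Over.comp_left _ _ _ _ _).symm
        (𝒜.projMap_comp_proj (ga ≫ g i)) _ _ hle] at hs
      rw [pullSec_comp _ _ ((𝒜.projMap_comp gb (g j)).trans (by rw [hgg]))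
        ((Over.comp_left _ _ _ _ _).symm.trans (by rw [hgg]))
        (𝒜.projMap_comp_proj (ga ≫ g i)) _ _ hle]
      exact hs)
  refine ⟨⟨f, ⟨B, fun x => ?_⟩⟩, fun j => ⟨hf j, hB j⟩⟩
  obtain ⟨j, y, hy⟩ : ∃ j, x ∈ (𝒲.f j).opensRange := ⟨_, 𝒲.covers x⟩
  obtain ⟨V', hyV', ⟨c⟩⟩ := (ξ j).family.corank y
  let V : T.affineOpens := ⟨𝒲.f j ''ᵁ V'.1, V'.2.image_of_isOpenImmersion (𝒲.f j)⟩
  have hV : V.1 ≤ (𝒲.f j).opensRange := (𝒲.f j).image_le_opensRange _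
  have hV' : V'.1 = 𝒲.f j ⁻¹ᵁ V.1 := ((𝒲.f j).preimage_image_eq _).symm
  refine ⟨V, ⟨y, hyV', hy⟩, ?_⟩
  exact nonempty_quotient_basis_of_bijective
    (B := Subalgebra.toSubmodule (B.sec V)) (B' := Subalgebra.toSubmodule ((ξ j).family.sec V'))
    (pullSec_comp_algebraMap (𝒜.projMap_comp_proj (g j)) hV'.le)
    (bijective_appLE_of_isOpenImmersion hV hV')
    (bijective_pullSec_of_isOpenImmersion (𝒜.isPullback_projMap (g j)) hV hV')
    (hB j V V' hV'.le) c

end FamilyOver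

/-- The functor that sends a scheme `T` to the pairs of an `S`-scheme structure on `T` and an
element of `F^δ_𝒜(T)`. It is represented by a scheme if and only if `F^δ_𝒜` is represented by an
`S`-scheme. -/
noncomputable def familyFunctor : Scheme.{u}ᵒᵖ ⥤ Type u where
  obj T := 𝒜.FamilyOver δ T.unop
  map g := ↾(FamilyOver.pull g.unop)
  map_id T := by ext ξ; exact FamilyOver.pull_id ξ
  map_comp g g' := by ext ξ; exact FamilyOver.pull_comp _ _ ξ

lemma isSheaf_familyFunctor : Presheaf.IsSheaf zariskiTopology (𝒜.familyFunctor δ) := by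
  rw [isSheaf_iff_isSheaf_of_type,
    Precoverage.isSheaf_toGrothendieck_iff_of_isStableUnderBaseChange]
  rintro Y R hR x hx
  obtain ⟨(𝓤 : OpenCover Y), rfl⟩ := exists_cover_of_mem_pretopology hR
  obtain ⟨η, hη⟩ := FamilyOver.exists_of_openCover 𝓤 (fun j => x (𝓤.f j) (.mk j))
    fun Z i j a b h => hx a b (.mk i) (.mk j) h
  refine ⟨η, ?_, fun η' h' => ?_⟩
  · rintro Z _ ⟨j⟩
    exact FamilyOver.pull_eq_iff.2 (hη j)
  · refine FamilyOver.eq_of_openCover 𝓤 fun j => ?_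
    rw [FamilyOver.pull_eq_iff.2 (hη j)]
    exact h' (𝓤.f j) (.mk j)

end QCohAlgebra

/-! ### Subalgebras with a prescribed basis of the quotient -/

section Chart

variable {R R' A A' : Type*} [CommRing R] [CommRing R'] [CommRing A] [CommRing A'] [Algebra R A]
  [Algebra R' A'] {n δ : ℕ}

/-- The linear map `A → R^δ` with matrix `K` in the basis `e` of `A`. -/
noncomputable def coordMap (e : Module.Basis (Fin n) R A) (K : Fin δ → Fin n → R) :
    A →ₗ[R] (Fin δ → R) :=
  e.constr R fun i j => K j i

@[simp] lemma coordMap_basis (e : Module.Basis (Fin n) R A) (K : Fin δ → Fin n → R) (i : Fin n) :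
    coordMap e K (e i) = fun j => K j i :=
  e.constr_basis R _ i

/-- When the entries of `K` express the classes of the `e i` in terms of those of the `e (ι l)`,
these elements generate the kernel of `coordMap e K`. -/
noncomputable def kerGenerator (e : Module.Basis (Fin n) R A) (ι : Fin δ → Fin n)
    (K : Fin δ → Fin n → R) (i : Fin n) : A :=
  e i - ∑ l, K l i • e (ι l)

/-- The elements of `R` whose vanishing says that the kernel of `coordMap e K` is a subalgebra with
the classes of the `e (ι j)` as a basis of the quotient. -/
def chartRelations (e : Module.Basis (Fin n) R A) (ι : Fin δ → Fin n) (K : Fin δ → Fin n → R) :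
    Set R :=
  Set.range (fun x : Fin δ × Fin δ => K x.1 (ι x.2) - (1 : Matrix (Fin δ) (Fin δ) R) x.1 x.2) ∪
    Set.range (coordMap e K 1) ∪
    Set.range fun x : Fin n × Fin n × Fin δ =>
      coordMap e K (kerGenerator e ι K x.1 * kerGenerator e ι K x.2.1) x.2.2

section

variable {e : Module.Basis (Fin n) R A} {ι : Fin δ → Fin n} {K : Fin δ → Fin n → R}

lemma chartRelations_eq_zero_iff : (∀ r ∈ chartRelations e ι K, r = 0) ↔
    (∀ j k, K j (ι k) = (1 : Matrix (Fin δ) (Fin δ) R) j k) ∧ coordMap e K 1 = 0 ∧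
    ∀ i k, coordMap e K (kerGenerator e ι K i * kerGenerator e ι K k) = 0 := by
  simp only [chartRelations, Set.mem_union, or_imp, forall_and, Set.forall_mem_range, Prod.forall,
    sub_eq_zero, funext_iff, Pi.zero_apply, and_assoc]

lemma sub_mem_span_kerGenerator (a : A) :
    a - ∑ l, coordMap e K a l • e (ι l) ∈ Submodule.span R (Set.range (kerGenerator e ι K)) := by
  have h : a - ∑ l, coordMap e K a l • e (ι l) = ∑ i, e.repr a i • kerGenerator e ι K i := by
    have h1 : ∀ l, coordMap e K a l = ∑ i, e.repr a i * K l i := fun l => by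
      conv_lhs => rw [← e.sum_repr a, map_sum]
      simp only [map_smul, coordMap_basis, Finset.sum_apply, Pi.smul_apply, smul_eq_mul]
    simp only [kerGenerator, smul_sub, Finset.sum_sub_distrib, e.sum_repr, h1, Finset.sum_smul,
      Finset.smul_sum, smul_smul]
    rw [Finset.sum_comm]
  rw [h]
  exact Submodule.sum_mem _ fun i _ => Submodule.smul_mem _ _ (Submodule.subset_span ⟨i, rfl⟩)

lemma ker_coordMap_le_span_kerGenerator (ι : Fin δ → Fin n) :
    LinearMap.ker (coordMap e K) ≤ Submodule.span R (Set.range (kerGenerator e ι K)) := by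
  intro a ha
  have := sub_mem_span_kerGenerator (e := e) (ι := ι) (K := K) a
  rw [LinearMap.mem_ker.1 ha] at this
  simpa using this

/-- The kernel of `coordMap e K` is closed under multiplication, as it is spanned by the
`kerGenerator e ι K i`, whose products it contains. -/
lemma exists_subalgebra_of_chartRelations (h : ∀ r ∈ chartRelations e ι K, r = 0) :
    ∃ (B : Subalgebra R A) (c : Module.Basis (Fin δ) R (A ⧸ Subalgebra.toSubmodule B)),
      (∀ j, c j = Submodule.Quotient.mk (e (ι j))) ∧
      ∀ a j, c.repr (Submodule.Quotient.mk a) j = coordMap e K a j := by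
  classical
  obtain ⟨h1, h2, h3⟩ := chartRelations_eq_zero_iff.1 h
  have hgen : ∀ i, coordMap e K (kerGenerator e ι K i) = 0 := fun i => by
    ext j
    simp [kerGenerator, h1, Matrix.one_apply]
  have hmul : ∀ a b, coordMap e K a = 0 → coordMap e K b = 0 → coordMap e K (a * b) = 0 := by
    intro a b ha hb
    have ha := ker_coordMap_le_span_kerGenerator ι (LinearMap.mem_ker.2 ha)
    have hb := ker_coordMap_le_span_kerGenerator ι (LinearMap.mem_ker.2 hb)
    have hab := Submodule.mul_mem_mul ha hb
    rw [Submodule.span_mul_span] at hab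
    refine (Submodule.span_le (p := LinearMap.ker (coordMap e K))).2 ?_ hab
    rintro _ ⟨_, ⟨i, rfl⟩, _, ⟨k, rfl⟩, rfl⟩
    exact LinearMap.mem_ker.2 (h3 i k)
  let B : Subalgebra R A :=
    { carrier := {a | coordMap e K a = 0}
      mul_mem' := fun {a b} ha hb => hmul a b ha hb
      add_mem' := fun {a b} (ha : _ = _) (hb : _ = _) => by
        rw [Set.mem_ofPred_eq, map_add, ha, hb, add_zero]
      algebraMap_mem' := fun r => by
        rw [Set.mem_ofPred_eq, Algebra.algebraMap_eq_smul_one, map_smul, h2, smul_zero] }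
  have hB : Subalgebra.toSubmodule B = LinearMap.ker (coordMap e K) := rfl
  have hsurj : Function.Surjective (coordMap e K) := fun v => by
    refine ⟨∑ l, v l • e (ι l), ?_⟩
    ext j
    simp [h1, Matrix.one_apply]
  let c : Module.Basis (Fin δ) R (A ⧸ Subalgebra.toSubmodule B) :=
    .ofEquivFun ((Submodule.quotEquivOfEq _ _ hB).trans
      ((coordMap e K).quotKerEquivOfSurjective hsurj))
  have hc : ∀ a j, c.repr (Submodule.Quotient.mk a) j = coordMap e K a j := fun a j => rfl
  refine ⟨B, c, fun j => ?_, hc⟩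
  apply c.repr.injective
  ext k
  rw [hc, c.repr_self, coordMap_basis, Finsupp.single_apply]
  refine Eq.trans ?_ (h1 k j).symm
  simp only [Matrix.one_apply, eq_comm]

/-- The matrix of the projection `A → A / B`, in the basis `e` of `A` and a basis of `A / B`. -/
noncomputable def quotientMatrix {B : Submodule R A} (e : Module.Basis (Fin n) R A)
    (c : Module.Basis (Fin δ) R (A ⧸ B)) (j : Fin δ) (i : Fin n) : R :=
  c.repr (Submodule.Quotient.mk (e i)) j

lemma coordMap_quotientMatrix {B : Submodule R A} (c : Module.Basis (Fin δ) R (A ⧸ B)) (a : A)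
    (j : Fin δ) : coordMap e (quotientMatrix e c) a j = c.repr (Submodule.Quotient.mk a) j := by
  have : LinearMap.proj j ∘ₗ coordMap e (quotientMatrix e c) =
      Finsupp.lapply j ∘ₗ c.repr.toLinearMap ∘ₗ B.mkQ := by
    refine e.ext fun i => ?_
    simp [quotientMatrix]
  exact LinearMap.congr_fun this a

lemma mem_iff_coordMap_eq_zero {B : Submodule R A} (c : Module.Basis (Fin δ) R (A ⧸ B))
    (hc : ∀ a j, c.repr (Submodule.Quotient.mk a) j = coordMap e K a j) (a : A) :
    a ∈ B ↔ coordMap e K a = 0 := by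
  rw [← Submodule.Quotient.mk_eq_zero, ← c.repr.map_eq_zero_iff, Finsupp.ext_iff, funext_iff]
  simp only [hc, Finsupp.zero_apply, Pi.zero_apply]

lemma chartRelations_quotientMatrix {B : Subalgebra R A}
    (c : Module.Basis (Fin δ) R (A ⧸ Subalgebra.toSubmodule B))
    (hc : ∀ j, c j = Submodule.Quotient.mk (e (ι j))) :
    ∀ r ∈ chartRelations e ι (quotientMatrix e c), r = 0 := by
  classical
  have hmem := mem_iff_coordMap_eq_zero c fun a j => (coordMap_quotientMatrix (e := e) c a j).symm
  have h1 : ∀ j k, quotientMatrix e c j (ι k) = (1 : Matrix (Fin δ) (Fin δ) R) j k := fun j k => by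
    rw [quotientMatrix, ← hc, c.repr_self, Matrix.one_apply, Finsupp.single_apply]
    simp only [eq_comm]
  have hgen : ∀ i, kerGenerator e ι (quotientMatrix e c) i ∈ B := fun i => by
    refine (hmem _).2 ?_
    ext j
    simp [kerGenerator, h1, Matrix.one_apply]
  exact chartRelations_eq_zero_iff.2 ⟨h1, (hmem 1).1 B.one_mem,
    fun i k => (hmem _).1 (B.mul_mem (hgen i) (hgen k))⟩

end

section BaseChange

variable {f : R →+* R'} {ψ : A →+* A'} (w : ψ.comp (algebraMap R A) = (algebraMap R' A').comp f)
  {e : Module.Basis (Fin n) R A} {e' : Module.Basis (Fin n) R' A'} (he : ∀ i, e' i = ψ (e i))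
include w he

lemma coordMap_map (K : Fin δ → Fin n → R) (a : A) (j : Fin δ) :
    coordMap e' (fun j i => f (K j i)) (ψ a) j = f (coordMap e K a j) := by
  rw [← e.sum_repr a, map_sum, map_sum, map_sum]
  simp only [RingHom.map_smul_of_comp_eq w, ← he, map_smul, coordMap_basis, Finset.sum_apply,
    Pi.smul_apply, smul_eq_mul, map_sum, map_mul]

lemma chartRelations_map (ι : Fin δ → Fin n) (K : Fin δ → Fin n → R) :
    chartRelations e' ι (fun j i => f (K j i)) = f '' chartRelations e ι K := by
  have hgen : ∀ i, kerGenerator e' ι (fun j i => f (K j i)) i = ψ (kerGenerator e ι K i) := by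
    intro i
    simp [kerGenerator, RingHom.map_smul_of_comp_eq w, he]
  have h1 : coordMap e' (fun j i => f (K j i)) 1 = f ∘ coordMap e K 1 := by
    ext j
    rw [← map_one ψ, coordMap_map w he]
    rfl
  simp only [chartRelations, Set.image_union, ← Set.range_comp, h1, hgen, ← map_mul,
    coordMap_map w he]
  congr 2
  ext x
  simp [Matrix.one_apply, apply_ite f]

end BaseChange

/-- A submodule with the classes of the `e (ι j)` as a basis of the quotient is determined by the
matrix of the projection to the quotient, so that base change of submodules may be tested on
matrices. -/
lemma toSubmodule_eq_span_iff {f : R →+* R'} {ψ : A →+* A'} (h : IsAlgBaseChange f ψ)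
    {e : Module.Basis (Fin n) R A} {e' : Module.Basis (Fin n) R' A'} (he : ∀ i, e' i = ψ (e i))
    {ι : Fin δ → Fin n} {B : Submodule R A} {B' : Submodule R' A'}
    (c : Module.Basis (Fin δ) R (A ⧸ B)) (hc : ∀ j, c j = Submodule.Quotient.mk (e (ι j)))
    (c' : Module.Basis (Fin δ) R' (A' ⧸ B')) (hc' : ∀ j, c' j = Submodule.Quotient.mk (e' (ι j))) :
    B' = Submodule.span R' (ψ '' B) ↔
      ∀ j i, f (quotientMatrix e c j i) = quotientMatrix e' c' j i := by
  constructor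
  · intro hB j i
    obtain ⟨d, hd⟩ := h.exists_quotient_basis hB c
    have : d = c' := by
      refine Module.Basis.eq_of_apply_eq fun j => ?_
      rw [hc', he]
      apply d.repr.injective
      ext k
      rw [hd, ← hc, c.repr_self, d.repr_self]
      simp [Finsupp.single_apply, apply_ite f]
    rw [← this, quotientMatrix, quotientMatrix, he, hd]
  · intro hK
    obtain ⟨d, hd⟩ := h.exists_quotient_basis rfl c
    have hd' : ∀ a j, d.repr (Submodule.Quotient.mk a) j =
        coordMap e' (quotientMatrix e' c') a j := by
      intro a j
      have hm : quotientMatrix e' d = quotientMatrix e' c' := by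
        ext j i
        rw [← hK, quotientMatrix, he, hd]
        rfl
      rw [← coordMap_quotientMatrix (e := e'), hm]
    ext a
    rw [mem_iff_coordMap_eq_zero d hd' a,
      mem_iff_coordMap_eq_zero c' fun a j => (coordMap_quotientMatrix (e := e') c' a j).symm]

open scoped TensorProduct

variable (e : Module.Basis (Fin n) R A) (ι : Fin δ → Fin n)

/-- The relations, in the polynomial ring over `R`, between the entries of the matrix of the
projection to a quotient by a subalgebra. -/
noncomputable def chartIdeal : Ideal (MvPolynomial (Fin δ × Fin n) R) :=
  Ideal.span (chartRelations (Algebra.TensorProduct.basis (MvPolynomial (Fin δ × Fin n) R) e) ι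
    fun j i => MvPolynomial.X (j, i))

/-- The coordinate ring of the space of subalgebras of `A` such that the classes of the `e (ι j)`
are a basis of the quotient. -/
abbrev ChartRing : Type _ := MvPolynomial (Fin δ × Fin n) R ⧸ chartIdeal e ι

/-- The matrix of the universal projection `A → A / B`. -/
noncomputable def chartMatrix (j : Fin δ) (i : Fin n) : ChartRing e ι :=
  Ideal.Quotient.mk _ (MvPolynomial.X (j, i))

lemma ChartRing.hom_ext {Q : Type*} [CommRing Q] {g₁ g₂ : ChartRing e ι →+* Q}
    (h : g₁.comp (algebraMap R _) = g₂.comp (algebraMap R _))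
    (h' : ∀ j i, g₁ (chartMatrix e ι j i) = g₂ (chartMatrix e ι j i)) : g₁ = g₂ := by
  apply Ideal.Quotient.ringHom_ext
  apply MvPolynomial.ringHom_ext
  · exact fun r => RingHom.congr_fun h r
  · exact fun x => h' x.1 x.2

variable {e} {f : R →+* R'} {ψ : A →+* A'}
  (w : ψ.comp (algebraMap R A) = (algebraMap R' A').comp f)
  {e' : Module.Basis (Fin n) R' A'} (he : ∀ i, e' i = ψ (e i))
include w he

/-- The relations for a matrix are the values of the universal ones, which are formed over the
polynomial ring. -/
lemma chartRelations_eval (K : Fin δ → Fin n → R') : chartRelations e' ι K =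
    MvPolynomial.eval₂Hom f (fun x : Fin δ × Fin n => K x.1 x.2) ''
      chartRelations (Algebra.TensorProduct.basis (MvPolynomial (Fin δ × Fin n) R) e) ι
        fun j i => MvPolynomial.X (j, i) := by
  let := ((algebraMap R' A').comp f).toAlgebra
  let g := MvPolynomial.eval₂Hom f (fun x : Fin δ × Fin n => K x.1 x.2)
  let l₁ : MvPolynomial (Fin δ × Fin n) R →ₐ[R] A' :=
    { (algebraMap R' A').comp g with
      commutes' := fun r => by
        simp [g, MvPolynomial.algebraMap_eq]
        rfl }
  let l₂ : A →ₐ[R] A' := { ψ with commutes' := fun r => RingHom.congr_fun w r }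
  let l : MvPolynomial (Fin δ × Fin n) R ⊗[R] A →ₐ[R] A' :=
    Algebra.TensorProduct.lift l₁ l₂ fun _ _ => .all _ _
  have h1 : ∀ (p : MvPolynomial (Fin δ × Fin n) R) (a : A), l (p ⊗ₜ a) =
    algebraMap R' A' (g p) * ψ a := fun p a => Algebra.TensorProduct.lift_tmul _ _ _ _ _
  have := chartRelations_map (f := g) (ψ := (l : MvPolynomial (Fin δ × Fin n) R ⊗[R] A →+* A'))
    (e := Algebra.TensorProduct.basis (MvPolynomial (Fin δ × Fin n) R) e) (e' := e')
    (RingHom.ext fun p => by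
      change l (p ⊗ₜ 1) = _
      rw [h1, map_one, mul_one]
      rfl)
    (fun i => by
      rw [Algebra.TensorProduct.basis_apply]
      refine Eq.trans ?_ (h1 1 (e i)).symm
      rw [map_one, map_one, one_mul, he]) ι (fun j i => MvPolynomial.X (j, i))
  rw [← this]
  congr 1
  ext j i
  simp [g]

lemma ChartRing.exists_hom (K : Fin δ → Fin n → R') (hK : ∀ r ∈ chartRelations e' ι K, r = 0) :
    ∃ g : ChartRing e ι →+* R', g.comp (algebraMap R _) = f ∧
      ∀ j i, g (chartMatrix e ι j i) = K j i := by
  let g := MvPolynomial.eval₂Hom f (fun x : Fin δ × Fin n => K x.1 x.2)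
  have hg : ∀ p ∈ chartIdeal e ι, g p = 0 := by
    intro p hp
    refine (Ideal.span_le (I := RingHom.ker g)).2 (fun r hr => ?_) hp
    refine hK _ ?_
    rw [chartRelations_eval ι w he]
    exact ⟨r, hr, rfl⟩
  refine ⟨Ideal.Quotient.lift _ g hg, ?_, fun j i => ?_⟩
  · ext r
    change g (algebraMap R _ r) = _
    simp [g, MvPolynomial.algebraMap_eq]
  · rw [chartMatrix, Ideal.Quotient.lift_mk]
    simp [g]

lemma ChartRing.chartRelations_eq_zero (g : ChartRing e ι →+* R')
    (hg : g.comp (algebraMap R _) = f) :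
    ∀ r ∈ chartRelations e' ι (fun j i => g (chartMatrix e ι j i)), r = 0 := by
  rw [chartRelations_eval ι w he]
  rintro _ ⟨r, hr, rfl⟩
  have : MvPolynomial.eval₂Hom f (fun x : Fin δ × Fin n => g (chartMatrix e ι x.1 x.2)) =
      g.comp (Ideal.Quotient.mk _) := by
    apply MvPolynomial.ringHom_ext
    · intro r
      rw [← hg]
      simp
      rfl
    · intro x
      simp [chartMatrix]
  have hr' : Ideal.Quotient.mk (chartIdeal e ι) r = 0 :=
    Ideal.Quotient.eq_zero_iff_mem.2 (Ideal.subset_span hr)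
  rw [this, RingHom.comp_apply, hr', map_zero]

end Chart

/-! ### Trivializations -/

lemma AlgebraicGeometry.IsAffineOpen.fromSpec_appLE_self {S : Scheme.{u}} {U : S.Opens}
    (hU : IsAffineOpen U) :
    hU.fromSpec.appLE U ⊤ hU.fromSpec_preimage_self.ge = (ΓSpecIso Γ(S, U)).inv := by
  rw [Scheme.Hom.appLE, hU.fromSpec_app_self, Category.assoc, ← Functor.map_comp]
  exact (congr_arg _ ((Spec Γ(S, U)).presheaf.map_id _)).trans (Category.comp_id _)

lemma AlgebraicGeometry.IsAffineOpen.SpecMap_fromSpec_appLE {S : Scheme.{u}} {U : S.Opens}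
    (hU : IsAffineOpen U) {C : CommRingCat.{u}} {φ : Γ(S, U) ⟶ C} {k : Spec C ⟶ S}
    (hk : k = Spec.map φ ≫ hU.fromSpec) (h : ⊤ ≤ k ⁻¹ᵁ U) :
    k.appLE U ⊤ h = φ ≫ (ΓSpecIso C).inv := by
  subst hk
  rw [← Scheme.Hom.appLE_comp_appLE _ _ U ⊤ ⊤ hU.fromSpec_preimage_self.ge le_rfl,
    hU.fromSpec_appLE_self, ΓSpecIso_inv_naturality]
  simp [Scheme.Hom.appLE]
  rfl

namespace QCohAlgebra

variable {S : Scheme.{u}} {𝒜 : QCohAlgebra S} {n δ : ℕ}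

/-- Over a member of a suitable affine cover, the direct image of the structure sheaf of the
relative spectrum has a basis. -/
lemma IsLocallyFreeOfRank.exists_basis (h𝒜 : 𝒜.IsLocallyFreeOfRank n) (x : S) :
    ∃ U : S.affineOpens, x ∈ U.1 ∧
      Nonempty (Module.Basis (Fin n) Γ(S, U) (PushforwardSec 𝒜.toBase U)) := by
  obtain ⟨U, hxU, ⟨b⟩⟩ := h𝒜 x
  refine ⟨⟨U.1, U.2⟩, hxU, ?_⟩
  let : Algebra Γ(S, U.toOpens) (𝒜.obj.obj (.op U)) := (𝒜.unit.app (.op U)).hom.toAlgebra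
  have hpre : ⊤ = 𝒜.relSpecι U ⁻¹ᵁ 𝒜.toBase ⁻¹ᵁ U.toOpens := by
    rw [preimage_toBase, Scheme.Hom.preimage_opensRange]
  have hbij := bijective_appLE_of_isOpenImmersion (g := 𝒜.relSpecι U) (𝒜.preimage_toBase U).le hpre
  let ψ₀ : Γ(𝒜.relSpec, 𝒜.toBase ⁻¹ᵁ U.toOpens) ⟶ 𝒜.obj.obj (.op U) :=
    (𝒜.relSpecι U).appLE _ ⊤ hpre.le ≫ (ΓSpecIso (𝒜.obj.obj (.op U))).hom
  have hψ₀ : 𝒜.toBase.app U.toOpens ≫ ψ₀ = 𝒜.unit.app (.op U) := by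
    have h1 := IsAffineOpen.SpecMap_fromSpec_appLE U.2 (𝒜.relSpecι_toBase U) (by
      rw [Scheme.Hom.comp_preimage]; exact hpre.le)
    rw [Scheme.Hom.app_eq_appLE, Scheme.Hom.appLE_comp_appLE_assoc]
    refine (congr_arg (· ≫ (ΓSpecIso (𝒜.obj.obj (.op U))).hom) h1).trans ?_
    exact (Category.assoc _ _ _).trans ((congr_arg _ (Iso.inv_hom_id _)).trans (Category.comp_id _))
  let ψ : PushforwardSec 𝒜.toBase U.toOpens →ₛₗ[RingHom.id Γ(S, U.toOpens)] 𝒜.obj.obj (.op U) :=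
    { ψ₀.hom with
      map_smul' := fun r a => by
        have := ConcreteCategory.congr_hom hψ₀ r
        rw [Algebra.smul_def, Algebra.smul_def]
        exact (map_mul ψ₀.hom _ _).trans (congr_arg (· * _) this) }
  have hψ : Function.Bijective ψ := by
    have h2 : Function.Bijective (ΓSpecIso (𝒜.obj.obj (.op U))).hom.hom :=
      ConcreteCategory.bijective_of_isIso _
    exact h2.comp hbij
  exact ⟨(exists_basis_of_bijective Function.bijective_id ψ hψ b).choose⟩

variable {U : S.affineOpens} (e : Module.Basis (Fin n) Γ(S, U) (PushforwardSec 𝒜.toBase U))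

/-- The pullback to an `S`-scheme `T` of a basis of `𝒜` over `U`. -/
noncomputable def pullBasis (T : Over S) (V : T.left.affineOpens) (h : V.1 ≤ T.hom ⁻¹ᵁ U.1) :
    Module.Basis (Fin n) Γ(T.left, V) (PushforwardSec (𝒜.proj T) V) :=
  ((isAlgBaseChange_pullSec (CategoryTheory.IsPullback.of_hasPullback 𝒜.toBase T.hom) U V
    h).exists_basis e).choose

lemma pullBasis_apply (T : Over S) (V : T.left.affineOpens) (h : V.1 ≤ T.hom ⁻¹ᵁ U.1) (i : Fin n) :
    pullBasis e T V h i =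
      pullSec (CategoryTheory.IsPullback.of_hasPullback 𝒜.toBase T.hom).w h (e i) :=
  ((isAlgBaseChange_pullSec (CategoryTheory.IsPullback.of_hasPullback 𝒜.toBase T.hom) U V
    h).exists_basis e).choose_spec i

lemma pullSec_pullBasis {T T' : Over S} (g : T' ⟶ T) {V : T.left.affineOpens}
    {V' : T'.left.affineOpens} (hV : V.1 ≤ T.hom ⁻¹ᵁ U.1) (hV' : V'.1 ≤ T'.hom ⁻¹ᵁ U.1)
    (h : V'.1 ≤ g.left ⁻¹ᵁ V.1) (i : Fin n) :
    pullBasis e T' V' hV' i = pullSec (𝒜.projMap_comp_proj g) h (pullBasis e T V hV i) := by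
  rw [pullBasis_apply, pullBasis_apply]
  exact (pullSec_comp _ _ (pullback.lift_fst _ _ _) (Over.w g) _ _ _ _ _).symm

lemma le_preimage_of_le {T T' : Over S} (g : T' ⟶ T) {V : T.left.Opens} {V' : T'.left.Opens}
    {U : S.Opens} (hV : V ≤ T.hom ⁻¹ᵁ U) (h : V' ≤ g.left ⁻¹ᵁ V) : V' ≤ T'.hom ⁻¹ᵁ U := by
  rw [← Over.w g, Scheme.Hom.comp_preimage]
  exact h.trans (g.left.preimage_mono hV)

lemma resSec_pullBasis {T : Over S} {V W : T.left.affineOpens} (hV : V.1 ≤ T.hom ⁻¹ᵁ U.1)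
    (h : W.1 ≤ V.1) (i : Fin n) :
    pullBasis e T W (h.trans hV) i = resSec (𝒜.proj T) h (pullBasis e T V hV i) := by
  rw [pullBasis_apply, pullBasis_apply, resSec_pullSec]

/-! ### The locus where given sections are a basis of the quotient -/

namespace Family

variable (ι : Fin δ → Fin n)

/-- The classes of the `e (ι j)` are a basis of `𝒜_T / ℬ` over `V`. -/
def IsBasisOn {T : Over S} (ℬ : 𝒜.Family T δ) (V : T.left.affineOpens) : Prop :=
  ∃ (h : V.1 ≤ T.hom ⁻¹ᵁ U.1) (c : Module.Basis (Fin δ) Γ(T.left, V)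
    (PushforwardSec (𝒜.proj T) V ⧸ Subalgebra.toSubmodule (ℬ.sec V))),
    ∀ j, c j = Submodule.Quotient.mk (pullBasis e T V h (ι j))

variable {e ι}

lemma exists_quotient_basis_of_le {T : Over S} (ℬ : 𝒜.Family T δ) {V W : T.left.affineOpens}
    (h : W.1 ≤ V.1) (c : Module.Basis (Fin δ) Γ(T.left, V)
      (PushforwardSec (𝒜.proj T) V ⧸ Subalgebra.toSubmodule (ℬ.sec V))) :
    ∃ c' : Module.Basis (Fin δ) Γ(T.left, W)
      (PushforwardSec (𝒜.proj T) W ⧸ Subalgebra.toSubmodule (ℬ.sec W)), ∀ a i,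
      c'.repr (Submodule.Quotient.mk (resSec (𝒜.proj T) h a)) i =
        T.left.presheaf.map (homOfLE h).op (c.repr (Submodule.Quotient.mk a) i) :=
  (isAlgBaseChange_resSec V W h).exists_quotient_basis (B := Subalgebra.toSubmodule (ℬ.sec V))
    (B' := Subalgebra.toSubmodule (ℬ.sec W)) (ℬ.toSubmodule_sec_eq_span h) c

lemma IsPullback.exists_quotient_basis {T T' : Over S} {g : T' ⟶ T} {ℬ : 𝒜.Family T δ}
    {ℬ' : 𝒜.Family T' δ} (H : IsPullback g ℬ ℬ') {V : T.left.affineOpens}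
    {V' : T'.left.affineOpens} (h : V'.1 ≤ g.left ⁻¹ᵁ V.1) (c : Module.Basis (Fin δ) Γ(T.left, V)
      (PushforwardSec (𝒜.proj T) V ⧸ Subalgebra.toSubmodule (ℬ.sec V))) :
    ∃ c' : Module.Basis (Fin δ) Γ(T'.left, V')
      (PushforwardSec (𝒜.proj T') V' ⧸ Subalgebra.toSubmodule (ℬ'.sec V')), ∀ a i,
      c'.repr (Submodule.Quotient.mk (pullSec (𝒜.projMap_comp_proj g) h a)) i =
        (g.left.appLE V V' h).hom (c.repr (Submodule.Quotient.mk a) i) :=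
  QCohSubalgebra.IsPullback.exists_quotient_basis (𝒜.isPullback_projMap g) (isPullback_iff.1 H) h c

lemma IsBasisOn.of_isPullback {T T' : Over S} {g : T' ⟶ T} {ℬ : 𝒜.Family T δ}
    {ℬ' : 𝒜.Family T' δ} (H : IsPullback g ℬ ℬ') {V : T.left.affineOpens}
    {V' : T'.left.affineOpens} (h : V'.1 ≤ g.left ⁻¹ᵁ V.1) (hV : ℬ.IsBasisOn e ι V) :
    ℬ'.IsBasisOn e ι V' := by
  classical
  obtain ⟨hVU, c, hc⟩ := hV
  obtain ⟨c', hc'⟩ := H.exists_quotient_basis h c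
  have hVU' := le_preimage_of_le g hVU h
  refine ⟨hVU', c', fun j => ?_⟩
  apply c'.repr.injective
  ext k
  rw [pullSec_pullBasis e g hVU hVU' h, hc', ← hc, c.repr_self, c'.repr_self]
  simp [Finsupp.single_apply, apply_ite (g.left.appLE V V' h).hom]

lemma IsBasisOn.of_le {T : Over S} {ℬ : 𝒜.Family T δ} {V W : T.left.affineOpens}
    (h : W.1 ≤ V.1) (hV : ℬ.IsBasisOn e ι V) : ℬ.IsBasisOn e ι W :=
  hV.of_isPullback (isPullback_id ℬ) h

lemma isBasisOn_of_isUnit_det {T : Over S} {ℬ : 𝒜.Family T δ} {V : T.left.affineOpens}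
    (hV : V.1 ≤ T.hom ⁻¹ᵁ U.1) (c : Module.Basis (Fin δ) Γ(T.left, V)
      (PushforwardSec (𝒜.proj T) V ⧸ Subalgebra.toSubmodule (ℬ.sec V)))
    (hd : IsUnit (c.det fun j => Submodule.Quotient.mk (pullBasis e T V hV (ι j)))) :
    ℬ.IsBasisOn e ι V := by
  obtain ⟨hli, hsp⟩ := c.is_basis_iff_det.2 hd
  exact ⟨hV, .mk hli hsp.ge, fun j => Module.Basis.mk_apply _ _ j⟩

lemma isBasisOn_affineBasicOpen {T : Over S} {ℬ : 𝒜.Family T δ} {V : T.left.affineOpens}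
    (hV : V.1 ≤ T.hom ⁻¹ᵁ U.1) (c : Module.Basis (Fin δ) Γ(T.left, V)
      (PushforwardSec (𝒜.proj T) V ⧸ Subalgebra.toSubmodule (ℬ.sec V))) :
    ℬ.IsBasisOn e ι (T.left.affineBasicOpen
      (c.det fun j => Submodule.Quotient.mk (pullBasis e T V hV (ι j)))) := by
  set d := c.det fun j => Submodule.Quotient.mk (pullBasis e T V hV (ι j))
  have hle := T.left.affineBasicOpen_coe_le d
  obtain ⟨c', hc'⟩ := exists_quotient_basis_of_le ℬ hle c
  refine isBasisOn_of_isUnit_det (hle.trans hV) c' ?_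
  have h1 : c'.det (fun j => Submodule.Quotient.mk
      (pullBasis e T (T.left.affineBasicOpen d) (hle.trans hV) (ι j))) =
      T.left.presheaf.map (homOfLE hle).op d := by
    rw [Module.Basis.det_apply]
    refine Eq.trans ?_ ((congr_arg (T.left.presheaf.map (homOfLE hle).op).hom (c.det_apply _)).trans
      (RingHom.map_det (T.left.presheaf.map (homOfLE hle).op).hom _)).symm
    congr 1
    ext j k
    rw [Module.Basis.toMatrix_apply, resSec_pullBasis e hV hle, hc']
    rfl
  rw [h1]
  exact RingedSpace.isUnit_res_basicOpen _ d

/-- The condition that given sections are a basis near a point may be checked on a pullback: the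
determinant that expresses it is pulled back. -/
lemma IsBasisOn.exists_of_isPullback {T T' : Over S} {g : T' ⟶ T} {ℬ : 𝒜.Family T δ}
    {ℬ' : 𝒜.Family T' δ} (H : IsPullback g ℬ ℬ') {V' : T'.left.affineOpens}
    (hV' : ℬ'.IsBasisOn e ι V') {z : T'.left} (hz : z ∈ V'.1) :
    ∃ V : T.left.affineOpens, g.left z ∈ V.1 ∧ ℬ.IsBasisOn e ι V := by
  obtain ⟨V₀, hzV₀, ⟨c₀⟩⟩ := ℬ.corank (g.left z)
  have hzU : g.left z ∈ T.hom ⁻¹ᵁ U.1 := by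
    have : z ∈ T'.hom ⁻¹ᵁ U.1 := hV'.choose hz
    rw [← Over.w g, Scheme.Hom.comp_preimage] at this
    exact this
  obtain ⟨V, hzV, hV⟩ := T.left.exists_affineOpens_mem_le (U := V₀.1 ⊓ T.hom ⁻¹ᵁ U.1) ⟨hzV₀, hzU⟩
  obtain ⟨c, -⟩ := exists_quotient_basis_of_le ℬ (hV.trans inf_le_left) c₀
  have hVU := hV.trans inf_le_right
  refine ⟨_, ?_, isBasisOn_affineBasicOpen hVU c⟩
  set d := c.det fun j => Submodule.Quotient.mk (pullBasis e T V hVU (ι j)) with hd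
  obtain ⟨W, hzW, hW⟩ := T'.left.exists_affineOpens_mem_le (U := V'.1 ⊓ g.left ⁻¹ᵁ V.1) ⟨hz, hzV⟩
  have hWV := hW.trans inf_le_right
  obtain ⟨hWU, b, hb⟩ := hV'.of_le (hW.trans inf_le_left)
  obtain ⟨c', hc'⟩ := H.exists_quotient_basis hWV c
  have h1 : (g.left.appLE V W hWV).hom d = c'.det b := by
    rw [hd, Module.Basis.det_apply, Module.Basis.det_apply]
    refine (RingHom.map_det (g.left.appLE V W hWV).hom _).trans ?_
    congr 1
    ext j k
    rw [Module.Basis.toMatrix_apply, hb, pullSec_pullBasis e g hVU hWU hWV, hc']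
    rfl
  have h2 : T'.left.basicOpen ((g.left.appLE V W hWV).hom d) = W.1 := by
    rw [h1]
    exact T'.left.basicOpen_of_isUnit (c'.isUnit_det b)
  have h3 := Scheme.basicOpen_appLE g.left W.1 V.1 hWV d
  have h4 : z ∈ T'.left.basicOpen ((g.left.appLE V W hWV).hom d) := h2.ge hzW
  exact (h3.le h4).2

/-- Near every point, the quotient has a basis that consists of classes of members of the given
basis: by the expansion of a determinant, one of the maximal minors is invertible. -/
lemma exists_isBasisOn {T : Over S} (ℬ : 𝒜.Family T δ) (x : T.left) (hx : T.hom x ∈ U.1) :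
    ∃ (ι : Fin δ → Fin n) (V : T.left.affineOpens), x ∈ V.1 ∧ ℬ.IsBasisOn e ι V := by
  obtain ⟨V₀, hxV₀, ⟨c₀⟩⟩ := ℬ.corank x
  obtain ⟨V, hxV, hV⟩ := T.left.exists_affineOpens_mem_le (U := V₀.1 ⊓ T.hom ⁻¹ᵁ U.1) ⟨hxV₀, hx⟩
  obtain ⟨c, -⟩ := exists_quotient_basis_of_le ℬ (hV.trans inf_le_left) c₀
  have hVU := hV.trans inf_le_right
  let d : (Fin δ → Fin n) → Γ(T.left, V) := fun ι =>
    c.det fun j => Submodule.Quotient.mk (pullBasis e T V hVU (ι j))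
  suffices ∃ ι, x ∈ T.left.basicOpen (d ι) by
    obtain ⟨ι, hι⟩ := this
    exact ⟨ι, _, hι, isBasisOn_affineBasicOpen hVU c⟩
  have hex : ∀ j, ∃ a : Fin n → Γ(T.left, V),
      c j = ∑ i, a i • Submodule.Quotient.mk (pullBasis e T V hVU i) := fun j => by
    obtain ⟨a, ha⟩ := Submodule.Quotient.mk_surjective _ (c j)
    refine ⟨(pullBasis e T V hVU).repr a, ?_⟩
    have h1 := congr_arg (Submodule.mkQ (Subalgebra.toSubmodule (ℬ.sec V)))
      ((pullBasis e T V hVU).sum_repr a)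
    rw [map_sum] at h1
    simp only [map_smul] at h1
    exact (h1.trans ha).symm
  choose a ha using hex
  have h1 : (1 : Γ(T.left, V)) = ∑ ι : Fin δ → Fin n, (∏ j, a j (ι j)) * d ι := by
    rw [← c.det_self, show (c : Fin δ → _) = fun j => ∑ i, a j i •
      (Submodule.Quotient.mk (pullBasis e T V hVU i) : _ ⧸ Subalgebra.toSubmodule (ℬ.sec V)) from
      funext ha]
    refine (c.det.toMultilinearMap.map_sum _).trans (Finset.sum_congr rfl fun ι _ => ?_)
    exact c.det.toMultilinearMap.map_smul_univ _ _
  by_contra! hcon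
  simp only [Scheme.mem_basicOpen _ _ x hxV] at hcon
  have h2 := congr_arg (T.left.presheaf.germ V.1 x hxV).hom h1
  rw [map_one, map_sum] at h2
  refine (IsLocalRing.mem_maximalIdeal (1 : T.left.presheaf.stalk x)).1 ?_ isUnit_one
  rw [h2]
  refine Ideal.sum_mem _ fun ι _ => ?_
  rw [map_mul]
  exact Ideal.mul_mem_left _ _ ((IsLocalRing.mem_maximalIdeal _).2 (hcon ι))

end Family

end QCohAlgebra

/-! ### The charts -/

/-- An affine scheme as an affine open of itself. -/
abbrev affineTop (T : Scheme.{u}) [IsAffine T] : T.affineOpens := ⟨⊤, isAffineOpen_top T⟩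

/-- A quasi-coherent subalgebra over an affine scheme may be given by its global sections. -/
lemma QCohSubalgebra.exists_of_isAffine {X Y : Scheme.{u}} {p : X ⟶ Y} [IsAffineHom p] [IsAffine Y]
    (B₀ : Subalgebra Γ(Y, affineTop Y) (PushforwardSec p (affineTop Y).1)) :
    ∃ B : QCohSubalgebra p, B.sec (affineTop Y) = B₀ := by
  let t : Y.affineOpens := affineTop Y
  have ht : ∀ V : Y.affineOpens, V.1 ≤ t.1 := fun V => le_top
  obtain ⟨B, hB⟩ := exists_extension (p := p) (fun _ => True) (fun _ _ _ _ => trivial)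
    (fun y => ⟨t, trivial, trivial⟩) (fun V => B₀.mapSpan (resSec p (ht V)) Γ(Y, V))
    fun V W h _ => by
      have h1 : (B₀.mapSpan (resSec p (ht V)) Γ(Y, V) : Set (PushforwardSec p V)) =
          Submodule.span Γ(Y, V) (resSec p (ht V) '' B₀) := by
        rw [← Subalgebra.toSubmodule_mapSpan]
        rfl
      rw [Subalgebra.toSubmodule_mapSpan, h1, RingHom.span_image_span_of_comp_eq
        (resSec_comp_algebraMap h), Set.image_image]
      simp only [resSec_resSec]
  refine ⟨B, (hB t trivial).trans (Subalgebra.toSubmodule_injective ?_)⟩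
  rw [Subalgebra.toSubmodule_mapSpan]
  have h2 : resSec p (ht t) '' B₀ = B₀ := by
    ext s
    simp
  rw [h2]
  exact Submodule.span_eq (Subalgebra.toSubmodule B₀)

namespace QCohAlgebra

variable {S : Scheme.{u}} {𝒜 : QCohAlgebra S} {n δ : ℕ} {U : S.affineOpens}
  (e : Module.Basis (Fin n) Γ(S, U) (PushforwardSec 𝒜.toBase U)) (ι : Fin δ → Fin n)

/-- The space of subalgebras of `𝒜_T` such that the classes of the `e (ι j)` are a basis of the
quotient. -/
noncomputable abbrev chart : Scheme.{u} := Spec (.of (ChartRing e ι))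

/-- The structure morphism of a chart. -/
noncomputable def chartHom : chart e ι ⟶ S :=
  Spec.map (CommRingCat.ofHom (algebraMap Γ(S, U) (ChartRing e ι))) ≫ U.2.fromSpec

lemma top_le_chartHom_preimage : ⊤ ≤ chartHom e ι ⁻¹ᵁ U.1 := by
  rw [chartHom, Scheme.Hom.comp_preimage, U.2.fromSpec_preimage_self]
  exact le_rfl

/-- The identification of the global functions on a chart. -/
noncomputable abbrev chartFunction : ChartRing e ι →+* Γ(chart e ι, ⊤) :=
  (ΓSpecIso (.of (ChartRing e ι))).inv.hom

lemma chartHom_appLE :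
    ((chartHom e ι).appLE U ⊤ (top_le_chartHom_preimage e ι)).hom =
      (chartFunction e ι).comp (algebraMap Γ(S, U) (ChartRing e ι)) :=
  congr_arg CommRingCat.Hom.hom (IsAffineOpen.SpecMap_fromSpec_appLE U.2 rfl _)

/-- The universal family on a chart. -/
lemma exists_chartFamily : ∃ (𝒰 : 𝒜.Family (Over.mk (chartHom e ι)) δ)
    (c : Module.Basis (Fin δ) Γ(chart e ι, affineTop (chart e ι))
      (PushforwardSec (𝒜.proj (Over.mk (chartHom e ι))) (affineTop (chart e ι)).1 ⧸
        Subalgebra.toSubmodule (𝒰.sec (affineTop (chart e ι))))),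
    (∀ j, c j = Submodule.Quotient.mk (pullBasis e (Over.mk (chartHom e ι)) (affineTop (chart e ι))
      (top_le_chartHom_preimage e ι) (ι j))) ∧
    ∀ j i, quotientMatrix (pullBasis e (Over.mk (chartHom e ι)) (affineTop (chart e ι))
      (top_le_chartHom_preimage e ι)) c j i = chartFunction e ι (chartMatrix e ι j i) := by
  let T : Over S := Over.mk (chartHom e ι)
  let t : T.left.affineOpens := affineTop (chart e ι)
  have htop : t.1 ≤ T.hom ⁻¹ᵁ U.1 := top_le_chartHom_preimage e ι
  have hrel := ChartRing.chartRelations_eq_zero ι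
    (pullSec_comp_algebraMap (CategoryTheory.IsPullback.of_hasPullback 𝒜.toBase T.hom).w htop)
    (pullBasis_apply e T t htop) (chartFunction e ι) (chartHom_appLE e ι).symm
  obtain ⟨B₀, c, hc, hc'⟩ := exists_subalgebra_of_chartRelations hrel
  have : IsAffine T.left := inferInstanceAs (IsAffine (chart e ι))
  obtain ⟨B, hB⟩ := QCohSubalgebra.exists_of_isAffine (p := 𝒜.proj T) B₀
  subst hB
  refine ⟨⟨B, fun x => ⟨t, trivial, ⟨c⟩⟩⟩, c, hc, fun j i => ?_⟩
  exact (hc' _ j).trans (congr_fun (coordMap_basis _ _ i) j)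

/-- The universal family on a chart, as a family over the chart. -/
noncomputable def chartFamily : 𝒜.FamilyOver δ (chart e ι) :=
  ⟨chartHom e ι, (exists_chartFamily e ι).choose⟩

lemma chartFamily_isBasisOn :
    (chartFamily e ι).family.IsBasisOn e ι (affineTop (chart e ι)) :=
  ⟨top_le_chartHom_preimage e ι, (exists_chartFamily e ι).choose_spec.choose,
    (exists_chartFamily e ι).choose_spec.choose_spec.1⟩

variable {e ι}

/-- Between affine schemes, families with a distinguished basis of the quotient are pullbacks of one
another if their matrices are. -/
lemma Family.isPullback_iff_quotientMatrix {T T' : Over S} [IsAffine T.left] [IsAffine T'.left]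
    (g : T' ⟶ T) {ℬ : 𝒜.Family T δ} {ℬ' : 𝒜.Family T' δ}
    (hU : (affineTop T.left).1 ≤ T.hom ⁻¹ᵁ U.1) (hU' : (affineTop T'.left).1 ≤ T'.hom ⁻¹ᵁ U.1)
    (c : Module.Basis (Fin δ) Γ(T.left, affineTop T.left)
      (PushforwardSec (𝒜.proj T) (affineTop T.left).1 ⧸
        Subalgebra.toSubmodule (ℬ.sec (affineTop T.left))))
    (hc : ∀ j, c j = Submodule.Quotient.mk (pullBasis e T (affineTop T.left) hU (ι j)))
    (c' : Module.Basis (Fin δ) Γ(T'.left, affineTop T'.left)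
      (PushforwardSec (𝒜.proj T') (affineTop T'.left).1 ⧸
        Subalgebra.toSubmodule (ℬ'.sec (affineTop T'.left))))
    (hc' : ∀ j, c' j = Submodule.Quotient.mk (pullBasis e T' (affineTop T'.left) hU' (ι j))) :
    IsPullback g ℬ ℬ' ↔ ∀ j i, (g.left.appLE ⊤ ⊤ le_top).hom
      (quotientMatrix (pullBasis e T (affineTop T.left) hU) c j i) =
        quotientMatrix (pullBasis e T' (affineTop T'.left) hU') c' j i := by
  have hle : (affineTop T'.left).1 ≤ g.left ⁻¹ᵁ (affineTop T.left).1 := le_top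
  have h1 := toSubmodule_eq_span_iff
    (isAlgBaseChange_pullSec (𝒜.isPullback_projMap g) (affineTop T.left) (affineTop T'.left) hle)
    (pullSec_pullBasis e g hU hU' hle) c hc c' hc'
  refine Iff.trans ⟨fun H => H _ _ hle, fun H => ?_⟩ h1
  exact QCohSubalgebra.IsPullback.of_local fun y => ⟨_, _, hle, trivial, H⟩

/-- On an affine scheme, a morphism to a chart is given by the matrix of a family. -/
lemma isPullback_chartFamily_iff {T : Scheme.{u}} [IsAffine T] (ξ : 𝒜.FamilyOver δ T)
    (hU : ⊤ ≤ ξ.hom ⁻¹ᵁ U.1) (c : Module.Basis (Fin δ) Γ(T, affineTop T)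
      (PushforwardSec (𝒜.proj (Over.mk ξ.hom)) (affineTop T).1 ⧸
        Subalgebra.toSubmodule (ξ.family.sec (affineTop T))))
    (hc : ∀ j, c j = Submodule.Quotient.mk
      (pullBasis e (Over.mk ξ.hom) (affineTop T) hU (ι j)))
    (a : T ⟶ chart e ι) : FamilyOver.IsPullback a (chartFamily e ι) ξ ↔
      a ≫ chartHom e ι = ξ.hom ∧
      ∀ j i, (a.appLE ⊤ ⊤ le_top).hom (chartFunction e ι (chartMatrix e ι j i)) =
        quotientMatrix (pullBasis e (Over.mk ξ.hom) (affineTop T) hU) c j i := by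
  obtain ⟨hc₀, hK⟩ := (exists_chartFamily e ι).choose_spec.choose_spec
  have : IsAffine (Over.mk (chartHom e ι)).left := inferInstanceAs (IsAffine (chart e ι))
  have : IsAffine (Over.mk ξ.hom).left := inferInstanceAs (IsAffine T)
  have key := fun w : a ≫ chartHom e ι = ξ.hom => Family.isPullback_iff_quotientMatrix
    (Over.homMk a w : Over.mk ξ.hom ⟶ Over.mk (chartHom e ι)) (ℬ' := ξ.family)
    (top_le_chartHom_preimage e ι) hU _ hc₀ c hc
  simp only [hK] at key
  exact ⟨fun ⟨w, h⟩ => ⟨w, (key w).1 h⟩, fun ⟨w, h⟩ => ⟨w, (key w).2 h⟩⟩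

/-- A family on an affine scheme for which the classes of the `e (ι j)` are a basis of the quotient
is the pullback of the universal family on the chart along a unique morphism. -/
lemma existsUnique_isPullback_chartFamily {T : Scheme.{u}} [IsAffine T] (ξ : 𝒜.FamilyOver δ T)
    (h : ξ.family.IsBasisOn e ι (affineTop T)) :
    ∃! a : T ⟶ chart e ι, FamilyOver.IsPullback a (chartFamily e ι) ξ := by
  obtain ⟨hU, c, hc⟩ := h
  have hU' : ⊤ ≤ ξ.hom ⁻¹ᵁ U.1 := hU
  have key := isPullback_chartFamily_iff ξ hU' c hc
  let f := ξ.hom.appLE U ⊤ hU'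
  have hf : T.toSpecΓ ≫ Spec.map f ≫ U.2.fromSpec = ξ.hom := by
    rw [IsAffineOpen.SpecMap_appLE_fromSpec ξ.hom U.2 (isAffineOpen_top T) hU',
      IsAffineOpen.fromSpec_top, ← Scheme.isoSpec_hom, Iso.hom_inv_id_assoc]
  have hfun : ∀ a : T ⟶ chart e ι, a ≫ chartHom e ι = ξ.hom →
      ((a.appLE ⊤ ⊤ le_top).hom.comp (chartFunction e ι)).comp
        (algebraMap Γ(S, U) (ChartRing e ι)) = f.hom := by
    intro a ha
    have h1 := Scheme.Hom.appLE_comp_appLE a (chartHom e ι) U.1 ⊤ ⊤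
      (top_le_chartHom_preimage e ι) le_top
    simp only [ha] at h1
    rw [RingHom.comp_assoc, ← chartHom_appLE]
    exact congr_arg CommRingCat.Hom.hom h1
  obtain ⟨g, hg, hgK⟩ := ChartRing.exists_hom ι
    (pullSec_comp_algebraMap (CategoryTheory.IsPullback.of_hasPullback 𝒜.toBase
      (Over.mk ξ.hom).hom).w hU) (pullBasis_apply e (Over.mk ξ.hom) (affineTop T) hU)
    (quotientMatrix (pullBasis e (Over.mk ξ.hom) (affineTop T) hU) c)
    (chartRelations_quotientMatrix c hc)
  let a : T ⟶ chart e ι := T.toSpecΓ ≫ Spec.map (CommRingCat.ofHom g)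
  have happ : ∀ x, (a.appLE ⊤ ⊤ le_top).hom (chartFunction e ι x) = g x := by
    have h1 : (ΓSpecIso (.of (ChartRing e ι))).inv ≫ a.appLE ⊤ ⊤ le_top = CommRingCat.ofHom g := by
      have h2 : a.appLE ⊤ ⊤ le_top = a.appTop := (Scheme.Hom.app_eq_appLE (f := a)).symm
      rw [h2, Scheme.Hom.comp_appTop, ← ΓSpecIso_inv_naturality_assoc, Scheme.toSpecΓ_appTop,
        Iso.inv_hom_id, Category.comp_id]
    exact fun x => ConcreteCategory.congr_hom h1 x
  refine ⟨a, (key a).2 ⟨?_, fun j i => ?_⟩, fun a' ha' => ?_⟩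
  · rw [← hf, chartHom, Category.assoc, ← Spec.map_comp_assoc]
    congr 3
    ext r
    exact RingHom.congr_fun hg r
  · rw [happ, hgK]
  · obtain ⟨h1, h2⟩ := (key a').1 ha'
    have h3 : (a'.appLE ⊤ ⊤ le_top).hom.comp (chartFunction e ι) = g := by
      apply ChartRing.hom_ext
      · rw [hfun a' h1]
        exact hg.symm
      · intro j i
        rw [RingHom.comp_apply, h2, hgK]
    apply ext_of_isAffine
    rw [← cancel_epi (ΓSpecIso (.of (ChartRing e ι))).inv]
    have h4 : ∀ b : T ⟶ chart e ι, b.appLE ⊤ ⊤ le_top = b.appTop := fun b =>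
      (Scheme.Hom.app_eq_appLE (f := b)).symm
    rw [← h4, ← h4]
    apply CommRingCat.hom_ext
    refine RingHom.ext fun x => ?_
    exact (RingHom.congr_fun h3 x).trans (happ x).symm

end QCohAlgebra

/-! ### Representability -/

namespace QCohAlgebra

variable {S : Scheme.{u}} {𝒜 : QCohAlgebra S} {n δ : ℕ} {U : S.affineOpens}
  (e : Module.Basis (Fin n) Γ(S, U) (PushforwardSec 𝒜.toBase U)) (ι : Fin δ → Fin n)

namespace FamilyOver

/-- The open locus where the classes of the `e (ι j)` are locally a basis of the quotient. -/
def basisLocus {T : Scheme.{u}} (ξ : 𝒜.FamilyOver δ T) : T.Opens :=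
  ⨆ V : {V : T.affineOpens // ξ.family.IsBasisOn e ι V}, V.1.1

variable {e ι}

lemma mem_basisLocus {T : Scheme.{u}} {ξ : 𝒜.FamilyOver δ T} {x : T} :
    x ∈ ξ.basisLocus e ι ↔ ∃ V : T.affineOpens, x ∈ V.1 ∧ ξ.family.IsBasisOn e ι V := by
  rw [basisLocus, TopologicalSpace.Opens.mem_iSup]
  exact ⟨fun ⟨V, hV⟩ => ⟨V.1, hV, V.2⟩, fun ⟨V, hV, h⟩ => ⟨⟨V, h⟩, hV⟩⟩

lemma mem_basisLocus_iff_of_isPullback {T T' : Scheme.{u}} {g : T' ⟶ T} {ξ : 𝒜.FamilyOver δ T}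
    {ξ' : 𝒜.FamilyOver δ T'} (h : IsPullback g ξ ξ') (z : T') :
    z ∈ ξ'.basisLocus e ι ↔ g z ∈ ξ.basisLocus e ι := by
  rw [mem_basisLocus, mem_basisLocus]
  constructor
  · rintro ⟨V', hz, hV'⟩
    exact hV'.exists_of_isPullback h.2 hz
  · rintro ⟨V, hz, hV⟩
    obtain ⟨V', hzV', hV'⟩ := T'.exists_affineOpens_mem_le (U := g ⁻¹ᵁ V.1) (y := z) hz
    exact ⟨V', hzV', hV.of_isPullback h.2 hV'⟩

lemma mem_basisLocus_chartFamily (z : chart e ι) : z ∈ (chartFamily e ι).basisLocus e ι :=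
  mem_basisLocus.2 ⟨affineTop (chart e ι), trivial, chartFamily_isBasisOn e ι⟩

/-- Restriction to an affine open, as a family on an affine scheme. -/
lemma isBasisOn_affineTop {T T' : Scheme.{u}} [IsAffine T'] {g : T' ⟶ T} {ξ : 𝒜.FamilyOver δ T}
    {ξ' : 𝒜.FamilyOver δ T'} (h : IsPullback g ξ ξ') {V : T.affineOpens} (hg : ⊤ ≤ g ⁻¹ᵁ V.1)
    (hV : ξ.family.IsBasisOn e ι V) : ξ'.family.IsBasisOn e ι (affineTop T') :=
  hV.of_isPullback h.2 hg

/-- A morphism to a chart is determined by the pullback of the universal family. -/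
lemma eq_of_pull_chartFamily_eq {T : Scheme.{u}} {a b : T ⟶ chart e ι}
    (h : pull a (chartFamily e ι) = pull b (chartFamily e ι)) : a = b := by
  refine T.affineCover.hom_ext _ _ fun j => ?_
  have h1 : pull (T.affineCover.f j ≫ a) (chartFamily e ι) =
      pull (T.affineCover.f j ≫ b) (chartFamily e ι) := by
    rw [pull_comp, pull_comp, h]
  have h2 := isPullback_pull (T.affineCover.f j ≫ a) (chartFamily e ι)
  exact (existsUnique_isPullback_chartFamily _
    (isBasisOn_affineTop h2 le_top (chartFamily_isBasisOn e ι))).unique h2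
    (h1 ▸ isPullback_pull (T.affineCover.f j ≫ b) (chartFamily e ι))

lemma exists_hom_chart {T : Scheme.{u}} (ξ : 𝒜.FamilyOver δ T) (h : ξ.basisLocus e ι = ⊤) :
    ∃ a : T ⟶ chart e ι, pull a (chartFamily e ι) = ξ := by
  let 𝒲 : T.OpenCover := T.openCoverOfIsOpenCover
    (fun V : {V : T.affineOpens // ξ.family.IsBasisOn e ι V} => V.1.1) (.mk h)
  have hex : ∀ V : 𝒲.I₀, ∃ a : 𝒲.X V ⟶ chart e ι,
      pull a (chartFamily e ι) = pull (𝒲.f V) ξ := fun V => by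
    let V' : {V : T.affineOpens // ξ.family.IsBasisOn e ι V} := V
    have : IsAffine (𝒲.X V) := V'.1.2
    have h1 := isPullback_pull (𝒲.f V) ξ
    obtain ⟨a, ha, -⟩ := existsUnique_isPullback_chartFamily _
      (isBasisOn_affineTop h1 (V'.1.1.ι_preimage_self).ge V'.2)
    exact ⟨a, pull_eq_iff.2 ha⟩
  choose a ha using hex
  have hglue : ∀ V W, pullback.fst (𝒲.f V) (𝒲.f W) ≫ a V = pullback.snd _ _ ≫ a W := by
    intro V W
    apply eq_of_pull_chartFamily_eq
    rw [pull_comp, pull_comp, ha, ha, ← pull_comp, ← pull_comp, pullback.condition]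
  refine ⟨𝒲.glueMorphisms a hglue, eq_of_openCover 𝒲 fun V => ?_⟩
  rw [← pull_comp, 𝒲.ι_glueMorphisms, ha]

end FamilyOver

/-- The morphism from a chart to the functor of families. -/
noncomputable def chartMap : yoneda.obj (chart e ι) ⟶ 𝒜.familyFunctor δ :=
  yonedaEquiv.symm (chartFamily e ι)

lemma chartMap_app {T : Scheme.{u}} (a : T ⟶ chart e ι) :
    (chartMap e ι).app (.op T) a = FamilyOver.pull a (chartFamily e ι) :=
  rfl

lemma isOpenImmersion_chartMap : IsOpenImmersion.presheaf (chartMap e ι) := by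
  refine MorphismProperty.relative.of_exists fun T g => ?_
  let ξ : 𝒜.FamilyOver δ T := yonedaEquiv g
  have hg : ∀ {Z : Scheme.{u}} (b : Z ⟶ T), g.app (.op Z) b = FamilyOver.pull b ξ := by
    intro Z b
    have := ConcreteCategory.congr_hom (g.naturality b.op) (𝟙 T)
    refine Eq.trans ?_ this
    exact congr_arg _ (Category.comp_id b).symm
  let W := ξ.basisLocus e ι
  have hW : (FamilyOver.pull W.ι ξ).basisLocus e ι = ⊤ := by
    ext z
    simp only [TopologicalSpace.Opens.coe_top, Set.mem_univ, iff_true]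
    exact (FamilyOver.mem_basisLocus_iff_of_isPullback (FamilyOver.isPullback_pull W.ι ξ) z).2 z.2
  obtain ⟨a, ha⟩ := FamilyOver.exists_hom_chart _ hW
  refine ⟨W.toScheme, yoneda.map a, W.ι, ?_, inferInstance⟩
  refine IsPullback.of_forall_isPullback_app fun Z => ?_
  rw [Types.isPullback_iff]
  refine ⟨?_, fun x y h => ?_, fun (b : Z.unop ⟶ chart e ι) (c : Z.unop ⟶ T) hbc => ?_⟩
  · ext z
    refine (chartMap_app e ι (z ≫ a)).trans (Eq.trans ?_ (hg (z ≫ W.ι)).symm)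
    rw [FamilyOver.pull_comp, ha, ← FamilyOver.pull_comp]
  · exact (cancel_mono W.ι).1 h.2
  · have hbc' : FamilyOver.pull b (chartFamily e ι) = FamilyOver.pull c ξ := hbc.trans (hg c)
    have hrange : Set.range c ⊆ Set.range W.ι := by
      rw [Scheme.Opens.range_ι]
      rintro _ ⟨z, rfl⟩
      have h1 := FamilyOver.isPullback_pull b (chartFamily e ι)
      have h2 := FamilyOver.isPullback_pull c ξ
      rw [← hbc'] at h2
      exact (FamilyOver.mem_basisLocus_iff_of_isPullback h2 z).1
        ((FamilyOver.mem_basisLocus_iff_of_isPullback h1 z).2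
          (FamilyOver.mem_basisLocus_chartFamily _))
    let l := IsOpenImmersion.lift W.ι c hrange
    have hl : l ≫ W.ι = c := IsOpenImmersion.lift_fac _ _ _
    refine ⟨l, ?_, hl⟩
    apply FamilyOver.eq_of_pull_chartFamily_eq
    refine (FamilyOver.pull_comp _ _ _).trans ?_
    rw [ha, ← FamilyOver.pull_comp, hl, hbc']

variable (𝒜 n δ)

/-- The index type of the charts. -/
abbrev ChartIndex : Type u :=
  Σ U : S.affineOpens, Module.Basis (Fin n) Γ(S, U) (PushforwardSec 𝒜.toBase U) × (Fin δ → Fin n)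

variable {𝒜 n} in
lemma isLocallySurjective_chartMap (h𝒜 : 𝒜.IsLocallyFreeOfRank n) :
    Presheaf.IsLocallySurjective zariskiTopology
      (Sigma.desc fun i : 𝒜.ChartIndex n δ => chartMap i.2.1 i.2.2) where
  imageSieve_mem := by
    intro T (ξ : 𝒜.FamilyOver δ T)
    have hex : ∀ x : T, ∃ (i : 𝒜.ChartIndex n δ), x ∈ ξ.basisLocus i.2.1 i.2.2 := by
      intro x
      obtain ⟨U, hU, ⟨e⟩⟩ := h𝒜.exists_basis (ξ.hom x)
      obtain ⟨ι, V, hxV, hV⟩ := ξ.family.exists_isBasisOn (e := e) x hU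
      exact ⟨⟨U, e, ι⟩, FamilyOver.mem_basisLocus.2 ⟨V, hxV, hV⟩⟩
    let 𝒲 : T.OpenCover := T.openCoverOfIsOpenCover
      (fun i : 𝒜.ChartIndex n δ => ξ.basisLocus i.2.1 i.2.2) (.mk (by
        rw [eq_top_iff]
        exact fun x _ => TopologicalSpace.Opens.mem_iSup.2 (hex x)))
    refine zariskiTopology.superset_covering ?_ 𝒲.mem_grothendieckTopology
    rw [Sieve.generate_le_iff]
    rintro _ _ ⟨i⟩
    have hW : (FamilyOver.pull (𝒲.f i) ξ).basisLocus i.2.1 i.2.2 = ⊤ := by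
      ext z
      simp only [TopologicalSpace.Opens.coe_top, Set.mem_univ, iff_true]
      exact (FamilyOver.mem_basisLocus_iff_of_isPullback
        (FamilyOver.isPullback_pull (𝒲.f i) ξ) z).2 z.2
    obtain ⟨a, ha⟩ := FamilyOver.exists_hom_chart _ hW
    refine ⟨(Sigma.ι (fun i : 𝒜.ChartIndex n δ => yoneda.obj (chart i.2.1 i.2.2)) i).app _ a, ?_⟩
    have h1 := Sigma.ι_desc (fun i : 𝒜.ChartIndex n δ => chartMap i.2.1 i.2.2) i
    have h2 := congr_arg (fun k => k.app (.op (𝒲.X i)) a) h1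
    exact h2.trans ha

variable {𝒜 n} in
/-- The functor of families is representable by a locally Noetherian scheme. -/
lemma exists_universal_familyOver (hS : IsLocallyNoetherian S) (h𝒜 : 𝒜.IsLocallyFreeOfRank n) :
    ∃ (Z : Scheme.{u}) (η : 𝒜.FamilyOver δ Z), IsLocallyNoetherian Z ∧
      ∀ (T : Scheme.{u}) (ξ : 𝒜.FamilyOver δ T), ∃! a : T ⟶ Z, FamilyOver.IsPullback a η ξ := by
  let F : Sheaf zariskiTopology.{u} (Type u) := ⟨𝒜.familyFunctor δ, 𝒜.isSheaf_familyFunctor δ⟩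
  let f : ∀ i : 𝒜.ChartIndex n δ, yoneda.obj (chart i.2.1 i.2.2) ⟶ F.1 :=
    fun i => chartMap i.2.1 i.2.2
  have hf : ∀ i, IsOpenImmersion.presheaf (f i) := fun i => isOpenImmersion_chartMap i.2.1 i.2.2
  have : Presheaf.IsLocallySurjective zariskiTopology (Sigma.desc f) :=
    isLocallySurjective_chartMap δ h𝒜
  let Z : Scheme.{u} := (LocalRepresentability.glueData hf).glued
  let R : (𝒜.familyFunctor δ).RepresentableBy Z :=
    LocalRepresentability.representableBy (F := F) hf
  let η : 𝒜.FamilyOver δ Z := R.homEquiv (𝟙 Z)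
  refine ⟨Z, η, ?_, fun T ξ => ?_⟩
  · rw [isLocallyNoetherian_iff_openCover (LocalRepresentability.glueData hf).openCover]
    intro i
    have : IsNoetherianRing Γ(S, i.1) := IsLocallyNoetherian.component_noetherian i.1
    have : IsNoetherianRing (ChartRing i.2.1 i.2.2) := inferInstance
    exact inferInstanceAs (IsLocallyNoetherian (Spec (.of (ChartRing i.2.1 i.2.2))))
  · have h : ∀ a : T ⟶ Z, FamilyOver.IsPullback a η ξ ↔ R.homEquiv a = ξ := by
      intro a
      rw [← FamilyOver.pull_eq_iff]
      have := R.homEquiv_eq a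
      exact ⟨fun h => this.trans h, fun h => this.symm.trans h⟩
    simp only [h]
    exact R.homEquiv.bijective.existsUnique ξ

variable {𝒜 n} in
theorem exists_isTerritory (hS : IsLocallyNoetherian S) (h𝒜 : 𝒜.IsLocallyFreeOfRank n) :
    ∃ (Ter : Over S) (𝒰 : 𝒜.Family Ter δ), 𝒜.IsTerritory Ter 𝒰 := by
  obtain ⟨Z, η, hZ, h⟩ := exists_universal_familyOver δ hS h𝒜
  refine ⟨Over.mk η.hom, η.family, hZ, trivial, fun T _ k => ?_, fun T _ ℬ _ => ?_,
    fun T T' _ _ g k ℬ ℬ' h₁ h₂ => h₁.of_comp h₂⟩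
  · obtain ⟨ℬ, hℬ⟩ := Family.exists_isPullback k η.family
    exact ⟨ℬ, ⟨trivial, hℬ⟩, fun ℬ' h' => h'.2.unique hℬ⟩
  · obtain ⟨a, ⟨ha, ha'⟩, hu⟩ := h T.left ⟨T.hom, ℬ⟩
    refine ⟨Over.homMk a ha, ha', fun k hk => ?_⟩
    ext : 1
    refine hu k.left ⟨Over.w k, ?_⟩
    exact hk

end QCohAlgebra

/-! ### Pullback of ideal sheaves -/

namespace AlgebraicGeometry.Scheme.IdealSheafData

variable {X Y : Scheme.{u}}

lemma _root_.AlgebraicGeometry.Scheme.eq_zero_of_locally {U : X.Opens} (s : Γ(X, U))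
    (h : ∀ x ∈ U, ∃ (V : X.Opens) (hV : V ≤ U), x ∈ V ∧ X.presheaf.map (homOfLE hV).op s = 0) :
    s = 0 := by
  choose V hV hxV h0 using h
  refine X.sheaf.eq_of_locally_eq' (fun x : U => V x x.2) U (fun x => homOfLE (hV x x.2))
    (fun x hx => TopologicalSpace.Opens.mem_iSup.2 ⟨⟨x, hx⟩, hxV x hx⟩) _ _ fun x => ?_
  exact (h0 x x.2).trans (map_zero (X.presheaf.map (homOfLE (hV x x.2)).op).hom).symm

lemma map_ideal_appLE_le (J : Y.IdealSheafData) (f : X ⟶ Y) (V : Y.affineOpens)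
    (V' : X.affineOpens) (h : V'.1 ≤ f ⁻¹ᵁ V.1) :
    (J.ideal V).map (f.appLE V V' h).hom ≤ (J.comap f).ideal V' := by
  rw [Ideal.map_le_iff_le_comap]
  intro s hs
  rw [Ideal.mem_comap, ← ker_subschemeι_app, RingHom.mem_ker]
  have h1 : ((J.comap f).subschemeι ≫ f).app V s = 0 :=
    Hom.ideal_ker_le _ V (J.le_map_comap f V hs)
  have h2 := congr_arg (((J.comap f).subscheme.presheaf.map
    (homOfLE ((J.comap f).subschemeι.preimage_mono h)).op).hom) h1
  refine Eq.trans ?_ (h2.trans (map_zero _))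
  change (f.appLE V V' h ≫ (J.comap f).subschemeι.app V') s =
    (((J.comap f).subschemeι ≫ f).app V ≫ (J.comap f).subscheme.presheaf.map _) s
  rw [Scheme.Hom.app_eq_appLE, Scheme.Hom.appLE_comp_appLE]
  rfl

/-- The pullback of an ideal sheaf may be computed on affine opens. -/
lemma comap_eq_of_forall_exists (J : Y.IdealSheafData) (f : X ⟶ Y) (J' : X.IdealSheafData)
    (H : ∀ x : X, ∃ (V : Y.affineOpens) (V' : X.affineOpens) (h : V'.1 ≤ f ⁻¹ᵁ V.1), x ∈ V'.1 ∧
      J'.ideal V' = (J.ideal V).map (f.appLE V V' h).hom) : J' = J.comap f := by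
  choose V V' h hx hJ using H
  apply le_antisymm
  · refine le_of_iSup_eq_top V' (eq_top_iff.2 fun x _ =>
      TopologicalSpace.Opens.mem_iSup.2 ⟨x, hx x⟩) fun x => ?_
    rw [hJ]
    exact map_ideal_appLE_le _ _ _ _ _
  · rw [← le_map_iff_comap_le, map, Hom.ker, le_ofIdeals_iff]
    intro U s hs
    rw [RingHom.mem_ker]
    refine eq_zero_of_locally _ fun z hz => ?_
    set x := J'.subschemeι z
    have hxU : f x ∈ U.1 := hz
    obtain ⟨W, hyW, hW⟩ := Y.exists_affineOpens_mem_le (U := U.1 ⊓ (V x).1)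
      ⟨hxU, h x (hx x)⟩
    obtain ⟨W', hxW', hW'⟩ := X.exists_affineOpens_mem_le (U := (V' x).1 ⊓ f ⁻¹ᵁ W.1)
      ⟨hx x, hyW⟩
    have hWU : W.1 ≤ U.1 := hW.trans inf_le_left
    have hWV : W.1 ≤ (V x).1 := hW.trans inf_le_right
    have hWV' : W'.1 ≤ (V' x).1 := hW'.trans inf_le_left
    have hWW : W'.1 ≤ f ⁻¹ᵁ W.1 := hW'.trans inf_le_right
    have h1 : f.appLE U W' (hWW.trans (f.preimage_mono hWU)) s ∈ J'.ideal W' := by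
      have h2 : (J.ideal W).map (f.appLE W W' hWW).hom ≤ J'.ideal W' := by
        rw [← J.map_ideal hWV, ← J'.map_ideal hWV', hJ, Ideal.map_map, Ideal.map_map,
          ← CommRingCat.hom_comp, ← CommRingCat.hom_comp, Scheme.Hom.map_appLE,
          Scheme.Hom.appLE_map]
      rw [← Scheme.Hom.map_appLE f hWW (homOfLE hWU).op]
      exact h2 (Ideal.mem_map_of_mem _ (J.ideal_le_comap_ideal hWU hs))
    refine ⟨J'.subschemeι ⁻¹ᵁ W'.1,
      J'.subschemeι.preimage_mono (hWW.trans (f.preimage_mono hWU)), hxW', ?_⟩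
    rw [← ker_subschemeι_app, RingHom.mem_ker] at h1
    refine Eq.trans ?_ h1
    change ((J'.subschemeι ≫ f).app U ≫ J'.subscheme.presheaf.map _) s =
      (f.appLE U W' _ ≫ J'.subschemeι.app W') s
    rw [Scheme.Hom.app_eq_appLE (f := J'.subschemeι), Scheme.Hom.appLE_comp_appLE]
    rfl

end AlgebraicGeometry.Scheme.IdealSheafData

/-- The endomorphisms of a free module of rank `δ` are generated by `δ²` elements. -/
lemma fittingIdeal_quotient_end {R M : Type*} [CommRing R] [AddCommGroup M] [Module R M] {δ : ℕ}
    (c : Module.Basis (Fin δ) R M) (N : Submodule R (Module.End R M)) :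
    fittingIdeal R (Module.End R M ⧸ N) ((δ : ℤ) ^ 2) = ⊤ := by
  let b : Module.Basis (Fin (δ * δ)) R (Module.End R M) := c.end.reindex finProdFinEquiv
  rw [fittingIdeal_eq_relMinors (m := 0) (N.mkQ ∘ b) ?_ (by push_cast; ring), relMinors_zero]
  rw [Set.range_comp, ← Submodule.map_span, b.span_eq, Submodule.map_top, Submodule.range_mkQ]

/-! ### Fitting ideal sheaves of a family -/

namespace QCohAlgebra.Family

variable {S : Scheme.{u}} {𝒜 : QCohAlgebra S} {δ : ℕ} {T T' : Over S}

/-- The sections of `Δ` over every affine open are finitely generated, not only over the members of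
a suitable cover. -/
lemma finite_quotient (ℬ : 𝒜.Family T δ) (V : T.left.affineOpens) :
    Module.Finite Γ(T.left, V)
      (PushforwardSec (𝒜.proj T) V ⧸ Subalgebra.toSubmodule (ℬ.sec V)) := by
  let t : Set Γ(T.left, V) := {f | Module.Finite Γ(T.left, T.left.affineBasicOpen f)
    (PushforwardSec (𝒜.proj T) (T.left.affineBasicOpen f).1 ⧸
      Subalgebra.toSubmodule (ℬ.sec (T.left.affineBasicOpen f)))}
  have ht : Ideal.span t = ⊤ := by
    rw [← V.2.self_le_iSup_basicOpen_iff]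
    intro x hx
    obtain ⟨U, hxU, ⟨c⟩⟩ := ℬ.corank x
    obtain ⟨f, hxf, hf⟩ := T.left.exists_affineBasicOpen_le V hx hxU
    obtain ⟨c', -⟩ := ℬ.exists_quotient_basis_of_le hf c
    exact TopologicalSpace.Opens.mem_iSup.2 ⟨⟨f, Module.Finite.of_basis c'⟩, hxf⟩
  let r : ∀ f : t, Γ(T.left, V) →+* Γ(T.left, T.left.affineBasicOpen f.1) := fun f =>
    (T.left.presheaf.map (homOfLE (T.left.affineBasicOpen_coe_le f.1)).op).hom
  have hq : ∀ f : t, ∃ (_ : Algebra Γ(T.left, V) Γ(T.left, T.left.affineBasicOpen f.1))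
      (_ : Module Γ(T.left, V) (PushforwardSec (𝒜.proj T) (T.left.affineBasicOpen f.1).1 ⧸
        Subalgebra.toSubmodule (ℬ.sec (T.left.affineBasicOpen f.1))))
      (_ : IsScalarTower Γ(T.left, V) Γ(T.left, T.left.affineBasicOpen f.1)
        (PushforwardSec (𝒜.proj T) (T.left.affineBasicOpen f.1).1 ⧸
        Subalgebra.toSubmodule (ℬ.sec (T.left.affineBasicOpen f.1))))
      (_ : IsLocalization.Away f.1 Γ(T.left, T.left.affineBasicOpen f.1))
      (q : (PushforwardSec (𝒜.proj T) V ⧸ Subalgebra.toSubmodule (ℬ.sec V)) →ₗ[Γ(T.left, V)]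
        (PushforwardSec (𝒜.proj T) (T.left.affineBasicOpen f.1).1 ⧸
        Subalgebra.toSubmodule (ℬ.sec (T.left.affineBasicOpen f.1)))),
      IsLocalizedModule.Away f.1 q := by
    intro f
    have hle := T.left.affineBasicOpen_coe_le f.1
    obtain ⟨w, h⟩ := isAlgBaseChange_resSec (p := 𝒜.proj T) V (T.left.affineBasicOpen f.1) hle
    let a1 : Algebra Γ(T.left, V) Γ(T.left, T.left.affineBasicOpen f.1) := (r f).toAlgebra
    let := ((algebraMap Γ(T.left, T.left.affineBasicOpen f.1)
      (PushforwardSec (𝒜.proj T) (T.left.affineBasicOpen f.1).1)).comp (r f)).toAlgebra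
    have : IsScalarTower Γ(T.left, V) Γ(T.left, T.left.affineBasicOpen f.1)
      (PushforwardSec (𝒜.proj T) (T.left.affineBasicOpen f.1).1) := .of_algebraMap_eq' rfl
    have hq := h.quotientMapOfSpan (B := Subalgebra.toSubmodule (ℬ.sec V))
      (B' := Subalgebra.toSubmodule (ℬ.sec (T.left.affineBasicOpen f.1)))
      (ℬ.toSubmodule_sec_eq_span hle)
    have hl : IsLocalization.Away f.1 Γ(T.left, T.left.affineBasicOpen f.1) :=
      isLocalizationAway_restrict V f.1
    have : IsLocalization (Submonoid.powers f.1) Γ(T.left, T.left.affineBasicOpen f.1) := hl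
    exact ⟨a1, inferInstance, inferInstance, hl, _,
      (isLocalizedModule_iff_isBaseChange (Submonoid.powers f.1) _ _).2 hq⟩
  choose _ _ _ _ q hq using hq
  exact Module.Finite.of_localizationSpan' t ht q fun f => f.2

instance (ℬ : 𝒜.Family T δ) [IsLocallyNoetherian T.left] (V : T.left.affineOpens) :
    Module.Finite Γ(T.left, V) (ℬ.sec V).CokerMulQuotient := by
  have := ℬ.finite_quotient V
  have : IsNoetherianRing Γ(T.left, V) := IsLocallyNoetherian.component_noetherian V
  infer_instance

lemma fittingIdealSheaf_ideal (ℬ : 𝒜.Family T δ) [IsLocallyNoetherian T.left] (k : ℤ)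
    (V : T.left.affineOpens) :
    (ℬ.fittingIdealSheaf k).ideal V = fittingIdeal Γ(T.left, V) (ℬ.sec V).CokerMulQuotient k := by
  let J : T.left.IdealSheafData :=
    { ideal := fun V => fittingIdeal Γ(T.left, V) (ℬ.sec V).CokerMulQuotient k
      map_ideal_basicOpen := fun U f => by
        have hle := T.left.affineBasicOpen_coe_le f
        have := ℬ.finite_quotient U
        have : IsNoetherianRing Γ(T.left, U) := IsLocallyNoetherian.component_noetherian U
        refine ((isAlgBaseChange_resSec (p := 𝒜.proj T) U (T.left.affineBasicOpen f)
          hle).fittingIdeal_of_flat (ℬ.toSubmodule_sec_eq_span hle) ?_ k).symm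
        let := (T.left.presheaf.map (homOfLE hle).op).hom.toAlgebra
        have : IsLocalization.Away f Γ(T.left, T.left.affineBasicOpen f) :=
          isLocalizationAway_restrict U f
        exact IsLocalization.flat _ (Submonoid.powers f) }
  exact congr($(IdealSheafData.ofIdeals_ideal J).ideal V)

/-- The formation of the Fitting ideal sheaves commutes with pullback. -/
lemma IsPullback.fittingIdealSheaf_eq_comap [IsLocallyNoetherian T.left]
    [IsLocallyNoetherian T'.left] {g : T' ⟶ T} {ℬ : 𝒜.Family T δ} {ℬ' : 𝒜.Family T' δ}
    (H : IsPullback g ℬ ℬ') (k : ℤ) :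
    ℬ'.fittingIdealSheaf k = (ℬ.fittingIdealSheaf k).comap g.left := by
  refine IdealSheafData.comap_eq_of_forall_exists _ _ _ fun x => ?_
  obtain ⟨V, hV, ⟨c⟩⟩ := ℬ.corank (g.left x)
  obtain ⟨V', hV', h⟩ := T'.left.exists_affineOpens_mem_le (U := g.left ⁻¹ᵁ V.1) (y := x) hV
  refine ⟨V, V', h, hV', ?_⟩
  rw [fittingIdealSheaf_ideal, fittingIdealSheaf_ideal]
  exact (isAlgBaseChange_pullSec (𝒜.isPullback_projMap g) V V' h).fittingIdeal_of_basis
    (H V V' h) c k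

lemma fittingIdealSheaf_mono (ℬ : 𝒜.Family T δ) [IsLocallyNoetherian T.left] :
    Monotone ℬ.fittingIdealSheaf := fun k l hkl V => by
  rw [fittingIdealSheaf_ideal, fittingIdealSheaf_ideal]
  exact fittingIdeal_mono hkl

lemma fittingIdealSheaf_eq_bot_of_neg (ℬ : 𝒜.Family T δ) [IsLocallyNoetherian T.left] {k : ℤ}
    (hk : k < 0) : ℬ.fittingIdealSheaf k = ⊥ := by
  ext V : 2
  rw [fittingIdealSheaf_ideal, fittingIdeal_eq_bot_of_neg hk]
  rfl

lemma fittingIdealSheaf_sq (ℬ : 𝒜.Family T δ) [IsLocallyNoetherian T.left] :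
    ℬ.fittingIdealSheaf ((δ : ℤ) ^ 2) = ⊤ := by
  choose V hV c using ℬ.corank
  refine top_le_iff.1 (IdealSheafData.le_of_iSup_eq_top V (eq_top_iff.2 fun x _ =>
    TopologicalSpace.Opens.mem_iSup.2 ⟨x, hV x⟩) fun x => ?_)
  obtain ⟨c⟩ := c x
  rw [fittingIdealSheaf_ideal]
  exact (fittingIdeal_quotient_end c _).ge

/-- On a locally Noetherian base, the cokernel of `ℬ → Hom(Δ, Δ)` is locally free of rank `r` if and
only if its Fitting ideals satisfy `Fit_{r-1} = 0` and `Fit_r = 1`. -/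
lemma hasDeltaPrime_iff (ℬ : 𝒜.Family T δ) [IsLocallyNoetherian T.left] (δ' : ℕ) :
    ℬ.HasDeltaPrime δ' ↔ ℬ.fittingIdealSheaf ((δ : ℤ) ^ 2 - δ' - 1) = ⊥ ∧
      ℬ.fittingIdealSheaf ((δ : ℤ) ^ 2 - δ') = ⊤ := by
  constructor
  · intro h
    choose V hV r hr b using h
    have hsup : ⨆ x, (V x).1 = ⊤ :=
      eq_top_iff.2 fun x _ => TopologicalSpace.Opens.mem_iSup.2 ⟨x, hV x⟩
    have hr' : ∀ x, (δ : ℤ) ^ 2 - δ' = r x := fun x => by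
      have := hr x
      zify at this
      omega
    refine ⟨le_bot_iff.1 (IdealSheafData.le_of_iSup_eq_top V hsup fun x => ?_),
      top_le_iff.1 (IdealSheafData.le_of_iSup_eq_top V hsup fun x => ?_)⟩
    · obtain ⟨b⟩ := b x
      rw [fittingIdealSheaf_ideal, hr' x, fittingIdeal_basis_eq_bot b]
      exact bot_le
    · obtain ⟨b⟩ := b x
      rw [fittingIdealSheaf_ideal, hr' x, fittingIdeal_basis_eq_top b]
      exact le_top
  · rintro ⟨h₁, h₂⟩ x
    have hle : δ' ≤ δ ^ 2 := by
      by_contra! hlt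
      have hneg : (δ : ℤ) ^ 2 - δ' < 0 := by
        zify at hlt
        omega
      rw [fittingIdealSheaf_eq_bot_of_neg ℬ hneg] at h₂
      have hx : x ∈ (⊥ : T.left.IdealSheafData).support := by
        rw [IdealSheafData.support_bot]
        trivial
      rw [h₂, IdealSheafData.support_top] at hx
      exact hx
    obtain ⟨r, hr⟩ := Nat.exists_eq_add_of_le hle
    have hr' : (δ : ℤ) ^ 2 - δ' = r := by
      zify at hr
      omega
    obtain ⟨V, hxV, ⟨c⟩⟩ := ℬ.corank x
    have h₁' := fittingIdealSheaf_ideal ℬ ((δ : ℤ) ^ 2 - δ' - 1) V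
    have h₂' := fittingIdealSheaf_ideal ℬ ((δ : ℤ) ^ 2 - δ') V
    rw [h₁, hr'] at h₁'
    rw [h₂, hr'] at h₂'
    obtain ⟨f, hf, hb⟩ := exists_notMem_nonempty_basis_of_fittingIdeal r h₁'.symm h₂'.symm
      (V.2.primeIdealOf ⟨x, hxV⟩).asIdeal
    have hxf : x ∈ T.left.basicOpen f := by
      have h1 : V.2.primeIdealOf ⟨x, hxV⟩ ∈ V.2.fromSpec ⁻¹ᵁ T.left.basicOpen f := by
        rw [V.2.fromSpec_preimage_basicOpen]
        exact hf
      have h2 : V.2.fromSpec (V.2.primeIdealOf ⟨x, hxV⟩) ∈ T.left.basicOpen f := h1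
      rwa [V.2.fromSpec_primeIdealOf] at h2
    refine ⟨T.left.affineBasicOpen f, hxf, r, by omega, ?_⟩
    have hle := T.left.affineBasicOpen_coe_le f
    obtain ⟨w, h⟩ := isAlgBaseChange_resSec (p := 𝒜.proj T) V (T.left.affineBasicOpen f) hle
    let φ := (T.left.presheaf.map (homOfLE hle).op).hom
    let := φ.toAlgebra
    let := ((algebraMap Γ(T.left, T.left.affineBasicOpen f)
      (PushforwardSec (𝒜.proj T) (T.left.affineBasicOpen f).1)).comp φ).toAlgebra
    have : IsScalarTower Γ(T.left, V) Γ(T.left, T.left.affineBasicOpen f)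
      (PushforwardSec (𝒜.proj T) (T.left.affineBasicOpen f).1) := .of_algebraMap_eq' rfl
    obtain ⟨l, hl⟩ := h.exists_cokerMulQuotient_of_basis c (ℬ.toSubmodule_sec_eq_span hle)
    exact hb _ _ l hl (RingedSpace.isUnit_res_basicOpen _ f)

end QCohAlgebra.Family

/-! ### Fitting strata -/

namespace AlgebraicGeometry.Scheme.IdealSheafData

variable {X Y : Scheme.{u}}

lemma range_ι_comp_subschemeι (I : Y.IdealSheafData) (U : Y.Opens) :
    Set.range ((I.subschemeι ⁻¹ᵁ U).ι ≫ I.subschemeι) = (U : Set Y) ∩ I.support := by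
  rw [Scheme.Hom.comp_base, TopCat.coe_comp, Set.range_comp, Scheme.Opens.range_ι]
  change _ '' (I.subschemeι ⁻¹' _) = _
  rw [Set.image_preimage_eq_inter_range, range_subschemeι]
  rfl

/-- A morphism factors through an open subscheme of the closed subscheme `V(I)` if and only if the
pullback of `I` vanishes and its image is contained in the open subset. -/
lemma exists_comp_ι_comp_subschemeι_iff (I : Y.IdealSheafData) (U : Y.Opens) (f : X ⟶ Y) :
    (∃ l, l ≫ (I.subschemeι ⁻¹ᵁ U).ι ≫ I.subschemeι = f) ↔ I.comap f = ⊥ ∧ ∀ x, f x ∈ U := by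
  rw [← le_bot_iff, ← le_map_iff_comap_le, map_bot]
  constructor
  · rintro ⟨l, rfl⟩
    refine ⟨?_, fun x => (l x).2⟩
    rw [← Category.assoc]
    nth_rw 1 [← I.ker_subschemeι]
    exact Scheme.Hom.le_ker_comp _ _
  · rintro ⟨hk, hU⟩
    let a : X ⟶ I.subscheme := IsClosedImmersion.lift I.subschemeι f (by rwa [ker_subschemeι])
    have ha : a ≫ I.subschemeι = f := IsClosedImmersion.lift_fac _ _ _
    refine ⟨IsOpenImmersion.lift (I.subschemeι ⁻¹ᵁ U).ι a ?_, ?_⟩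
    · rw [Scheme.Opens.range_ι]
      rintro _ ⟨x, rfl⟩
      change (a ≫ I.subschemeι) x ∈ U
      rw [ha]
      exact hU x
    · rw [IsOpenImmersion.lift_fac_assoc, ha]

end AlgebraicGeometry.Scheme.IdealSheafData

namespace QCohAlgebra.Family

variable {S : Scheme.{u}} {𝒜 : QCohAlgebra S} {δ : ℕ} {T T' : Over S}

instance (ℬ : 𝒜.Family T δ) (δ' : ℕ) : IsImmersion (ℬ.stratumι δ').left :=
  inferInstanceAs (IsImmersion (((ℬ.stratumClosure δ').subschemeι ⁻¹ᵁ ℬ.stratumOpen δ').ι ≫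
    (ℬ.stratumClosure δ').subschemeι))

instance (ℬ : 𝒜.Family T δ) (δ' : ℕ) : Mono (ℬ.stratumι δ') :=
  Over.mono_of_mono_left _

lemma isLocallyNoetherian_stratum (ℬ : 𝒜.Family T δ) [IsLocallyNoetherian T.left] (δ' : ℕ) :
    IsLocallyNoetherian (ℬ.stratum δ').left :=
  LocallyOfFiniteType.isLocallyNoetherian (ℬ.stratumι δ').left

lemma mem_range_stratumι (ℬ : 𝒜.Family T δ) (δ' : ℕ) (x : T.left) :
    x ∈ Set.range (ℬ.stratumι δ').left ↔
      x ∈ (ℬ.fittingIdealSheaf ((δ : ℤ) ^ 2 - δ' - 1)).support ∧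
        x ∉ (ℬ.fittingIdealSheaf ((δ : ℤ) ^ 2 - δ')).support :=
  (Set.ext_iff.1 ((ℬ.stratumClosure δ').range_ι_comp_subschemeι (ℬ.stratumOpen δ')) x).trans
    and_comm

/-- The Fitting stratum represents the condition that `Fit_{r-1}` vanishes and `Fit_r` is the unit
ideal after pullback. -/
lemma exists_comp_stratumι_iff (ℬ : 𝒜.Family T δ) (δ' : ℕ) (g : T' ⟶ T) :
    (∃ l, l ≫ ℬ.stratumι δ' = g) ↔
      (ℬ.fittingIdealSheaf ((δ : ℤ) ^ 2 - δ' - 1)).comap g.left = ⊥ ∧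
        (ℬ.fittingIdealSheaf ((δ : ℤ) ^ 2 - δ')).comap g.left = ⊤ := by
  have h : (ℬ.fittingIdealSheaf ((δ : ℤ) ^ 2 - δ')).comap g.left = ⊤ ↔
      ∀ x, g.left x ∈ ℬ.stratumOpen δ' := by
    rw [← IdealSheafData.support_eq_bot_iff, IdealSheafData.support_comap,
      TopologicalSpace.Closeds.ext_iff, TopologicalSpace.Closeds.coe_preimage,
      TopologicalSpace.Closeds.coe_bot, Set.eq_empty_iff_forall_notMem]
    rfl
  rw [h]
  refine Iff.trans ?_ ((ℬ.stratumClosure δ').exists_comp_ι_comp_subschemeι_iff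
    (ℬ.stratumOpen δ') g.left)
  constructor
  · rintro ⟨l, rfl⟩
    exact ⟨l.left, rfl⟩
  · rintro ⟨b, hb⟩
    let b' : T'.left ⟶ (ℬ.stratum δ').left := b
    have hb' : b' ≫ (ℬ.stratumι δ').left = g.left := hb
    refine ⟨Over.homMk b' ?_, Over.OverMorphism.ext hb'⟩
    rw [← Over.w (ℬ.stratumι δ'), ← Over.w g, ← hb', Category.assoc]

lemma IsPullback.hasDeltaPrime_iff [IsLocallyNoetherian T.left] [IsLocallyNoetherian T'.left]
    {g : T' ⟶ T} {ℬ : 𝒜.Family T δ} {ℬ' : 𝒜.Family T' δ} (H : IsPullback g ℬ ℬ') (δ' : ℕ) :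
    ℬ'.HasDeltaPrime δ' ↔ ∃ l, l ≫ ℬ.stratumι δ' = g := by
  rw [exists_comp_stratumι_iff, Family.hasDeltaPrime_iff, H.fittingIdealSheaf_eq_comap,
    H.fittingIdealSheaf_eq_comap]

lemma pairwise_disjoint_range_stratumι (ℬ : 𝒜.Family T δ) [IsLocallyNoetherian T.left] :
    Pairwise fun δ₁ δ₂ : ℕ => Disjoint (Set.range (ℬ.stratumι δ₁).left)
      (Set.range (ℬ.stratumι δ₂).left) := by
  have key : ∀ δ₁ δ₂ : ℕ, δ₁ < δ₂ → Disjoint (Set.range (ℬ.stratumι δ₁).left)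
      (Set.range (ℬ.stratumι δ₂).left) := fun δ₁ δ₂ h => by
    rw [Set.disjoint_left]
    intro x hx hx'
    rw [mem_range_stratumι] at hx hx'
    -- `Fit_{r₂} ⊆ Fit_{r₁ - 1}`, as `r₂ ≤ r₁ - 1`
    exact hx'.2 (IdealSheafData.support_antitone (ℬ.fittingIdealSheaf_mono (by omega)) hx.1)
  exact fun δ₁ δ₂ h => h.lt_or_gt.elim (key _ _) fun h' => (key _ _ h').symm

lemma iUnion_range_stratumι (ℬ : 𝒜.Family T δ) [IsLocallyNoetherian T.left] :
    ⋃ δ' : ℕ, Set.range (ℬ.stratumι δ').left = Set.univ := by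
  classical
  refine Set.eq_univ_of_forall fun x => ?_
  have hx : x ∉ (ℬ.fittingIdealSheaf (δ ^ 2 : ℕ)).support := by
    rw [Nat.cast_pow, fittingIdealSheaf_sq, IdealSheafData.support_top]
    exact id
  have hex : ∃ s : ℕ, x ∉ (ℬ.fittingIdealSheaf s).support := ⟨_, hx⟩
  -- `s` is the least number of generators of `Q` at `x`
  let s := Nat.find hex
  have hs : s ≤ δ ^ 2 := Nat.find_min' hex hx
  obtain ⟨δ', hδ'⟩ := Nat.exists_eq_add_of_le hs
  have hr : (δ : ℤ) ^ 2 - δ' = s := by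
    zify at hδ'
    omega
  refine Set.mem_iUnion.2 ⟨δ', ?_⟩
  rw [mem_range_stratumι, hr]
  refine ⟨?_, Nat.find_spec hex⟩
  rcases Nat.eq_zero_or_pos s with h0 | h0
  · rw [fittingIdealSheaf_eq_bot_of_neg ℬ (by omega), IdealSheafData.support_bot]
    trivial
  · have := not_not.1 (Nat.find_min hex (m := s - 1) (by omega))
    rwa [Nat.cast_sub h0, Nat.cast_one] at this

end QCohAlgebra.Family

namespace QCohAlgebra

variable {S : Scheme.{u}} {𝒜 : QCohAlgebra S} {δ : ℕ}

/-- A subfunctor that is cut out by the factorization through a monomorphism into the representing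
scheme is represented by the source of the monomorphism. -/
lemma IsTerritory.represents_of_mono {Z W : Over S} {𝒰 : 𝒜.Family Z δ} (h : 𝒜.IsTerritory Z 𝒰)
    {P : ∀ T : Over S, 𝒜.Family T δ → Prop} (i : W ⟶ Z) [Mono i] (hW : IsLocallyNoetherian W.left)
    (hP : ∀ (T : Over S), IsLocallyNoetherian T.left → ∀ (g : T ⟶ Z) (ℬ : 𝒜.Family T δ),
      Family.IsPullback g 𝒰 ℬ → (P T ℬ ↔ ∃ l, l ≫ i = g))
    {𝒱 : 𝒜.Family W δ} (hi : Family.IsPullback i 𝒰 𝒱) : 𝒜.Represents P W 𝒱 where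
  isLocallyNoetherian := hW
  prop := (hP W hW i 𝒱 hi).2 ⟨𝟙 W, Category.id_comp i⟩
  existsUnique_pullback T hT g := by
    obtain ⟨ℬ, hℬ⟩ := Family.exists_isPullback g 𝒱
    exact ⟨ℬ, ⟨(hP T hT (g ≫ i) ℬ (hi.comp hℬ)).2 ⟨g, rfl⟩, hℬ⟩, fun ℬ' h' => h'.2.unique hℬ⟩
  existsUnique_hom T hT ℬ hℬ := by
    obtain ⟨k, hk, hu⟩ := h.existsUnique_hom T hT ℬ trivial
    obtain ⟨l, rfl⟩ := (hP T hT k ℬ hk).1 hℬ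
    exact ⟨l, hi.of_comp hk, fun l' hl' => (cancel_mono i).1 (hu _ (hi.comp hl'))⟩
  natural _ _ _ _ _ _ _ _ h₁ h₂ := h₁.of_comp h₂

end QCohAlgebra

theorem mainTheorem6 (S : Scheme.{u}) (hS : IsLocallyNoetherian S) (𝒜 : QCohAlgebra S) (n : ℕ)
    (h𝒜 : 𝒜.IsLocallyFreeOfRank n) (δ : ℕ) :
    (∃ (Ter : Over S) (𝒰 : 𝒜.Family Ter δ), 𝒜.IsTerritory Ter 𝒰) ∧
    ∀ (Ter : Over S) (𝒰 : 𝒜.Family Ter δ), 𝒜.IsTerritory Ter 𝒰 →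
      (∀ δ' : ℕ, IsImmersion (𝒰.stratumι δ').left ∧
        ∃ 𝒰' : 𝒜.Family (𝒰.stratum δ') δ,
          QCohAlgebra.Family.IsPullback (𝒰.stratumι δ') 𝒰 𝒰' ∧
          𝒜.Represents (fun _ ℬ => ℬ.HasDeltaPrime δ') (𝒰.stratum δ') 𝒰') ∧
      (Pairwise fun δ₁ δ₂ : ℕ => Disjoint (Set.range (𝒰.stratumι δ₁).left)
        (Set.range (𝒰.stratumι δ₂).left)) ∧
      (⋃ δ' : ℕ, Set.range (𝒰.stratumι δ').left) = Set.univ := by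
  refine ⟨𝒜.exists_isTerritory δ hS h𝒜, fun Ter 𝒰 h => ?_⟩
  have : IsLocallyNoetherian Ter.left := h.isLocallyNoetherian
  refine ⟨fun δ' => ⟨inferInstance, ?_⟩, 𝒰.pairwise_disjoint_range_stratumι,
    𝒰.iUnion_range_stratumι⟩
  obtain ⟨𝒰', h𝒰'⟩ := QCohAlgebra.Family.exists_isPullback (𝒰.stratumι δ') 𝒰
  exact ⟨𝒰', h𝒰', h.represents_of_mono _ (𝒰.isLocallyNoetherian_stratum δ')
    (fun _ _ _ _ hg => hg.hasDeltaPrime_iff δ') h𝒰'⟩
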